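/- **Conventions.** $\mu$ is the uniform (fair coin) measure on $\{0,1\}^\omega$; for a string $\sigma$, $[\sigma]$ is the set of $X\in\{0,1\}^\omega$ extending $\sigma$; $X{\upharpoonright}m$ is the initial segment of $X$ of length $m$. A function on strings is in FPSPACE if it is computed by a Turing machine (with a read-only input tape, work tapes and a write-only output tape) which halts on every input, uses space on its work tapes polynomially bounded in the length of the input, and whose output has length polynomially bounded in the length of the input. PTIME functions are those computed by such machines in polynomial time. A *PSPACE test* $(U_n)_{n\ge 0}$ is given by an FPSPACE function $G:\{1\}^*\times\{0,1\}^*\to\{0,1\}$ and a PTIME function $f:\{1\}^*\to\{1\}^*$ that is strictly length increasing, such that for every $n$ the set $U_n=\bigcup_{\tau\in G_n}[\tau]$ has $\mu(U_n)\le 2^{-n}$, where $G_n=\{\tau\in\{0,1\}^{\le |f(1^n)|}: G(1^n,\tau)=1\}$. The test is *weak* if moreover $\mu(U_{n+1}\cap[\sigma])\le\frac12\mu([\sigma])$ for all $n$ and all $\sigma\in G_n$. A sequence $X$ *passes* the test if $X\notin U_n$ for some $n$. $X$ is *Martin-Löf BPS random* if it passes every PSPACE test, and *weakly Martin-Löf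 BPS random* if it passes every weak PSPACE test. A *martingale* is a function $d:\{0,1\}^*\to\mathbb{Q}\cap[0,\infty)$ with $d(\emptyset)=1$ and $d(\sigma)=\frac12\bigl(d(\sigma0)+d(\sigma1)\bigr)$ for all $\sigma$. It is an *FPSPACE martingale* if some FPSPACE function maps every $\sigma$ to a code of $d(\sigma)$, where a code of a rational $q\ge 0$ is a finite string $u2v$ over $\{0,1,2\}$ such that $u,v\in\{0,1\}^*$ and $u.v$ is a binary expansion of $q$. $X$ is *martingale BPS random* if there are no FPSPACE martingale $d$ and PTIME function $f:\{1\}^*\to\{1\}^*$ such that $d(X{\upharpoonright}|f(1^n)|)\ge 2^n$ for all $n$. **Theorem.** For every $X\in\{0,1\}^\omega$ the following are equivalent: 1. $X$ is Martin-Löf BPS random. 2. $X$ is weakly Martin-Löf BPS random. 3. $X$ is martingale BPS random. Moreover, every PSPACE test can be converted into a weak one: for every PSPACE test $(U_n)_{n\ge0}$ there is a weak PSPACE test $(V_n)_{n\ge0}$ with $\bigcap_n V_n=\bigcap_n U_n$, so that a sequence passes one of the two tests if and only if it passes the other. -/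

import Mathlib

namespace BPS

/-! ### Turing machines with a read-only input tape, work tapes and a write-only output tape -/

/-- A head movement. -/
inductive Move where
  | left
  | stay
  | right

/-- A deterministic Turing machine with input alphabet `α` and output alphabet `β`: a finite
control, a two-way read-only input tape, `tapes` many read-write work tapes over a finite
alphabet `Sym`, and a write-only output tape. In one step the machine reads the symbol under the
input head (`none` is the end marker) and the symbols under the work heads; it either halts (`none`)
or enters a new state, moves the input head, writes on and moves on each work tape, and writes
at most one symbol on the output tape. -/
structure Machine (α β : Type) where
  State : Type
  finite_state : Finite State
  Sym : Type
  finite_sym : Finite Sym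
  blank : Sym
  tapes : ℕ
  start : State
  δ : State → Option α → (Fin tapes → Sym) →
    Option (State × Move × (Fin tapes → Sym × Move) × Option β)

/-- A configuration. The work tapes are infinite to the right, with cells numbered by `ℕ`. -/
structure Config {α β : Type} (M : Machine α β) where
  state : M.State
  inputHead : ℕ
  head : Fin M.tapes → ℕ
  tape : Fin M.tapes → ℕ → M.Sym
  output : List β

/-- Moving a work head; a left move in the leftmost cell has no effect. -/
def Move.apply : Move → ℕ → ℕ
  | .left, i => i - 1
  | .stay, i => i
  | .right, i => i + 1

/-- The input tape holds `x` between two end markers: cell `0` and cell `|x| + 1` hold the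
end marker `none`, and cell `i + 1` holds the `i`-th symbol of `x`. -/
def readInput {α : Type} (x : List α) : ℕ → Option α
  | 0 => none
  | i + 1 => x[i]?

namespace Machine

variable {α β : Type} (M : Machine α β)

/-- The initial configuration: blank work tapes, all heads in cell `0`. -/
def initial : Config M where
  state := M.start
  inputHead := 0
  head := fun _ => 0
  tape := fun _ _ => M.blank
  output := []

/-- The instruction that applies to a configuration on input `x`; `none` means halt. -/
def next (x : List α) (c : Config M) :
    Option (M.State × Move × (Fin M.tapes → M.Sym × Move) × Option β) :=
  M.δ c.state (readInput x c.inputHead) (fun i => c.tape i (c.head i))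

/-- The machine halts in configuration `c` on input `x`. -/
def Halted (x : List α) (c : Config M) : Prop := M.next x c = none

/-- One step on input `x`; a halted configuration is left unchanged. The input head never leaves
the cells `0, …, |x| + 1`. -/
def step (x : List α) (c : Config M) : Config M :=
  match M.next x c with
  | none => c
  | some (q, mv, act, o) =>
    { state := q
      inputHead := min (mv.apply c.inputHead) (x.length + 1)
      head := fun i => (act i).2.apply (c.head i)
      tape := fun i => Function.update (c.tape i) (c.head i) (act i).1
      output := c.output ++ o.toList }

/-- The configuration after `t` steps on input `x`. -/
def run (x : List α) (t : ℕ) : Config M := (M.step x)^[t] M.initial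

/-- Within `t` steps the machine halts on input `x`, with `y` on its output tape. -/
def OutputsWithin (x : List α) (y : List β) (t : ℕ) : Prop :=
  M.Halted x (M.run x t) ∧ (M.run x t).output = y

/-- On input `x` the machine visits only the first `s` cells of each of its work tapes. -/
def UsesSpace (x : List α) (s : ℕ) : Prop :=
  ∀ (t : ℕ) (i : Fin M.tapes), (M.run x t).head i < s

end Machine

/-- `F` is computable in polynomial time. -/
def PTime {α β : Type} (F : List α → List β) : Prop :=
  ∃ (M : Machine α β) (p : Polynomial ℕ),
    ∀ x, M.OutputsWithin x (F x) (p.eval x.length)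

/-- `F` is computable by a machine that halts on all inputs and whose work tapes are
polynomially bounded in the length of the input, and the length of `F x` is polynomially bounded
in the length of `x`. -/
def FPSpace {α β : Type} (F : List α → List β) : Prop :=
  (∃ (M : Machine α β) (p : Polynomial ℕ),
    ∀ x, (∃ t, M.OutputsWithin x (F x) t) ∧ M.UsesSpace x (p.eval x.length)) ∧
  ∃ q : Polynomial ℕ, ∀ x, (F x).length ≤ q.eval x.length

/-! ### Strings, sequences and the uniform measure -/

/-- The string `1ⁿ`. The set `{1}*` is `List Unit`. -/
def ones (n : ℕ) : List Unit := List.replicate n ()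

/-- The length of `f(1ⁿ)`. -/
def lengthAt (f : List Unit → List Unit) (n : ℕ) : ℕ := (f (ones n)).length

/-- The initial segment of `X` of length `m`. -/
def initSeg (X : ℕ → Bool) (m : ℕ) : List Bool := List.ofFn fun i : Fin m => X i

/-- The cylinder `[σ]` of all infinite sequences that extend `σ`. -/
def cylinder (σ : List Bool) : Set (ℕ → Bool) := {X | initSeg X σ.length = σ}

/-- The uniform (fair coin) probability measure on the space of infinite binary sequences. -/
noncomputable def uniformMeasure : MeasureTheory.Measure (ℕ → Bool) :=
  MeasureTheory.Measure.infinitePi fun _ : ℕ => (PMF.uniformOfFintype Bool).toMeasure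

/-! ### Tests -/

/-- The pair `(1ⁿ, τ)` as the input string `1ⁿ0τ`. -/
def pairCode (u : List Unit) (τ : List Bool) : List Bool :=
  List.replicate u.length true ++ false :: τ

/-- `G : {1}* × {0,1}* → {0,1}` is polynomial space computable. -/
def FPSpacePredicate (G : List Unit → List Bool → Bool) : Prop :=
  ∃ F : List Bool → List Bool, FPSpace F ∧ ∀ u τ, F (pairCode u τ) = [G u τ]

/-- The set of strings `Gₙ = {τ : |τ| ≤ |f(1ⁿ)|, G(1ⁿ, τ) = 1}`. -/
def testStrings (G : List Unit → List Bool → Bool) (f : List Unit → List Unit) (n : ℕ) :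
    Set (List Bool) :=
  {τ | τ.length ≤ lengthAt f n ∧ G (ones n) τ = true}

/-- The clopen set `Uₙ = [Gₙ]`. -/
def testSet (G : List Unit → List Bool → Bool) (f : List Unit → List Unit) (n : ℕ) :
    Set (ℕ → Bool) :=
  ⋃ τ ∈ testStrings G f n, cylinder τ

/-- `(G, f)` specifies a PSPACE test. -/
structure IsPSpaceTest (G : List Unit → List Bool → Bool) (f : List Unit → List Unit) :
    Prop where
  fpspace : FPSpacePredicate G
  ptime : PTime f
  strictMono : StrictMono (lengthAt f)
  measure_le : ∀ n, uniformMeasure (testSet G f n) ≤ (1 / 2) ^ n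

/-- `(G, f)` specifies a weak PSPACE test. -/
structure IsWeakPSpaceTest (G : List Unit → List Bool → Bool) (f : List Unit → List Unit) : Prop
    extends IsPSpaceTest G f where
  weak : ∀ n, ∀ σ ∈ testStrings G f n,
    uniformMeasure (testSet G f (n + 1) ∩ cylinder σ) ≤ 1 / 2 * uniformMeasure (cylinder σ)

/-- `X` passes the test `(G, f)`: it lies outside some `Uₙ`. -/
def Passes (X : ℕ → Bool) (G : List Unit → List Bool → Bool) (f : List Unit → List Unit) :
    Prop :=
  ∃ n, X ∉ testSet G f n

/-- Martin-Löf BPS randomness. -/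
def MLRandom (X : ℕ → Bool) : Prop :=
  ∀ G f, IsPSpaceTest G f → Passes X G f

/-- Weak Martin-Löf BPS randomness. -/
def WeaklyMLRandom (X : ℕ → Bool) : Prop :=
  ∀ G f, IsWeakPSpaceTest G f → Passes X G f

/-! ### Martingales -/

/-- A martingale `d : {0,1}* → ℚ ∩ [0, ∞)` with `d(∅) = 1`. -/
structure IsMartingale (d : List Bool → ℚ) : Prop where
  nonneg : ∀ σ, 0 ≤ d σ
  empty : d [] = 1
  fair : ∀ σ, d σ = (d (σ ++ [false]) + d (σ ++ [true])) / 2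

/-- The natural number with binary expansion `u`, most significant digit first. -/
def binVal (u : List Bool) : ℕ := u.foldl (fun m b => 2 * m + b.toNat) 0

/-- A binary digit as a symbol of the ternary alphabet `{0,1,2}`. -/
def digit (b : Bool) : Fin 3 := if b then 1 else 0

/-- The ternary string `w` is a code `u2v` of the rational number `q`, where `u.v` is a
(finite) binary expansion of `q`. -/
def IsRatCode (w : List (Fin 3)) (q : ℚ) : Prop :=
  ∃ u v : List Bool, w = u.map digit ++ 2 :: v.map digit ∧
    q = binVal u + binVal v / 2 ^ v.length

/-- `d` is an FPSPACE martingale: a code of `d(σ)` is polynomial space computable from `σ`. -/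
def IsFPSpaceMartingale (d : List Bool → ℚ) : Prop :=
  IsMartingale d ∧
    ∃ F : List Bool → List (Fin 3), FPSpace F ∧ ∀ σ, IsRatCode (F σ) (d σ)

/-- `d` succeeds on `X`, with a polynomial time computable bound. -/
def Succeeds (d : List Bool → ℚ) (X : ℕ → Bool) : Prop :=
  ∃ f : List Unit → List Unit, PTime f ∧ ∀ n, 2 ^ n ≤ d (initSeg X (lengthAt f n))

/-- Martingale BPS randomness. -/
def MartingaleRandom (X : ℕ → Bool) : Prop :=
  ∀ d, IsFPSpaceMartingale d → ¬ Succeeds d X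

end BPS

/-! The probabilistic core is short. Let `d` be a martingale, and let the `n`-th component of a test
consist of the strings at which `d` first reaches `4 ^ n`. By Ville's inequality (`ville`) its
measure is at most `4⁻ⁿ`. A martingale at most doubles in one step, so such a string `σ` has `d σ ≤
2 * 4 ^ n`, and Ville's inequality inside `[σ]` bounds the conditional measure of the next component
by `2 * 4 ^ n / 4 ^ (n + 1) = 1 / 2`. Thus the test is automatically weak (`IsMartingale.weakTest`),
which gives 2 → 3; the implication 1 → 2 is immediate.

For 3 → 1, let `V_k` be the intersection of `U_0, …, U_k`. The conditional measure of `V_k` given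
`σ` is fair in `σ`, and it is found by counting extensions. The martingale `testMart` has capital 1
and, for each `k`, buys at length `k + 1` the conditional measure of `V_{3(k+1)}` with multiplicity
`2 ^ (k + 1)`. The price is at most `2 ^ (k + 1) * 2 ^ (-3(k + 1)) * 2 ^ (k + 1) = 2 ^ (-(k + 1))`,
so all purchases together cost at most 1 and the capital stays nonnegative; at `σ` only `|σ|`
summands occur, so the value is an explicit dyadic rational. On a sequence in all `U_n` the `k`-th
purchase is worth `2 ^ (k + 1)` from length `|f(1^{3(k+1)})|` on (`two_pow_le_testMart`). If `X ∉
U_j`, then from length `|f(1^j)|` on all purchases with `k ≥ j` are worthless, so `testMart` is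
bounded along `X` (`testMart_bounded`). Hence the crossing test of `testMart` is weak and has the
same intersection as the given test.

Most of the file is about resources. `PS` is a class of functions of natural numbers computed by
register programs with polynomially many bits per register. It is closed under composition and under
loops with short states, however long they run, hence under sums of exponentially many terms.
Programs compile to machines (`FPSpace.of_psStr`), and machines are simulated by such functions
(`PSStr.fpspace`), so the constructions above can be checked with arithmetic instead of transition
tables. Polynomial time enters only through the length bounds of tests and successes: a strictly
increasing bound above any polynomial is written by an explicit odometer machine (`ptime_pow`,
`exists_ptime_bound`). -/

namespace BPS

open Function

/-! ### A while language on registers that hold natural numbers -/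

/-- Programs: registers are incremented, decremented and tested for zero; the input is read from left
to right by a head, and numbers are appended to the output. -/
inductive Prog where
  | skip
  | inc (v : ℕ)
  | dec (v : ℕ)
  | adv
  | emit (n : ℕ)
  | onInput (a : Option Bool) (P : Prog)
  | seq (P Q : Prog)
  | loop (v : ℕ) (P : Prog)

/-- A strict upper bound for the registers that occur in a program. -/
def Prog.width : Prog → ℕ
  | .skip => 0
  | .inc v => v + 1
  | .dec v => v + 1
  | .adv => 0
  | .emit _ => 0
  | .onInput _ P => P.width
  | .seq P Q => max P.width Q.width
  | .loop v P => max (v + 1) P.width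

/-- The state of a program. -/
structure PState where
  reg : ℕ → ℕ
  pos : ℕ
  out : List ℕ

/-- `Exec x B P s s'`: on input `x`, program `P` takes `s` to `s'`, and every value it
creates is below `B`. -/
inductive Exec (x : List Bool) (B : ℕ) : Prog → PState → PState → Prop
  | skip (s : PState) : Exec x B .skip s s
  | inc (s : PState) (v : ℕ) (h : s.reg v + 1 < B) :
      Exec x B (.inc v) s { s with reg := update s.reg v (s.reg v + 1) }
  | dec (s : PState) (v : ℕ) (h : s.reg v ≠ 0) :
      Exec x B (.dec v) s { s with reg := update s.reg v (s.reg v - 1) }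
  | adv (s : PState) : Exec x B .adv s { s with pos := min (s.pos + 1) (x.length + 1) }
  | emit (s : PState) (n : ℕ) : Exec x B (.emit n) s { s with out := s.out ++ [n] }
  | onInput_true {a : Option Bool} {P : Prog} {s s' : PState} (h : readInput x s.pos = a)
      (hP : Exec x B P s s') : Exec x B (.onInput a P) s s'
  | onInput_false {a : Option Bool} {P : Prog} {s : PState} (h : readInput x s.pos ≠ a) :
      Exec x B (.onInput a P) s s
  | seq {P Q : Prog} {s s' s'' : PState} (hP : Exec x B P s s') (hQ : Exec x B Q s' s'') :
      Exec x B (.seq P Q) s s''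
  | loop_zero {v : ℕ} {P : Prog} {s : PState} (h : s.reg v = 0) : Exec x B (.loop v P) s s
  | loop_succ {v : ℕ} {P : Prog} {s s' s'' : PState} (h : s.reg v ≠ 0) (hP : Exec x B P s s')
      (hQ : Exec x B (.loop v P) s' s'') : Exec x B (.loop v P) s s''

theorem Exec.mono {x : List Bool} {B B' : ℕ} (hB : B ≤ B') {P : Prog} {s s' : PState}
    (h : Exec x B P s s') : Exec x B' P s s' := by
  induction h with
  | skip s => exact .skip s
  | inc s v h => exact .inc s v (h.trans_le hB)
  | dec s v h => exact .dec s v h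
  | adv s => exact .adv s
  | emit s n => exact .emit s n
  | onInput_true h _ ih => exact .onInput_true h ih
  | onInput_false h => exact .onInput_false h
  | seq _ _ ih1 ih2 => exact .seq ih1 ih2
  | loop_zero h => exact .loop_zero h
  | loop_succ h _ _ ih1 ih2 => exact .loop_succ h ih1 ih2

/-! ### Machine fragments -/

/-- The work tape alphabet of compiled programs. -/
inductive Cell where
  | blank
  | mark
  | bit (b : Bool)
  deriving DecidableEq

instance : Finite Cell :=
  Finite.of_surjective (fun o : Option (Option Bool) => match o with
    | none => Cell.blank
    | some none => Cell.mark
    | some (some b) => Cell.bit b)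
    (by
      rintro (_ | _ | b)
      · exact ⟨none, rfl⟩
      · exact ⟨some none, rfl⟩
      · exact ⟨some (some b), rfl⟩)

/-- The part of a configuration that is shared by fragments. -/
structure Mem (β : Type) (k : ℕ) where
  pos : ℕ
  head : Fin k → ℕ
  tape : Fin k → ℕ → Cell
  out : List β

/-- A machine with `k` work tapes over `Cell`. -/
structure Frag (β : Type) (k : ℕ) where
  Q : Type
  finite_Q : Finite Q
  start : Q
  δ : Q → Option Bool → (Fin k → Cell) → Option (Q × Move × (Fin k → Cell × Move) × Option β)

variable {β : Type} {k : ℕ}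

/-- The effect of an instruction. -/
def Mem.act (x : List Bool) (μ : Mem β k) (mv : Move) (a : Fin k → Cell × Move) (o : Option β) :
    Mem β k where
  pos := min (mv.apply μ.pos) (x.length + 1)
  head := fun i => (a i).2.apply (μ.head i)
  tape := fun i => update (μ.tape i) (μ.head i) (a i).1
  out := μ.out ++ o.toList

namespace Frag

/-- The instruction for a configuration. -/
def next (F : Frag β k) (x : List Bool) (c : F.Q × Mem β k) :=
  F.δ c.1 (readInput x c.2.pos) (fun i => c.2.tape i (c.2.head i))

/-- A step from a configuration whose heads are below `s`. -/
def Step (F : Frag β k) (x : List Bool) (s : ℕ) (c c' : F.Q × Mem β k) : Prop :=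
  (∀ i, c.2.head i < s) ∧ ∃ q mv a o, F.next x c = some (q, mv, a, o) ∧ c' = (q, c.2.act x mv a o)

/-- Reachability by steps with heads below `s`. -/
def Reach (F : Frag β k) (x : List Bool) (s : ℕ) : F.Q × Mem β k → F.Q × Mem β k → Prop :=
  Relation.ReflTransGen (F.Step x s)

/-- The fragment takes `μ` to `μ'` with heads below `s`. -/
def Runs (F : Frag β k) (x : List Bool) (s : ℕ) (μ μ' : Mem β k) : Prop :=
  ∃ q, F.Reach x s (F.start, μ) (q, μ') ∧ F.next x (q, μ') = none

/-- The instruction that changes nothing on the work tapes. -/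
def keep (c : Fin k → Cell) : Fin k → Cell × Move := fun i => (c i, .stay)

/-- A single instruction, which applies `w` to the cells under the heads. -/
def single (mv : Move) (w : Cell → Cell) (o : Option β) : Frag β k where
  Q := Bool
  finite_Q := inferInstance
  start := false
  δ q _ c := if q then none else some (true, mv, fun i => (w (c i), .stay), o)

/-- Sequential composition. -/
def seq (A B : Frag β k) : Frag β k where
  Q := A.Q ⊕ B.Q
  finite_Q := by
    have := A.finite_Q
    have := B.finite_Q
    infer_instance
  start := .inl A.start
  δ q r c := match q with
    | .inl q => match A.δ q r c with
      | some (q', mv, a, o) => some (.inl q', mv, a, o)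
      | none => some (.inr B.start, .stay, keep c, none)
    | .inr q => match B.δ q r c with
      | some (q', mv, a, o) => some (.inr q', mv, a, o)
      | none => none

/-- Runs `A` if the input head reads `a`. -/
def onInput (a : Option Bool) (A : Frag β k) : Frag β k where
  Q := Option A.Q
  finite_Q := by
    have := A.finite_Q
    infer_instance
  start := none
  δ q r c := match q with
    | none => if r = a then some (some A.start, .stay, keep c, none) else none
    | some q => match A.δ q r c with
      | some (q', mv, a, o) => some (some q', mv, a, o)
      | none => none

/-- The states of a sweep over a tape. -/
inductive SweepQ where
  | scan
  | rew (r : Bool)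
  | done (r : Bool)

instance : Finite SweepQ :=
  Finite.of_surjective (fun o : Option (Bool × Bool) => match o with
    | none => SweepQ.scan
    | some (true, r) => SweepQ.rew r
    | some (false, r) => SweepQ.done r)
    (by
      rintro (_ | r | r)
      · exact ⟨none, rfl⟩
      · exact ⟨some (true, r), rfl⟩
      · exact ⟨some (false, r), rfl⟩)

/-- Write and move on tape `v` only. -/
def actOn (v : Fin k) (c : Fin k → Cell) (b : Cell) (mv : Move) : Fin k → Cell × Move :=
  update (keep c) v (b, mv)

/-- Transitions of a sweep: replace an initial block of bits `a` by `a'`, apply `w` to the cell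
that follows it, and return to the mark; remember whether that cell holds the other bit. -/
def sweepδ (v : Fin k) (a a' : Bool) (w : Cell → Cell) (q : SweepQ) (c : Fin k → Cell) :
    Option (SweepQ × Move × (Fin k → Cell × Move) × Option β) :=
  match q with
  | .scan =>
    if c v = .mark then some (.scan, .stay, actOn v c .mark .right, none)
    else if c v = .bit a then some (.scan, .stay, actOn v c (.bit a') .right, none)
    else some (.rew (decide (c v = .bit !a)), .stay, actOn v c (w (c v)) .left, none)
  | .rew r =>
    if c v = .mark then some (.done r, .stay, actOn v c .mark .stay, none)
    else some (.rew r, .stay, actOn v c (c v) .left, none)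
  | .done _ => none

/-- A sweep as a fragment. -/
def sweep (v : Fin k) (a a' : Bool) (w : Cell → Cell) : Frag β k where
  Q := SweepQ
  finite_Q := inferInstance
  start := .scan
  δ q _ c := sweepδ v a a' w q c

/-- Runs `A` as long as tape `v` holds a nonzero number. -/
def loop (v : Fin k) (A : Frag β k) : Frag β k where
  Q := SweepQ ⊕ A.Q
  finite_Q := by
    have := A.finite_Q
    infer_instance
  start := .inl .scan
  δ q r c := match q with
    | .inl (.done true) => some (.inr A.start, .stay, keep c, none)
    | .inl q => match (sweepδ v false false id q c : Option (_ × _ × _ × Option β)) with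
      | some (q', mv, a, o) => some (.inl q', mv, a, o)
      | none => none
    | .inr q => match A.δ q r c with
      | some (q', mv, a, o) => some (.inr q', mv, a, o)
      | none => some (.inl .scan, .stay, keep c, none)

/-- The bound on `pos` is needed because `Mem.act` truncates the input position at `x.length + 1`.
This is why the lemmas on fragments carry it along. -/
theorem act_keep (x : List Bool) (μ : Mem β k) (h : μ.pos ≤ x.length + 1) :
    μ.act x .stay (keep fun i => μ.tape i (μ.head i)) none = μ := by
  cases μ
  simp only at h
  simp [Mem.act, keep, Move.apply, h]

theorem act_pos_le (x : List Bool) (μ : Mem β k) (mv : Move) (a : Fin k → Cell × Move)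
    (o : Option β) : (μ.act x mv a o).pos ≤ x.length + 1 := by
  simp [Mem.act]

theorem Reach.pos_le {F : Frag β k} {x : List Bool} {s : ℕ} {c c' : F.Q × Mem β k}
    (h : F.Reach x s c c') (hc : c.2.pos ≤ x.length + 1) : c'.2.pos ≤ x.length + 1 := by
  induction h with
  | refl => exact hc
  | tail _ h2 _ =>
    obtain ⟨_, q, mv, a, o, _, rfl⟩ := h2
    exact act_pos_le ..

theorem Runs.pos_le {F : Frag β k} {x : List Bool} {s : ℕ} {μ μ' : Mem β k}
    (h : F.Runs x s μ μ') (hc : μ.pos ≤ x.length + 1) : μ'.pos ≤ x.length + 1 := by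
  obtain ⟨q, hq, _⟩ := h
  exact hq.pos_le hc

/-- Steps of one fragment inside another. -/
theorem Reach.embed {A F : Frag β k} {x : List Bool} {s : ℕ} (e : A.Q → F.Q)
    (he : ∀ q r c q' mv a o, A.δ q r c = some (q', mv, a, o) →
      F.δ (e q) r c = some (e q', mv, a, o))
    {c c' : A.Q × Mem β k} (h : A.Reach x s c c') :
    F.Reach x s (e c.1, c.2) (e c'.1, c'.2) := by
  induction h with
  | refl => exact .refl
  | tail _ h2 ih =>
    obtain ⟨h1, q', mv, a, o, h2, rfl⟩ := h2
    exact ih.tail ⟨h1, e q', mv, a, o, he _ _ _ _ _ _ _ h2, rfl⟩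

/-- A step without effect on the memory. -/
theorem reach_noop {F : Frag β k} {x : List Bool} {s : ℕ} {q q' : F.Q} {μ : Mem β k}
    (h : F.next x (q, μ) = some (q', .stay, keep fun i => μ.tape i (μ.head i), none))
    (hμ : μ.pos ≤ x.length + 1) (hs : ∀ i, μ.head i < s) : F.Reach x s (q, μ) (q', μ) := by
  refine Relation.ReflTransGen.single ⟨hs, _, _, _, _, h, ?_⟩
  rw [act_keep x μ hμ]

theorem seq_runs {A B : Frag β k} {x : List Bool} {s : ℕ} {μ μ' μ'' : Mem β k}
    (hA : A.Runs x s μ μ') (hB : B.Runs x s μ' μ'') (hμ : μ'.pos ≤ x.length + 1)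
    (hs : ∀ i, μ'.head i < s) : (seq A B).Runs x s μ μ'' := by
  obtain ⟨q, h1, h2⟩ := hA
  obtain ⟨q', h3, h4⟩ := hB
  refine ⟨.inr q', ?_, ?_⟩
  · have e1 := h1.embed (F := seq A B) Sum.inl (by
      intro q r c q' mv a o h
      simp [seq, h])
    have e2 := h3.embed (F := seq A B) Sum.inr (by
      intro q r c q' mv a o h
      simp [seq, h])
    refine e1.trans (Relation.ReflTransGen.trans (reach_noop ?_ hμ hs) e2)
    simp only [next] at h2
    simp [next, seq, h2]
  · simp only [next] at h4
    simp [next, seq, h4]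

theorem onInput_runs_true {A : Frag β k} {a : Option Bool} {x : List Bool} {s : ℕ}
    {μ μ' : Mem β k} (hA : A.Runs x s μ μ') (ha : readInput x μ.pos = a)
    (hμ : μ.pos ≤ x.length + 1) (hs : ∀ i, μ.head i < s) : (onInput a A).Runs x s μ μ' := by
  obtain ⟨q, h1, h2⟩ := hA
  refine ⟨some q, ?_, ?_⟩
  · have e1 := h1.embed (F := onInput a A) some (by
      intro q r c q' mv a o h
      simp [onInput, h])
    refine Relation.ReflTransGen.trans (reach_noop ?_ hμ hs) e1
    simp [next, onInput, ha]
  · simp only [next] at h2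
    simp [next, onInput, h2]

theorem onInput_runs_false {A : Frag β k} {a : Option Bool} {x : List Bool} {s : ℕ}
    {μ : Mem β k} (ha : readInput x μ.pos ≠ a) : (onInput a A).Runs x s μ μ :=
  ⟨none, .refl, by simp [next, onInput, ha]⟩

theorem single_runs {mv : Move} {w : Cell → Cell} {o : Option β} {x : List Bool} {s : ℕ}
    {μ : Mem β k} (hs : ∀ i, μ.head i < s) :
    (single mv w o).Runs x s μ (μ.act x mv (fun i => (w (μ.tape i (μ.head i)), .stay)) o) :=
  ⟨true, .single ⟨hs, _, _, _, _, rfl, rfl⟩, rfl⟩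

/-- The memory with tape `v` replaced. -/
def _root_.BPS.Mem.set (μ : Mem β k) (v : Fin k) (h : ℕ) (t : ℕ → Cell) : Mem β k where
  pos := μ.pos
  head := update μ.head v h
  tape := update μ.tape v t
  out := μ.out

/-- Lets a computation on tape `v` alone be followed through its head and contents, with all else
frozen in `μ`. -/
theorem act_actOn (x : List Bool) (μ : Mem β k) (v : Fin k) (h : ℕ) (t : ℕ → Cell)
    (hμ : μ.pos ≤ x.length + 1) (b : Cell) (mv : Move) :
    (μ.set v h t).act x .stay
      (actOn v (fun i => (μ.set v h t).tape i ((μ.set v h t).head i)) b mv) none =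
      μ.set v (mv.apply h) (update t h b) := by
  have h1 : ∀ i, ((μ.set v h t).act x .stay
      (actOn v (fun i => (μ.set v h t).tape i ((μ.set v h t).head i)) b mv) none).head i =
      (μ.set v (mv.apply h) (update t h b)).head i := by
    intro i
    by_cases hi : i = v
    · subst hi; simp [Mem.act, Mem.set, actOn]
    · simp [Mem.act, Mem.set, actOn, keep, hi, Move.apply]
  have h2 : ∀ i, ((μ.set v h t).act x .stay
      (actOn v (fun i => (μ.set v h t).tape i ((μ.set v h t).head i)) b mv) none).tape i =
      (μ.set v (mv.apply h) (update t h b)).tape i := by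
    intro i
    by_cases hi : i = v
    · subst hi; simp [Mem.act, Mem.set, actOn]
    · simp [Mem.act, Mem.set, actOn, keep, hi]
  have h1' := funext h1
  have h2' := funext h2
  simp only [Mem.act, Mem.set] at h1' h2' ⊢
  rw [h1', h2']
  simp [Move.apply, hμ]

/-! ### Correctness of a sweep over one tape. -/

section Sweep

variable {x : List Bool} {s : ℕ} {μ : Mem β k} {v : Fin k} {a a' : Bool} {w : Cell → Cell}

theorem sweep_step (hμ : μ.pos ≤ x.length + 1) (hs : ∀ i, i ≠ v → μ.head i < s) {h : ℕ}
    (hh : h < s) {t : ℕ → Cell} {q q' : SweepQ} {b : Cell} {mv : Move}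
    (hδ : ∀ c : Fin k → Cell, c v = t h →
      (sweepδ v a a' w q c : Option (_ × _ × _ × Option β)) =
        some (q', .stay, actOn v c b mv, none)) :
    (sweep v a a' w).Step x s (q, μ.set v h t) (q', μ.set v (mv.apply h) (update t h b)) := by
  refine ⟨?_, q', .stay, actOn v (fun i => (μ.set v h t).tape i ((μ.set v h t).head i)) b mv,
    none, ?_, ?_⟩
  · intro i
    by_cases hi : i = v
    · subst hi; simpa [Mem.set]
    · simpa [Mem.set, hi] using hs i hi
  · simp only [next, sweep]
    rw [hδ]
    simp [Mem.set]
  · rw [act_actOn x μ v h t hμ]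

theorem sweep_scan (hμ : μ.pos ≤ x.length + 1) (hs : ∀ i, i ≠ v → μ.head i < s) (n : ℕ) :
    ∀ (h : ℕ) (t : ℕ → Cell), h + n < s → (∀ z, h ≤ z → z < h + n → t z = .bit a) →
    (sweep v a a' w).Reach x s (.scan, μ.set v h t)
      (.scan, μ.set v (h + n) fun z => if h ≤ z ∧ z < h + n then .bit a' else t z) := by
  induction n with
  | zero =>
    intro h t _ _
    have : (fun z => if h ≤ z ∧ z < h + 0 then .bit a' else t z) = t := by
      funext z
      rw [if_neg (by omega)]
    rw [this]
    exact .refl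
  | succ n ih =>
    intro h t hhs ht
    have h0 := ht h le_rfl (by omega)
    have h1 := sweep_step (β := β) (a := a) (a' := a') (w := w) (q := .scan) (q' := .scan)
      (b := .bit a') (mv := .right) (t := t) hμ hs (h := h) (by omega) (by
        intro c hc
        simp [sweepδ, hc, h0])
    have h2 := ih (h + 1) (update t h (.bit a')) (by omega) (by
      intro z hz1 hz2
      rw [update_of_ne (by omega)]
      exact ht z (by omega) (by omega))
    refine Relation.ReflTransGen.head h1 ?_
    have e1 : h + (n + 1) = h + 1 + n := by omega
    have e2 : (fun z => if h ≤ z ∧ z < h + (n + 1) then .bit a' else t z) = fun z =>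
        if h + 1 ≤ z ∧ z < h + 1 + n then .bit a' else update t h (.bit a') z := by
      funext z
      by_cases hz : z = h
      · subst hz
        simp
      · rw [update_of_ne hz]
        congr 1
        apply propext
        omega
    rw [e2, e1]
    exact h2

theorem sweep_rew (hμ : μ.pos ≤ x.length + 1) (hs : ∀ i, i ≠ v → μ.head i < s) (r : Bool)
    {t : ℕ → Cell} (h0 : t 0 = .mark) (h : ℕ) (hh : h < s) (ht : ∀ z, 0 < z → z ≤ h → t z ≠ .mark) :
    (sweep v a a' w).Reach x s (.rew r, μ.set v h t) (.done r, μ.set v 0 t) := by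
  induction h with
  | zero =>
    have h1 := sweep_step (β := β) (a := a) (a' := a') (w := w) (q := .rew r) (q' := .done r)
      (b := .mark) (mv := .stay) (t := t) hμ hs hh (by
        intro c hc
        simp [sweepδ, hc, h0])
    rw [← h0, update_eq_self] at h1
    exact .single h1
  | succ h ih =>
    have h1 := sweep_step (β := β) (a := a) (a' := a') (w := w) (q := .rew r) (q' := .rew r)
      (b := t (h + 1)) (mv := .left) (t := t) hμ hs hh (by
        intro c hc
        simp [sweepδ, hc, ht (h + 1) (by omega) le_rfl])
    rw [update_eq_self] at h1
    exact .head h1 (ih (by omega) fun z hz1 hz2 => ht z hz1 (by omega))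

/-- A complete sweep: leave the mark, pass the block, treat the cell `n + 1` where the block ends,
and rewind to the only mark, in cell `0`. -/
theorem sweep_reach (hμ : μ.pos ≤ x.length + 1) (hs : ∀ i, i ≠ v → μ.head i < s)
    {t : ℕ → Cell} (h0 : t 0 = .mark) (n : ℕ) (hn : n + 1 < s)
    (ht : ∀ z, 0 < z → z < n + 1 → t z = .bit a) (h1 : t (n + 1) ≠ .mark)
    (h2 : t (n + 1) ≠ .bit a) :
    (sweep v a a' w).Reach x s (.scan, μ.set v 0 t)
      (.done (decide (t (n + 1) = .bit !a)), μ.set v 0 fun z =>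
        if 0 < z ∧ z < n + 1 then .bit a' else if z = n + 1 then w (t (n + 1)) else t z) := by
  have e1 := sweep_step (β := β) (a := a) (a' := a') (w := w) (q := .scan) (q' := .scan)
      (b := .mark) (mv := .right) (t := t) hμ hs (h := 0) (by omega) (by
        intro c hc
        simp [sweepδ, hc, h0])
  rw [← h0, update_eq_self] at e1
  have e2 := sweep_scan (β := β) (μ := μ) (v := v) (a := a) (a' := a') (w := w) (s := s)
    hμ hs n 1 t (by omega) (fun z hz1 hz2 => ht z (by omega) (by omega))
  have e3 := sweep_step (β := β) (a := a) (a' := a') (w := w) (q := .scan)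
      (q' := .rew (decide (t (n + 1) = .bit !a)))
      (b := w (t (n + 1))) (mv := .left)
      (t := fun z => if 1 ≤ z ∧ z < 1 + n then .bit a' else t z) hμ hs (h := n + 1)
      (by omega) (by
        intro c hc
        rw [if_neg (by omega)] at hc
        simp [sweepδ, hc, h1, h2])
  have h4 : ∀ z, (update (fun z => if 1 ≤ z ∧ z < 1 + n then .bit a' else t z) (n + 1)
      (w (t (n + 1)))) z = (fun z => if 0 < z ∧ z < n + 1 then .bit a' else
        if z = n + 1 then w (t (n + 1)) else t z) z := by
    intro z
    by_cases hz : z = n + 1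
    · subst hz
      simp
    · rw [update_of_ne hz]
      simp only [if_neg hz]
      congr 1
      apply propext
      omega
  rw [funext h4] at e3
  have e4 := sweep_rew (β := β) (μ := μ) (v := v) (a := a) (a' := a') (w := w) (s := s)
    hμ hs (decide (t (n + 1) = .bit !a)) (t := fun z => if 0 < z ∧ z < n + 1 then .bit a' else
        if z = n + 1 then w (t (n + 1)) else t z) (by simp [h0]) n (by omega) (by
      intro z hz1 hz2
      simp [hz1, Nat.lt_succ_of_le hz2])
  rw [Nat.add_comm 1 n] at e2 e3
  exact (Relation.ReflTransGen.single e1).trans (e2.trans (.head e3 e4))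

end Sweep

end Frag

/-! ### Binary numbers on tapes -/

/-- The value of a list of bits, least significant bit first. -/
def bitsVal : List Bool → ℕ
  | [] => 0
  | b :: l => b.toNat + 2 * bitsVal l

/-- A tape with a mark in cell `0` that is followed by the bits of `l`. -/
def tapeOf (l : List Bool) : ℕ → Cell
  | 0 => .mark
  | i + 1 => match l[i]? with
    | none => .blank
    | some b => .bit b

/-- Adding `b.toNat` on both sides covers blocks of zeros and blocks of ones (of value `2 ^ n - 1`)
at once, without truncated subtraction. -/
theorem bitsVal_replicate_append (n : ℕ) (b : Bool) (r : List Bool) :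
    bitsVal (List.replicate n b ++ r) + b.toNat = 2 ^ n * (bitsVal r + b.toNat) := by
  induction n with
  | zero => simp
  | succ n ih =>
    rw [List.replicate_succ, List.cons_append, bitsVal, pow_succ']
    rw [mul_assoc, ← ih]
    ring

/-- The initial block is the one through which a carry (`b = true`) or a borrow (`b = false`)
propagates. -/
theorem exists_replicate_append (b : Bool) (l : List Bool) :
    ∃ n r, l = List.replicate n b ++ r ∧ (r = [] ∨ ∃ r', r = (!b) :: r') := by
  induction l with
  | nil => exact ⟨0, [], rfl, .inl rfl⟩
  | cons c l ih =>
    obtain ⟨n, r, rfl, hr⟩ := ih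
    by_cases hc : c = b
    · subst hc
      exact ⟨n + 1, r, rfl, hr⟩
    · have : c = !b := by
        revert hc
        cases b <;> cases c <;> simp
      exact ⟨0, _, rfl, .inr ⟨_, by rw [this]⟩⟩

theorem tapeOf_sweep (n : ℕ) (a a' c : Bool) (r r' : List Bool) (y : Cell)
    (hr : ∀ i, tapeOf r' (i + 2) = tapeOf (c :: r) (i + 2)) (hy : tapeOf (c :: r) 1 = y) :
    (fun z => if 0 < z ∧ z < n + 1 then .bit a' else if z = n + 1 then y else
      tapeOf (List.replicate n a ++ r') z) = tapeOf (List.replicate n a' ++ c :: r) := by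
  funext z
  rcases z with _ | z
  · simp [tapeOf]
  · by_cases h1 : z < n
    · simp [tapeOf, h1, List.getElem?_append]
    · rw [if_neg (by omega)]
      obtain ⟨i, rfl⟩ := Nat.exists_eq_add_of_le (not_lt.1 h1)
      have e : ∀ (b : Bool) (l : List Bool), tapeOf (List.replicate n b ++ l) (n + i + 1) =
          tapeOf l (i + 1) := by
        intro b l
        simp [tapeOf, List.getElem?_append]
      rw [e, e]
      rcases i with _ | i
      · simp [hy]
      · rw [if_neg (by omega)]
        exact hr i

/-- The tape holds the number `n` with at most `m` digits. -/
def TapeRep (t : ℕ → Cell) (m n : ℕ) : Prop :=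
  ∃ l : List Bool, l.length ≤ m ∧ bitsVal l = n ∧ t = tapeOf l

theorem tapeOf_ne_mark (l : List Bool) (i : ℕ) : tapeOf l (i + 1) ≠ .mark := by
  simp only [tapeOf]
  split <;> simp

namespace Frag

variable {x : List Bool} {m : ℕ} {μ : Mem β k}

theorem set_self (v : Fin k) (h : μ.head v = 0) : μ.set v 0 (μ.tape v) = μ := by
  cases μ
  simp only at h
  simp [Mem.set, ← h]

/-- The remainder `r` is empty or begins with the other bit, so the remembered flag is `r ≠ []`. For
`a = false` this says that the number is nonzero. Cells up to `m + 1` are visited: the mark, the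
digits and the cell behind them. -/
theorem sweep_reach_list (hμ : μ.pos ≤ x.length + 1) (hs : ∀ i, μ.head i = 0) (v : Fin k)
    (a a' : Bool) (w : Cell → Cell) (n : ℕ) (r : List Bool)
    (hv : μ.tape v = tapeOf (List.replicate n a ++ r)) (hn : n ≤ m)
    (hr : r = [] ∨ ∃ r', r = (!a) :: r') :
    (sweep v a a' w).Reach x (m + 2) (.scan, μ)
      (.done (decide (r ≠ [])), μ.set v 0 fun z => if 0 < z ∧ z < n + 1 then .bit a' else
        if z = n + 1 then w (tapeOf r 1) else tapeOf (List.replicate n a ++ r) z) := by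
  have h1 : tapeOf (List.replicate n a ++ r) (n + 1) = tapeOf r 1 := by
    simp [tapeOf, List.getElem?_append]
  have key := sweep_reach (β := β) (μ := μ) (v := v) (a := a) (a' := a') (w := w) (s := m + 2)
    (x := x) hμ (fun i _ => by rw [hs i]; omega)
    (t := tapeOf (List.replicate n a ++ r)) rfl n (by omega) (by
      intro z hz1 hz2
      obtain ⟨z, rfl⟩ := Nat.exists_eq_succ_of_ne_zero hz1.ne'
      have : z < n := by omega
      simp [tapeOf, List.getElem?_append, this]) (tapeOf_ne_mark _ _) (by
      rw [h1]
      rcases hr with rfl | ⟨r', rfl⟩ <;> simp [tapeOf])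
  rw [← hv, set_self v (hs v), hv, h1] at key
  have h2 : decide (tapeOf r 1 = .bit !a) = decide (r ≠ []) := by
    rcases hr with rfl | ⟨r', rfl⟩ <;> simp [tapeOf]
  rwa [h2] at key

/-- Binary increment: low ones become zeros, and the next cell becomes a one, whether it held a zero
or was blank. -/
theorem inc_runs (hμ : μ.pos ≤ x.length + 1) (hs : ∀ i, μ.head i = 0) (v : Fin k) {n : ℕ}
    (hv : TapeRep (μ.tape v) m n) (hn : n + 1 < 2 ^ m) :
    ∃ t, TapeRep t m (n + 1) ∧
      (sweep v true false fun _ => .bit true).Runs x (m + 2) μ (μ.set v 0 t) := by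
  obtain ⟨l, hl, rfl, ht⟩ := hv
  obtain ⟨j, r, rfl, hr⟩ := exists_replicate_append true l
  have h1 := bitsVal_replicate_append j true r
  simp only [List.length_append, List.length_replicate] at hl
  have key := sweep_reach_list hμ hs v true false (fun _ => .bit true) j r ht
    (by omega : j ≤ m) hr
  refine ⟨_, ?_, _, key, rfl⟩
  rcases hr with rfl | ⟨r', rfl⟩
  · have h2 := bitsVal_replicate_append j false [true]
    refine ⟨List.replicate j false ++ [true], ?_, ?_, ?_⟩
    -- All digits were ones, so the numeral grows by one digit; the incremented value `2 ^ j` is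
    -- below `2 ^ m`, which leaves room for it.
    · simp only [bitsVal, Bool.toNat_true] at h1
      rw [h1] at hn
      have : j < m := (Nat.pow_lt_pow_iff_right (a := 2) (by norm_num)).1 (by simpa using hn)
      simpa using this
    · simp [bitsVal] at h1 h2 ⊢
      omega
    · exact tapeOf_sweep j true false true [] [] _ (fun i => by simp [tapeOf]) rfl
  · have h2 := bitsVal_replicate_append j false (true :: r')
    refine ⟨List.replicate j false ++ true :: r', ?_, ?_, ?_⟩
    · simpa using hl
    · simp [bitsVal] at h1 h2 ⊢
      rw [h1, h2]
      ring
    · exact tapeOf_sweep j true false true r' _ _ (fun i => by simp [tapeOf]) rfl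

/-- Binary decrement: low zeros become ones and the first one becomes a zero. Leading zeros may
arise, which `TapeRep` permits. -/
theorem dec_runs (hμ : μ.pos ≤ x.length + 1) (hs : ∀ i, μ.head i = 0) (v : Fin k) {n : ℕ}
    (hv : TapeRep (μ.tape v) m n) (hn : n ≠ 0) :
    ∃ t, TapeRep t m (n - 1) ∧
      (sweep v false true fun _ => .bit false).Runs x (m + 2) μ (μ.set v 0 t) := by
  obtain ⟨l, hl, rfl, ht⟩ := hv
  obtain ⟨j, r, rfl, hr⟩ := exists_replicate_append false l
  have h1 := bitsVal_replicate_append j false r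
  simp only [List.length_append, List.length_replicate] at hl
  have key := sweep_reach_list hμ hs v false true (fun _ => .bit false) j r ht
    (by omega : j ≤ m) hr
  refine ⟨_, ?_, _, key, rfl⟩
  rcases hr with rfl | ⟨r', rfl⟩
  · simp [bitsVal] at h1
    simp [h1] at hn
  · have h2 := bitsVal_replicate_append j true (false :: r')
    refine ⟨List.replicate j true ++ false :: r', ?_, ?_, ?_⟩
    · simpa using hl
    · simp [bitsVal] at h1 h2 ⊢
      rw [h1]
      have h3 : 2 ^ j * (1 + 2 * bitsVal r') = 2 ^ j * (2 * bitsVal r' + 1) := by ring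
      rw [h3]
      omega
    · exact tapeOf_sweep j false true false r' _ _ (fun i => by simp [tapeOf]) rfl

/-- The zero test is a sweep over zeros that rewrites each cell by itself, so only its flag matters.
-/
theorem loop_test (A : Frag β k) (hμ : μ.pos ≤ x.length + 1) (hs : ∀ i, μ.head i = 0) (v : Fin k)
    {n : ℕ} (hv : TapeRep (μ.tape v) m n) :
    (loop v A).Reach x (m + 2) (.inl .scan, μ) (.inl (.done (decide (n ≠ 0))), μ) := by
  obtain ⟨l, hl, rfl, ht⟩ := hv
  obtain ⟨j, r, rfl, hr⟩ := exists_replicate_append false l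
  have h1 := bitsVal_replicate_append j false r
  simp only [List.length_append, List.length_replicate] at hl
  have key := sweep_reach_list hμ hs v false false id j r ht (by omega : j ≤ m) hr
  have h2 : decide (bitsVal (List.replicate j false ++ r) ≠ 0) = decide (r ≠ []) := by
    simp only [Bool.toNat_false, add_zero] at h1
    rw [h1]
    rcases hr with rfl | ⟨r', rfl⟩ <;> simp [bitsVal]
  rw [h2]
  have h3 : (fun z => if 0 < z ∧ z < j + 1 then .bit false else
      if z = j + 1 then id (tapeOf r 1) else tapeOf (List.replicate j false ++ r) z) =
      tapeOf (List.replicate j false ++ r) := by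
    funext z
    rcases z with _ | z
    · simp
    · by_cases h : z < j
      · simp [h, tapeOf, List.getElem?_append]
      · rw [if_neg (by omega)]
        by_cases h' : z = j
        · subst h'
          simp [tapeOf, List.getElem?_append]
        · rw [if_neg (by omega)]
  rw [h3, ← ht, set_self v (hs v)] at key
  refine key.embed (F := loop v A) Sum.inl ?_
  intro q r c q' mv a o h
  simp only [sweep] at h
  rcases q with _ | _ | _
  · simp [loop, h]
    rfl
  · simp [loop, h]
    rfl
  · simp [sweepδ] at h

theorem loop_runs_zero (A : Frag β k) (hμ : μ.pos ≤ x.length + 1) (hs : ∀ i, μ.head i = 0)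
    (v : Fin k) (hv : TapeRep (μ.tape v) m 0) : (loop v A).Runs x (m + 2) μ μ :=
  ⟨_, loop_test A hμ hs v hv, by simp [next, loop, sweepδ]⟩

theorem loop_runs_succ {A : Frag β k} (hμ : μ.pos ≤ x.length + 1) (hs : ∀ i, μ.head i = 0)
    (v : Fin k) {n : ℕ} (hv : TapeRep (μ.tape v) m n) (hn : n ≠ 0) {μ' μ'' : Mem β k}
    (hA : A.Runs x (m + 2) μ μ') (hs' : ∀ i, μ'.head i = 0)
    (hl : (loop v A).Runs x (m + 2) μ' μ'') : (loop v A).Runs x (m + 2) μ μ'' := by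
  have hμ' := hA.pos_le hμ
  obtain ⟨q, h1, h2⟩ := hA
  obtain ⟨q', h3, h4⟩ := hl
  have h0 := loop_test A hμ hs v hv
  simp only [ne_eq, hn, not_false_eq_true, decide_true] at h0
  have e1 := h1.embed (F := loop v A) Sum.inr (by
    intro q r c q' mv a o h
    simp [loop, h])
  have n1 : (loop v A).Reach x (m + 2) (.inl (.done true), μ) (.inr A.start, μ) :=
    reach_noop (by simp [next, loop]) hμ (fun i => by rw [hs i]; omega)
  have n2 : (loop v A).Reach x (m + 2) (.inr q, μ') (.inl .scan, μ') :=
    reach_noop (by simp only [next] at h2; simp [next, loop, h2]) hμ'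
      (fun i => by rw [hs' i]; omega)
  exact ⟨q', h0.trans (n1.trans (e1.trans (n2.trans h3))), h4⟩

end Frag

/-! ### Compilation -/

/-- The fragment for a program. The map `e` decodes the emitted numbers. -/
def Prog.compile (e : ℕ → β) (k : ℕ) : Prog → Frag β k
  | .skip => .single .stay id none
  | .inc v => if h : v < k then .sweep ⟨v, h⟩ true false fun _ => .bit true
      else .single .stay id none
  | .dec v => if h : v < k then .sweep ⟨v, h⟩ false true fun _ => .bit false
      else .single .stay id none
  | .adv => .single .right id none
  | .emit n => .single .stay id (some (e n))
  | .onInput a P => .onInput a (P.compile e k)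
  | .seq P Q => .seq (P.compile e k) (Q.compile e k)
  | .loop v P => if h : v < k then .loop ⟨v, h⟩ (P.compile e k) else .single .stay id none

/-- The memory represents the state of a program. -/
structure Rep (x : List Bool) (e : ℕ → β) (m : ℕ) (s : PState) (μ : Mem β k) : Prop where
  pos : μ.pos = s.pos
  pos_le : μ.pos ≤ x.length + 1
  head : ∀ i, μ.head i = 0
  out : μ.out = s.out.map e
  tape : ∀ i, TapeRep (μ.tape i) m (s.reg i)

theorem Rep.set {x : List Bool} {e : ℕ → β} {m : ℕ} {s : PState} {μ : Mem β k}
    (h : Rep x e m s μ) (v : Fin k) {n : ℕ} {t : ℕ → Cell} (ht : TapeRep t m n) :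
    Rep x e m { s with reg := update s.reg v n } (μ.set v 0 t) where
  pos := h.pos
  pos_le := h.pos_le
  head i := by
    by_cases hi : i = v
    · subst hi; simp [Mem.set]
    · simpa [Mem.set, hi] using h.head i
  out := h.out
  tape i := by
    by_cases hi : i = v
    · subst hi; simpa [Mem.set]
    · have : (i : ℕ) ≠ v := fun h => hi (Fin.ext h)
      simpa [Mem.set, hi, this] using h.tape i

theorem Rep.act {x : List Bool} {e : ℕ → β} {m : ℕ} {s s' : PState} {μ : Mem β k}
    (h : Rep x e m s μ) (mv : Move) (o : Option β) (hr : s'.reg = s.reg)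
    (hp : min (mv.apply μ.pos) (x.length + 1) = s'.pos)
    (ho : s.out.map e ++ o.toList = s'.out.map e) :
    Rep x e m s' (μ.act x mv (fun i => (id (μ.tape i (μ.head i)), .stay)) o) where
  pos := hp
  pos_le := by simp [Mem.act]
  head i := by simpa [Mem.act, Move.apply] using h.head i
  out := by simpa [Mem.act, h.out] using ho
  tape i := by
    rw [hr]
    simpa [Mem.act] using h.tape i

/-- The induction is on the execution, so a loop is unrolled as often as it runs. Values below `2 ^
m` have `m` digits, hence heads stay below `m + 2`. -/
theorem Exec.compile {x : List Bool} {m : ℕ} (e : ℕ → β) (k : ℕ) {P : Prog} {s s' : PState}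
    (h : Exec x (2 ^ m) P s s') (hk : P.width ≤ k) (μ : Mem β k) (hμ : Rep x e m s μ) :
    ∃ μ', (P.compile e k).Runs x (m + 2) μ μ' ∧ Rep x e m s' μ' := by
  induction h generalizing μ with
  | skip s =>
    refine ⟨_, Frag.single_runs fun i => by rw [hμ.head i]; omega, hμ.act _ _ rfl ?_ (by simp)⟩
    simp only [Move.apply]
    rw [min_eq_left hμ.pos_le, hμ.pos]
  | inc s v h =>
    have hv : v < k := hk
    obtain ⟨t, ht, hr⟩ := Frag.inc_runs hμ.pos_le hμ.head ⟨v, hv⟩ (hμ.tape ⟨v, hv⟩) h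
    refine ⟨_, ?_, hμ.set ⟨v, hv⟩ ht⟩
    simpa [Prog.compile, hv] using hr
  | dec s v h =>
    have hv : v < k := hk
    obtain ⟨t, ht, hr⟩ := Frag.dec_runs hμ.pos_le hμ.head ⟨v, hv⟩ (hμ.tape ⟨v, hv⟩) h
    refine ⟨_, ?_, hμ.set ⟨v, hv⟩ ht⟩
    simpa [Prog.compile, hv] using hr
  | adv s =>
    refine ⟨_, Frag.single_runs fun i => by rw [hμ.head i]; omega, hμ.act _ _ rfl ?_ (by simp)⟩
    simp only [Move.apply, hμ.pos]
  | emit s n =>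
    refine ⟨_, Frag.single_runs fun i => by rw [hμ.head i]; omega, hμ.act _ _ rfl ?_ (by simp)⟩
    simp only [Move.apply]
    rw [min_eq_left hμ.pos_le, hμ.pos]
  | onInput_true h _ ih =>
    obtain ⟨μ', h1, h2⟩ := ih hk μ hμ
    exact ⟨μ', Frag.onInput_runs_true h1 (by rw [hμ.pos, h]) hμ.pos_le
      (fun i => by rw [hμ.head i]; omega), h2⟩
  | onInput_false h => exact ⟨μ, Frag.onInput_runs_false (by rwa [hμ.pos]), hμ⟩
  | seq _ _ ih1 ih2 =>
    obtain ⟨μ1, h1, h2⟩ := ih1 ((le_max_left _ _).trans hk) μ hμ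
    obtain ⟨μ2, h3, h4⟩ := ih2 ((le_max_right _ _).trans hk) μ1 h2
    exact ⟨μ2, Frag.seq_runs h1 h3 h2.pos_le (fun i => by rw [h2.head i]; omega), h4⟩
  | @loop_zero v P s h =>
    have hv : v < k := (le_max_left _ _).trans hk
    have ht := hμ.tape ⟨v, hv⟩
    simp only [h] at ht
    refine ⟨μ, ?_, hμ⟩
    simpa [Prog.compile, hv] using Frag.loop_runs_zero (P.compile e k) hμ.pos_le hμ.head _ ht
  | @loop_succ v P s s' s'' h _ _ ih1 ih2 =>
    have hv : v < k := (le_max_left _ _).trans hk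
    obtain ⟨μ1, h1, h2⟩ := ih1 ((le_max_right _ _).trans hk) μ hμ
    obtain ⟨μ2, h3, h4⟩ := ih2 hk μ1 h2
    refine ⟨μ2, ?_, h4⟩
    simp only [Prog.compile, hv, dif_pos] at h3 ⊢
    exact Frag.loop_runs_succ hμ.pos_le hμ.head _ (hμ.tape ⟨v, hv⟩) h h1 h2.head h3

/-! ### From fragments to machines -/

/-- A fragment as a machine. -/
def Frag.toMachine (F : Frag β k) : Machine Bool β where
  State := F.Q
  finite_state := F.finite_Q
  Sym := Cell
  finite_sym := inferInstance
  blank := .blank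
  tapes := k
  start := F.start
  δ := F.δ

/-- A configuration of a fragment as one of its machine. -/
def Frag.config (F : Frag β k) (c : F.Q × Mem β k) : Config F.toMachine where
  state := c.1
  inputHead := c.2.pos
  head := c.2.head
  tape := c.2.tape
  output := c.2.out

theorem Frag.Reach.iterate {F : Frag β k} {x : List Bool} {s : ℕ} {c c' : F.Q × Mem β k}
    (h : F.Reach x s c c') : ∃ t, (F.toMachine.step x)^[t] (F.config c) = F.config c' ∧
      ∀ t' < t, ∀ i, ((F.toMachine.step x)^[t'] (F.config c)).head i < s := by
  induction h with
  | refl => exact ⟨0, rfl, by simp⟩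
  | @tail d d' _ h2 ih =>
    obtain ⟨t, h3, h4⟩ := ih
    obtain ⟨hs, q, mv, a, o, hn, rfl⟩ := h2
    refine ⟨t + 1, ?_, ?_⟩
    · rw [iterate_succ_apply', h3]
      have hn' : F.toMachine.next x (F.config d) = some (q, mv, a, o) := hn
      simp only [Machine.step, hn']
      rfl
    · intro t' ht' i
      rcases Nat.lt_succ_iff_lt_or_eq.1 ht' with h | rfl
      · exact h4 t' h i
      · rw [h3]
        exact hs i

theorem Machine.iterate_of_halted {α : Type} (M : Machine α β) (x : List α) (c : Config M)
    (h : M.Halted x c) (t : ℕ) : (M.step x)^[t] c = c := by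
  have h1 : M.step x c = c := by
    simp only [Halted] at h
    simp [step, h]
  exact iterate_fixed h1 t

/-- A function that is computed by a program with polynomially many bits per register is polynomial
space computable. -/
theorem FPSpace.of_prog {F : List Bool → List β} (P : Prog) (e : ℕ → β) (p q : Polynomial ℕ)
    (hP : ∀ x, ∃ s', Exec x (2 ^ p.eval x.length) P ⟨fun _ => 0, 0, []⟩ s' ∧ s'.out.map e = F x)
    (hq : ∀ x, (F x).length ≤ q.eval x.length) : FPSpace F := by
  -- The extra first instruction writes the mark into cell `0` of every tape; a blank tape with a
  -- mark represents zero.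
  let A : Frag β P.width := .seq (.single .stay (fun _ => .mark) none) (P.compile e P.width)
  refine ⟨⟨A.toMachine, p + 2, fun x => ?_⟩, q, hq⟩
  obtain ⟨s', h1, h2⟩ := hP x
  set m := p.eval x.length
  let μ0 : Mem β P.width := ⟨0, fun _ => 0, fun _ _ => .blank, []⟩
  let μ1 : Mem β P.width :=
    μ0.act x .stay (fun i => ((fun _ => .mark) (μ0.tape i (μ0.head i)), .stay)) none
  have hr0 : (Frag.single .stay (fun _ => .mark) none).Runs x (m + 2) μ0 μ1 :=
    Frag.single_runs fun i => by simp [μ0]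
  have hr1 : Rep x e m ⟨fun _ => 0, 0, []⟩ μ1 := by
    refine ⟨?_, ?_, ?_, ?_, ?_⟩
    · simp [μ1, μ0, Mem.act, Move.apply]
    · simp [μ1, μ0, Mem.act, Move.apply]
    · intro i
      simp [μ1, μ0, Mem.act, Move.apply]
    · simp [μ1, μ0, Mem.act]
    · intro i
      refine ⟨[], by simp, rfl, ?_⟩
      funext z
      rcases z with _ | z <;> simp [μ1, μ0, Mem.act, tapeOf]
  obtain ⟨μ2, h3, h4⟩ := h1.compile e P.width le_rfl μ1 hr1
  obtain ⟨c, h5, h6⟩ := Frag.seq_runs hr0 h3 hr1.pos_le (fun i => by rw [hr1.head i]; omega)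
  obtain ⟨t, h7, h8⟩ := h5.iterate
  have h9 : A.toMachine.run x t = A.config (c, μ2) := h7
  have h10 : A.toMachine.Halted x (A.config (c, μ2)) := h6
  refine ⟨⟨t, ?_, ?_⟩, ?_⟩
  · rwa [h9]
  · rw [h9]
    change μ2.out = F x
    rw [h4.out, h2]
  · intro t' i
    have hm : (p + 2).eval x.length = m + 2 := by simp [m]
    rw [hm]
    rcases lt_or_ge t' t with h | h
    · exact h8 t' h i
    · obtain ⟨j, rfl⟩ := Nat.exists_eq_add_of_le h
      have : A.toMachine.run x (t + j) = A.config (c, μ2) := by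
        rw [Machine.run, add_comm, iterate_add_apply]
        change (A.toMachine.step x)^[j] (A.toMachine.run x t) = _
        rw [h9, Machine.iterate_of_halted _ _ _ h10]
      rw [this]
      change μ2.head i < m + 2
      rw [h4.head i]
      omega

/-! ### Polynomial space computable functions of natural numbers -/

theorem polynomial_eval_mono (p : Polynomial ℕ) : Monotone fun n => p.eval n := by
  intro a b hab
  induction p using Polynomial.induction_on' with
  | add p q hp hq => simpa using add_le_add hp hq
  | monomial n c => simpa using Nat.mul_le_mul_left c (Nat.pow_le_pow_left hab n)

/-- `P` takes the registers `s` to `s'` and does not touch the input and the output. -/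
def RExec (B : ℕ) (P : Prog) (s s' : ℕ → ℕ) : Prop :=
  ∀ x pos out, Exec x B P ⟨s, pos, out⟩ ⟨s', pos, out⟩

namespace RExec

variable {B B' : ℕ} {P Q : Prog} {s s' s'' : ℕ → ℕ}

theorem mono (hB : B ≤ B') (h : RExec B P s s') : RExec B' P s s' :=
  fun x pos out => (h x pos out).mono hB

theorem skip (s : ℕ → ℕ) : RExec B .skip s s := fun _ _ _ => .skip _

theorem inc (v : ℕ) (h : s v + 1 < B) : RExec B (.inc v) s (update s v (s v + 1)) :=
  fun _ _ _ => .inc _ v h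

theorem dec (v : ℕ) (h : s v ≠ 0) : RExec B (.dec v) s (update s v (s v - 1)) :=
  fun _ _ _ => .dec _ v h

theorem seq (h1 : RExec B P s s') (h2 : RExec B Q s' s'') : RExec B (.seq P Q) s s'' :=
  fun _ _ _ => .seq (h1 _ _ _) (h2 _ _ _)

theorem loop_zero {v : ℕ} (h : s v = 0) : RExec B (.loop v P) s s :=
  fun _ _ _ => .loop_zero h

theorem loop_succ {v : ℕ} (h : s v ≠ 0) (h1 : RExec B P s s') (h2 : RExec B (.loop v P) s' s'') :
    RExec B (.loop v P) s s'' :=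
  fun _ _ _ => .loop_succ h (h1 _ _ _) (h2 _ _ _)

theorem congr (h : RExec B P s s') (e : s' = s'') : RExec B P s s'' := e ▸ h

/-- Sets a register to zero. -/
theorem clear (v : ℕ) (s : ℕ → ℕ) : RExec B (.loop v (.dec v)) s (update s v 0) := by
  generalize hn : s v = n
  induction n generalizing s with
  | zero => exact (loop_zero hn).congr (by rw [← hn, update_eq_self])
  | succ n ih =>
    refine loop_succ (by omega) (dec v (by omega)) ((ih (update s v (s v - 1)) ?_).congr ?_)
    · simp [hn]
    · simp

/-- Adds one register to another one. -/
theorem move {u r : ℕ} (hur : u ≠ r) (s : ℕ → ℕ) (h : s r + s u < B) :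
    RExec B (.loop u (.seq (.dec u) (.inc r))) s (update (update s u 0) r (s r + s u)) := by
  generalize hn : s u = n
  induction n generalizing s with
  | zero =>
    refine (loop_zero hn).congr ?_
    funext z
    simp only [update_apply]
    split_ifs with h1 h2
    · simp [h1]
    · rw [h2, hn]
    · rfl
  | succ n ih =>
    refine loop_succ (by omega) ((dec u (by omega)).seq (inc r ?_)) ((ih _ ?_ ?_).congr ?_)
    · simp [hur.symm]; omega
    · simp [hur, hur.symm]; omega
    · simp [hur, hn]
    · funext z
      simp only [update_apply]
      split_ifs <;> simp_all
      omega

/-- Adds one register to two others. -/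
theorem move_two {u r t : ℕ} (hur : u ≠ r) (hut : u ≠ t) (hrt : r ≠ t) (s : ℕ → ℕ)
    (h : s r + s u < B) (h' : s t + s u < B) :
    RExec B (.loop u (.seq (.dec u) (.seq (.inc r) (.inc t)))) s
      (update (update (update s u 0) r (s r + s u)) t (s t + s u)) := by
  generalize hn : s u = n
  induction n generalizing s with
  | zero =>
    refine (loop_zero hn).congr ?_
    funext z
    simp only [update_apply]
    split_ifs with h1 h2 h3
    · simp [h1]
    · simp [h2]
    · rw [h3, hn]
    · rfl
  | succ n ih =>
    refine loop_succ (by omega) ((dec u (by omega)).seq ((inc r ?_).seq (inc t ?_)))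
      ((ih _ ?_ ?_ ?_).congr ?_)
    · simp [hur.symm]; omega
    · simp [hut.symm, hrt.symm]; omega
    · simp [hur, hur.symm, hut, hrt]; omega
    · simp [hur, hut, hut.symm, hrt.symm]; omega
    · simp [hur, hut, hn]
    · funext z
      simp only [update_apply]
      split_ifs <;> simp_all <;> omega

/-- Programs for the elements of a finite set, one after the other. -/
theorem finset {κ : Type} (P : κ → Prog) (J : Finset κ) : ∃ Q : Prog, ∀ (B : ℕ)
    (Inv : Finset κ → (ℕ → ℕ) → Prop),
    (∀ J' j s (hj : j ∉ J'), Inv J' s → ∃ s', RExec B (P j) s s' ∧ Inv (J'.cons j hj) s') →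
    ∀ s, Inv ∅ s → ∃ s', RExec B Q s s' ∧ Inv J s' := by
  induction J using Finset.cons_induction with
  | empty => exact ⟨.skip, fun B Inv _ s hs => ⟨s, skip s, hs⟩⟩
  | cons j J hj ih =>
    obtain ⟨Q, hQ⟩ := ih
    refine ⟨.seq Q (P j), fun B Inv h s hs => ?_⟩
    obtain ⟨s1, h1, h2⟩ := hQ B Inv h s hs
    obtain ⟨s2, h3, h4⟩ := h J j s1 hj h2
    exact ⟨s2, h1.seq h3, h4⟩

/-- Sets finitely many registers to zero. -/
theorem clear_all {κ : Type} [Finite κ] (t : κ → ℕ) : ∃ Q : Prog, ∀ (B : ℕ) (s : ℕ → ℕ),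
    ∃ s', RExec B Q s s' ∧ (∀ j, s' (t j) = 0) ∧ ∀ z, (∀ j, z ≠ t j) → s' z = s z := by
  have := Fintype.ofFinite κ
  obtain ⟨Q, hQ⟩ := finset (fun j => .loop (t j) (.dec (t j))) (Finset.univ : Finset κ)
  refine ⟨Q, fun B s => ?_⟩
  obtain ⟨s', h1, h2⟩ := hQ B (fun J s' => (∀ j ∈ J, s' (t j) = 0) ∧
    ∀ z, (∀ j, z ≠ t j) → s' z = s z) (by
    rintro J j s' hj ⟨h1, h2⟩
    refine ⟨_, clear (t j) s', ?_, ?_⟩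
    · intro i hi
      by_cases h : t i = t j
      · rw [h, update_self]
      · rw [update_of_ne h]
        rcases Finset.mem_cons.1 hi with rfl | hi
        · exact absurd rfl h
        · exact h1 i hi
    · intro z hz
      rw [update_of_ne (hz j), h2 z hz]) s ⟨by simp, by simp⟩
  exact ⟨s', h1, fun j => h2.1 j (Finset.mem_univ j), h2.2⟩

/-- Moves finitely many registers. -/
theorem move_all {κ : Type} [Finite κ] (u t : κ → ℕ) (hu : Injective u) (ht : Injective t)
    (hut : ∀ i j, u i ≠ t j) : ∃ Q : Prog, ∀ (B : ℕ) (s : ℕ → ℕ), (∀ j, s (t j) = 0) →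
    (∀ j, s (u j) < B) →
    ∃ s', RExec B Q s s' ∧ (∀ j, s' (t j) = s (u j)) ∧ (∀ j, s' (u j) = 0) ∧
      ∀ z, (∀ j, z ≠ t j) → (∀ j, z ≠ u j) → s' z = s z := by
  classical
  have := Fintype.ofFinite κ
  obtain ⟨Q, hQ⟩ := finset (fun j => .loop (u j) (.seq (.dec (u j)) (.inc (t j))))
    (Finset.univ : Finset κ)
  refine ⟨Q, fun B s hst hsu => ?_⟩
  obtain ⟨s', h1, h2, h3, h4⟩ := hQ B (fun J s' =>
    (∀ j, s' (t j) = if j ∈ J then s (u j) else 0) ∧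
    (∀ j, s' (u j) = if j ∈ J then 0 else s (u j)) ∧
    ∀ z, (∀ j, z ≠ t j) → (∀ j, z ≠ u j) → s' z = s z) (by
    rintro J j s' hj ⟨h1, h2, h3⟩
    have e1 : s' (t j) = 0 := by simp [h1, hj]
    have e2 : s' (u j) = s (u j) := by simp [h2, hj]
    refine ⟨_, move (hut j j) s' (by rw [e1, e2]; simpa using hsu j), ?_, ?_, ?_⟩
    · intro i
      by_cases h : i = j
      · subst h
        simp [e1, e2]
      · rw [update_of_ne (fun e => h (ht e)), update_of_ne (hut j i).symm, h1]
        simp [h]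
    · intro i
      rw [update_of_ne (hut i j)]
      by_cases h : i = j
      · subst h
        simp
      · rw [update_of_ne (fun e => h (hu e)), h2]
        simp [h]
    · intro z hz hz'
      rw [update_of_ne (hz j), update_of_ne (hz' j), h3 z hz hz']) s
    ⟨by simpa using hst, by simp, by simp⟩
  exact ⟨s', h1, by simpa using h2, by simpa using h3, h4⟩

end RExec

/-- `f` is computed by programs whose values have polynomially many bits. The program reads its
arguments in the registers `a`, writes the result in register `r`, and uses the registers from `b`
on as scratch space that it leaves clean. -/
def PS {ι : Type} (f : (ι → ℕ) → ℕ) : Prop :=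
  ∃ p : Polynomial ℕ, (∀ v m, (∀ i, v i < 2 ^ m) → f v < 2 ^ p.eval m) ∧
    ∀ (a : ι → ℕ) (r b : ℕ), (∀ i, a i < b) → r < b → (∀ i, a i ≠ r) → ∃ P : Prog,
      ∀ (s : ℕ → ℕ) (m : ℕ), (∀ i, s (a i) < 2 ^ m) → s r = 0 → (∀ j, b ≤ j → s j = 0) →
        RExec (2 ^ p.eval m) P s (update s r (f fun i => s (a i)))

namespace PS

variable {ι κ : Type}

/-- Moving a register destroys it, so the argument is moved to `r` and to the scratch register `b`
simultaneously, and then restored from `b`. -/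
theorem proj (i : ι) : PS fun v : ι → ℕ => v i := by
  refine ⟨.X, fun v m h => by simpa using h i, fun a r b hab hr har => ?_⟩
  refine ⟨.seq (.loop (a i) (.seq (.dec (a i)) (.seq (.inc r) (.inc b))))
    (.loop b (.seq (.dec b) (.inc (a i)))), fun s m hs hsr hsb => ?_⟩
  have hb := hsb b le_rfl
  have h1 := hab i
  have h2 := har i
  have h3 := hs i
  refine ((RExec.move_two h2 (by omega) (by omega) s ?_ ?_).seq (RExec.move (by omega) _ ?_)).congr
    ?_
  · simpa [hsr] using h3
  · simpa [hb] using h3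
  · simp [hb, h2, h1.ne]
    exact h3
  · funext z
    simp only [update_apply]
    split_ifs <;> simp_all

theorem const (c : ℕ) : PS fun _ : ι → ℕ => c := by
  have hc : c < 2 ^ c := Nat.lt_two_pow_self
  refine ⟨.C c, fun v m _ => by simpa using hc, fun a r b hab hr har => ?_⟩
  have key : ∀ n ≤ c, ∃ P : Prog, ∀ s : ℕ → ℕ, s r = 0 → RExec (2 ^ c) P s (update s r n) := by
    intro n
    induction n with
    | zero =>
      intro _
      exact ⟨.skip, fun s hs => (RExec.skip s).congr (by rw [← hs, update_eq_self])⟩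
    | succ n ih =>
      intro hn
      obtain ⟨P, hP⟩ := ih (by omega)
      refine ⟨.seq P (.inc r), fun s hs => ((hP s hs).seq (.inc r ?_)).congr ?_⟩
      · simp; omega
      · simp
  obtain ⟨P, hP⟩ := key c le_rfl
  exact ⟨P, fun s m _ hs _ => by simpa using hP s hs⟩

theorem succ_proj (i : ι) : PS fun v : ι → ℕ => v i + 1 := by
  obtain ⟨p, hp, h⟩ := proj i
  have hle : ∀ m, 2 ^ p.eval m + 1 ≤ 2 ^ (p + 1).eval m := by
    intro m
    have : 1 ≤ 2 ^ p.eval m := Nat.one_le_two_pow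
    simp only [Polynomial.eval_add, Polynomial.eval_one, pow_succ]
    omega
  refine ⟨p + 1, fun v m hv => by have := hp v m hv; have := hle m; beta_reduce at *; omega,
    fun a r b hab hr har => ?_⟩
  obtain ⟨P, hP⟩ := h a r b hab hr har
  refine ⟨.seq P (.inc r), fun s m hs hsr hsb => ?_⟩
  have h1 := hP s m hs hsr hsb
  have h2 := hle m
  refine ((h1.mono (by omega)).seq (.inc r ?_)).congr ?_
  · have := hp (fun i => s (a i)) m hs
    beta_reduce at *
    rw [update_self]
    omega
  · simp

/-- A decrement needs a nonzero register. The outer loop serves as a conditional: its body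
decrements once and then empties `r` into `b`, so it runs at most once. -/
theorem pred_proj (i : ι) : PS fun v : ι → ℕ => v i - 1 := by
  obtain ⟨p, hp, h⟩ := proj i
  refine ⟨p, fun v m hv => by have := hp v m hv; beta_reduce at *; omega, fun a r b hab hr har => ?_⟩
  obtain ⟨P, hP⟩ := h a r b hab hr har
  refine ⟨.seq P (.seq (.loop r (.seq (.dec r) (.loop r (.seq (.dec r) (.inc b)))))
    (.loop b (.seq (.dec b) (.inc r)))), fun s m hs hsr hsb => ?_⟩
  have h1 := hP s m hs hsr hsb
  have h2 := hp (fun i => s (a i)) m hs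
  beta_reduce at h2
  have hb := hsb b le_rfl
  have hrb : r ≠ b := hr.ne
  refine h1.seq ?_
  rcases Nat.eq_zero_or_pos (s (a i)) with h0 | h0
  · refine ((RExec.loop_zero (by simp [h0])).seq (RExec.loop_zero ?_)).congr ?_
    · simp [hrb.symm, hb]
    · simp [h0]
  · refine ((RExec.loop_succ ?_ ((RExec.dec r ?_).seq (RExec.move hrb _ ?_))
      (RExec.loop_zero ?_)).seq (RExec.move hrb.symm _ ?_)).congr ?_
    · simp; omega
    · simp; omega
    · simp [hrb.symm, hb]; omega
    · simp [hrb]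
    · simp [hrb, hrb.symm, hb]; omega
    · funext z
      simp only [update_apply]
      split_ifs <;> simp_all

theorem exists_bound [Finite κ] (p : κ → Polynomial ℕ) :
    ∃ q : Polynomial ℕ, ∀ j m, (p j).eval m ≤ q.eval m := by
  have := Fintype.ofFinite κ
  refine ⟨∑ j, p j, fun j m => ?_⟩
  rw [Polynomial.eval_finsetSum]
  exact Finset.single_le_sum (f := fun j => (p j).eval m) (fun _ _ => Nat.zero_le _)
    (Finset.mem_univ j)

/-- Computes finitely many functions. -/
theorem tuple [Finite κ] {g : κ → (ι → ℕ) → ℕ} (hg : ∀ j, PS (g j)) : ∃ p : Polynomial ℕ,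
    (∀ j v m, (∀ i, v i < 2 ^ m) → g j v < 2 ^ p.eval m) ∧
    ∀ (a : ι → ℕ) (t : κ → ℕ) (b : ℕ), (∀ i, a i < b) → (∀ j, t j < b) → Injective t →
      (∀ i j, a i ≠ t j) → ∃ P : Prog,
      ∀ (s : ℕ → ℕ) (m : ℕ), (∀ i, s (a i) < 2 ^ m) → (∀ j, s (t j) = 0) →
        (∀ j, b ≤ j → s j = 0) → ∃ s', RExec (2 ^ p.eval m) P s s' ∧
          (∀ j, s' (t j) = g j fun i => s (a i)) ∧ ∀ z, (∀ j, z ≠ t j) → s' z = s z := by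
  classical
  have := Fintype.ofFinite κ
  choose p hp h using hg
  obtain ⟨q, hq⟩ := exists_bound p
  refine ⟨q, fun j v m hv => (hp j v m hv).trans_le (Nat.pow_le_pow_right (by norm_num) (hq j m)),
    fun a t b hab htb ht hat => ?_⟩
  choose P hP using fun j => h j a (t j) b hab (htb j) (fun i => hat i j)
  obtain ⟨Q, hQ⟩ := RExec.finset P (Finset.univ : Finset κ)
  refine ⟨Q, fun s m hs hst hsb => ?_⟩
  obtain ⟨s', h1, h2, h3⟩ := hQ (2 ^ q.eval m) (fun J s' =>
    (∀ j, s' (t j) = if j ∈ J then g j fun i => s (a i) else 0) ∧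
    ∀ z, (∀ j, z ≠ t j) → s' z = s z) (by
    rintro J j s' hj ⟨h1, h2⟩
    have e : ∀ i, s' (a i) = s (a i) := fun i => h2 _ (hat i)
    refine ⟨_, (hP j s' m (fun i => by rw [e]; exact hs i) (by simp [h1, hj]) ?_).mono
      (Nat.pow_le_pow_right (by norm_num) (hq j m)), ?_, ?_⟩
    · intro z hz
      rw [h2 z fun i => by have := htb i; omega]
      exact hsb z hz
    · intro i
      by_cases hi : i = j
      · subst hi
        simp [e]
      · rw [update_of_ne (fun e => hi (ht e)), h1]
        simp [hi]
    · intro z hz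
      rw [update_of_ne (hz j), h2 z hz]) s ⟨by simpa using hst, by simp⟩
  exact ⟨s', h1, by simpa using h2, h3⟩

/-- The intermediate values live in the `n` registers from `b` on and are cleared at the end; the
scratch space of the components starts above them. -/
theorem comp [Finite κ] {f : (κ → ℕ) → ℕ} (hf : PS f) {g : κ → (ι → ℕ) → ℕ}
    (hg : ∀ j, PS (g j)) : PS fun v => f fun j => g j v := by
  obtain ⟨p, hp, h⟩ := hf
  obtain ⟨q, hq, h'⟩ := tuple hg
  have hB1 : ∀ m, 2 ^ (p.comp q).eval m ≤ 2 ^ (p.comp q + q).eval m := fun m =>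
    Nat.pow_le_pow_right (by norm_num) (by simp)
  have hB2 : ∀ m, 2 ^ q.eval m ≤ 2 ^ (p.comp q + q).eval m := fun m =>
    Nat.pow_le_pow_right (by norm_num) (by simp)
  refine ⟨p.comp q + q, fun v m hv => lt_of_lt_of_le ?_ (hB1 m), fun a r b hab hr har => ?_⟩
  · rw [Polynomial.eval_comp]
    exact hp _ _ fun j => hq j v m hv
  obtain ⟨n, ⟨e⟩⟩ := Finite.exists_equiv_fin κ
  let t : κ → ℕ := fun j => b + e j
  have ht : Injective t := fun i j hij => e.injective (Fin.ext (by simpa [t] using hij))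
  have htb : ∀ j, t j < b + n := fun j => by have := (e j).2; simp only [t]; omega
  have hbt : ∀ j, b ≤ t j := fun j => by simp [t]
  obtain ⟨P1, h1⟩ := h' a t (b + n) (fun i => by have := hab i; omega) htb ht
    (fun i j => by have := hab i; have := hbt j; omega)
  obtain ⟨P2, h2⟩ := h t r (b + n) htb (by omega) (fun j => by have := hbt j; omega)
  obtain ⟨P3, h3⟩ := RExec.clear_all t
  refine ⟨.seq P1 (.seq P2 P3), fun s m hs hsr hsb => ?_⟩
  obtain ⟨s1, e1, e2, e3⟩ := h1 s m hs (fun j => hsb _ (hbt j)) fun j hj => hsb j (by omega)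
  have e4 := h2 s1 (q.eval m) (fun j => by rw [e2]; exact hq j _ m hs)
    (by rw [e3 r fun j => by have := hbt j; omega, hsr])
    (fun z hz => by
      rw [e3 z fun j => by have := htb j; omega]
      exact hsb z (by omega))
  obtain ⟨s2, e5, e6, e7⟩ := h3 (2 ^ (p.comp q + q).eval m) (update s1 r (f fun j => s1 (t j)))
  rw [← Polynomial.eval_comp] at e4
  refine ((e1.mono (hB2 m)).seq ((e4.mono (hB1 m)).seq e5)).congr ?_
  funext z
  by_cases hz : ∃ j, z = t j
  · obtain ⟨j, rfl⟩ := hz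
    have := hbt j
    rw [e6, update_of_ne (by omega), hsb _ this]
  · push Not at hz
    rw [e7 z hz]
    by_cases hzr : z = r
    · subst hzr
      simp [e2]
    · rw [update_of_ne hzr, update_of_ne hzr, e3 z hz]

/-- Closure under loops whose states have polynomially many bits. -/
theorem while_loop [Finite κ] {f : (ι → ℕ) → ℕ} {init : κ → (ι → ℕ) → ℕ}
    (hinit : ∀ j, PS (init j)) {c : (κ → ℕ) → ℕ} (hc : PS c) {G : κ → (κ → ℕ) → ℕ}
    (hG : ∀ j, PS (G j)) {out : (κ → ℕ) → ℕ} (hout : PS out) (p : Polynomial ℕ)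
    (h : ∀ v m, (∀ i, v i < 2 ^ m) → ∃ (T : ℕ) (w : ℕ → κ → ℕ), (w 0 = fun j => init j v) ∧
      (∀ t < T, c (w t) ≠ 0 ∧ w (t + 1) = fun j => G j (w t)) ∧ c (w T) = 0 ∧
      (∀ t ≤ T, ∀ j, w t j < 2 ^ p.eval m) ∧ f v = out (w T)) : PS f := by
  obtain ⟨p1, hp1, hi⟩ := tuple hinit
  obtain ⟨p2, hp2, hc⟩ := hc
  obtain ⟨p3, hp3, hG⟩ := tuple hG
  obtain ⟨p4, hp4, hO⟩ := hout
  let q := p1 + (p2.comp p + (p3.comp p + p4.comp p))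
  have hq1 : ∀ m, 2 ^ p1.eval m ≤ 2 ^ q.eval m := fun m =>
    Nat.pow_le_pow_right (by norm_num) (by simp [q])
  have hq2 : ∀ m, 2 ^ p2.eval (p.eval m) ≤ 2 ^ q.eval m := fun m =>
    Nat.pow_le_pow_right (by norm_num) (by simp [q]; omega)
  have hq3 : ∀ m, 2 ^ p3.eval (p.eval m) ≤ 2 ^ q.eval m := fun m =>
    Nat.pow_le_pow_right (by norm_num) (by simp [q]; omega)
  have hq4 : ∀ m, 2 ^ p4.eval (p.eval m) ≤ 2 ^ q.eval m := fun m =>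
    Nat.pow_le_pow_right (by norm_num) (by simp [q]; omega)
  refine ⟨q, fun v m hv => lt_of_lt_of_le ?_ (hq4 m), fun a r b hab hr har => ?_⟩
  · obtain ⟨T, w, _, _, _, h4, h5⟩ := h v m hv
    rw [h5]
    exact hp4 _ _ (h4 T le_rfl)
  obtain ⟨n, ⟨e⟩⟩ := Finite.exists_equiv_fin κ
  let t : κ → ℕ := fun j => b + e j
  let u : κ → ℕ := fun j => b + n + e j
  let φ := b + 2 * n
  have ht : Injective t := fun i j hij => e.injective (Fin.ext (by simpa [t] using hij))
  have hu : Injective u := fun i j hij => e.injective (Fin.ext (by simpa [u] using hij))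
  have ht1 : ∀ j, t j < b + n := fun j => by have := (e j).2; simp only [t]; omega
  have ht2 : ∀ j, b ≤ t j := fun j => by simp [t]
  have hu1 : ∀ j, u j < φ := fun j => by have := (e j).2; simp only [u, φ]; omega
  have hu2 : ∀ j, b + n ≤ u j := fun j => by simp [u]
  have hφ : φ = b + 2 * n := rfl
  have hut : ∀ i j, u i ≠ t j := fun i j => by have := hu2 i; have := ht1 j; omega
  obtain ⟨P1, h1⟩ := hi a t (φ + 1) (fun i => by have := hab i; omega)
    (fun j => by have := ht1 j; omega) ht (fun i j => by have := hab i; have := ht2 j; omega)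
  obtain ⟨P2, h2⟩ := hc t φ (φ + 1) (fun j => by have := ht1 j; omega) (by omega)
    (fun j => by have := ht1 j; omega)
  obtain ⟨P3, h3⟩ := hG t u (φ + 1) (fun j => by have := ht1 j; omega)
    (fun j => by have := hu1 j; omega) hu (fun i j => (hut j i).symm)
  obtain ⟨P4, h4⟩ := hO t r (φ + 1) (fun j => by have := ht1 j; omega) (by omega)
    (fun j => by have := ht2 j; omega)
  obtain ⟨P5, h5⟩ := RExec.clear_all t
  obtain ⟨P6, h6⟩ := RExec.move_all u t hu ht hut
  -- Simultaneous assignment: the new state is computed from `t` into `u`, then `t` is cleared, `u`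
  -- is moved back, and the condition is recomputed in `φ`.
  let body : Prog := .seq (.loop φ (.dec φ)) (.seq P3 (.seq P5 (.seq P6 P2)))
  refine ⟨.seq P1 (.seq P2 (.seq (.loop φ body) (.seq P4 P5))), fun s m hs hsr hsb => ?_⟩
  obtain ⟨T, w, w0, w1, w2, w3, w4⟩ := h (fun i => s (a i)) m hs
  set B := 2 ^ q.eval m
  -- the registers during the loop
  let St : (κ → ℕ) → ℕ → (ℕ → ℕ) → Prop := fun w y s' =>
    (∀ j, s' (t j) = w j) ∧ s' φ = y ∧ ∀ z, (∀ j, z ≠ t j) → z ≠ φ → s' z = s z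
  have hcond : ∀ i ≤ T, ∀ s', St (w i) 0 s' → ∃ s'', RExec B P2 s' s'' ∧ St (w i) (c (w i)) s'' := by
    rintro i hi s' ⟨e1, e2, e3⟩
    refine ⟨_, (h2 s' (p.eval m) (fun j => by rw [e1]; exact w3 i hi j) e2 ?_).mono (hq2 m), ?_, ?_,
      ?_⟩
    · intro z hz
      rw [e3 z (fun j => by have := ht1 j; omega) (by omega)]
      exact hsb z (by omega)
    · intro j
      rw [update_of_ne (by have := ht1 j; omega), e1]
    · simp [e1]
    · intro z hz hz'
      rw [update_of_ne hz', e3 z hz hz']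
  have hbody : ∀ i < T, ∀ y s', St (w i) y s' →
      ∃ s'', RExec B body s' s'' ∧ St (w (i + 1)) (c (w (i + 1))) s'' := by
    rintro i hi y s' ⟨e1, e2, e3⟩
    have f1 : RExec B (.loop φ (.dec φ)) s' (update s' φ 0) := RExec.clear φ s'
    have f1t : ∀ j, update s' φ 0 (t j) = w i j := fun j => by
      rw [update_of_ne (by have := ht1 j; omega), e1]
    obtain ⟨s2, f2, f3, f4⟩ := h3 (update s' φ 0) (p.eval m)
      (fun j => by rw [f1t]; exact w3 i hi.le j)
      (fun j => by
        have := hu1 j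
        have := hu2 j
        rw [update_of_ne (by omega), e3 _ (fun j' => hut j j') (by omega)]
        exact hsb _ (by omega))
      (fun z hz => by
        rw [update_of_ne (by omega), e3 z (fun j => by have := ht1 j; omega) (by omega)]
        exact hsb z (by omega))
    obtain ⟨s3, g1, g2, g3⟩ := h5 B s2
    have hs3u : ∀ j, s3 (u j) = w (i + 1) j := fun j => by
      rw [g3 _ (hut j), f3, (w1 i hi).2]
      simp only [f1t]
    obtain ⟨s4, k1, k2, k3, k4⟩ := h6 B s3 g2 (fun j => by
      rw [hs3u, (w1 i hi).2]
      exact lt_of_lt_of_le (hp3 j _ _ (w3 i hi.le)) (hq3 m))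
    obtain ⟨s5, l1, l2⟩ := hcond (i + 1) hi s4 ⟨fun j => by rw [k2, hs3u], by
      rw [k4 φ (fun j => by have := ht1 j; omega) (fun j => by have := hu1 j; omega),
        g3 φ (fun j => by have := ht1 j; omega), f4 φ (fun j => by have := hu1 j; omega)]
      simp, fun z hz hz' => by
      by_cases hzu : ∃ j, z = u j
      · obtain ⟨j, rfl⟩ := hzu
        rw [k3]
        exact (hsb _ (by have := hu2 j; omega)).symm
      · push Not at hzu
        rw [k4 z hz hzu, g3 z hz, f4 z hzu, update_of_ne hz', e3 z hz hz']⟩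
    exact ⟨s5, f1.seq ((f2.mono (hq3 m)).seq (g1.seq (k1.seq l1))), l2⟩
  -- Induction on the number of remaining rounds. No bound on `T` is ever used, only the bound on
  -- the states.
  have hloop : ∀ k i, i + k = T → ∀ s', St (w i) (c (w i)) s' →
      ∃ s'', RExec B (.loop φ body) s' s'' ∧ St (w T) 0 s'' := by
    intro k
    induction k with
    | zero =>
      rintro i hi s' hs'
      obtain rfl : i = T := by omega
      rw [w2] at hs'
      exact ⟨s', RExec.loop_zero hs'.2.1, hs'⟩
    | succ k ih =>
      rintro i hi s' hs'
      obtain ⟨s1, f1, f2⟩ := hbody i (by omega) _ s' hs'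
      obtain ⟨s2, f3, f4⟩ := ih (i + 1) (by omega) s1 f2
      exact ⟨s2, RExec.loop_succ (by rw [hs'.2.1]; exact (w1 i (by omega)).1) f1 f3, f4⟩
  obtain ⟨s1, f1, f2, f3⟩ := h1 s m hs (fun j => hsb _ (ht2 j)) fun j hj => hsb j (by omega)
  obtain ⟨s2, f4, f5⟩ := hcond 0 (by omega) s1 ⟨fun j => by rw [f2, w0], by
    rw [f3 φ (fun j => by have := ht1 j; omega)]
    exact hsb _ (by omega), fun z hz _ => f3 z hz⟩
  obtain ⟨s3, f6, f7, f8, f9⟩ := hloop T 0 (by omega) s2 f5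
  have f10 := (h4 s3 (p.eval m) (fun j => by rw [f7]; exact w3 T le_rfl j)
    (by rw [f9 r (fun j => by have := ht2 j; omega) (by omega), hsr])
    (fun z hz => by
      rw [f9 z (fun j => by have := ht1 j; omega) (by omega)]
      exact hsb z (by omega))).mono (hq4 m)
  obtain ⟨s4, g1, g2, g3⟩ := h5 B (update s3 r (out fun j => s3 (t j)))
  refine ((f1.mono (hq1 m)).seq (f4.seq (f6.seq (f10.seq g1)))).congr ?_
  funext z
  by_cases hz : ∃ j, z = t j
  · obtain ⟨j, rfl⟩ := hz
    have := ht2 j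
    rw [g2, update_of_ne (by omega), hsb _ this]
  · push Not at hz
    rw [g3 z hz]
    by_cases hzr : z = r
    · subst hzr
      simp only [update_self, f7, w4]
    · rw [update_of_ne hzr, update_of_ne hzr]
      by_cases hzφ : z = φ
      · rw [hzφ, f8]
        exact (hsb _ (by omega)).symm
      · rw [f9 z hz hzφ]

end PS

set_option linter.unusedSectionVars false

/-! ### Arithmetic by bounded recursion. -/

namespace PS

variable {ι κ : Type} [Finite ι] {f g h : (ι → ℕ) → ℕ}

theorem comp_one {F : ℕ → ℕ} (hF : PS fun v : Unit → ℕ => F (v ())) (hg : PS g) :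
    PS fun v => F (g v) :=
  comp (κ := Unit) hF (g := fun _ => g) fun _ => hg

theorem succ (hg : PS g) : PS fun v => g v + 1 := comp_one (F := fun n => n + 1) (succ_proj ()) hg

theorem pred (hg : PS g) : PS fun v => g v - 1 := comp_one (F := fun n => n - 1) (pred_proj ()) hg

theorem rename (hf : PS f) (σ : ι → κ) : PS fun v : κ → ℕ => f fun i => v (σ i) :=
  comp hf fun i => proj (σ i)

theorem lift (hf : PS f) : PS fun w : Option ι → ℕ => f fun i => w (some i) := hf.rename some

theorem subst {F : ℕ → (ι → ℕ) → ℕ}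
    (hF : PS fun w : Option ι → ℕ => F (w none) fun i => w (some i)) (hg : PS g) :
    PS fun v => F (g v) v :=
  comp hF (g := fun o v => match o with
    | none => g v
    | some i => v i) (fun o => match o with
    | none => hg
    | some i => proj i)

/-- Bounded primitive recursion. -/
theorem primrec {n : (ι → ℕ) → ℕ} (hn : PS n) (hg : PS g) {H : ℕ → ℕ → (ι → ℕ) → ℕ}
    (hH : PS fun w : Option (Option ι) → ℕ =>
      H (w none) (w (some none)) fun i => w (some (some i)))
    (F : ℕ → (ι → ℕ) → ℕ) (h0 : ∀ v, F 0 v = g v) (h1 : ∀ t v, F (t + 1) v = H t (F t v) v)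
    (p : Polynomial ℕ)
    (hp : ∀ v m, (∀ i, v i < 2 ^ m) → ∀ t ≤ n v, F t v < 2 ^ p.eval m) : PS fun v => F (n v) v := by
  obtain ⟨q, hq, _⟩ := id hn
  -- The state consists of the remaining number of rounds, the index, the current value and a copy
  -- of the arguments.
  refine while_loop (κ := Option (Option (Option ι)))
    (init := fun j v => match j with
      | none => n v
      | some none => 0
      | some (some none) => g v
      | some (some (some i)) => v i) ?_ (proj none)
    (G := fun j w => match j with
      | none => w none - 1
      | some none => w (some none) + 1
      | some (some none) => H (w (some none)) (w (some (some none)))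
          fun i => w (some (some (some i)))
      | some (some (some i)) => w (some (some (some i)))) ?_ (proj (some (some none)))
    (q + p + .X) ?_
  · rintro (_ | _ | _ | i)
    exacts [hn, const 0, hg, proj i]
  · rintro (_ | _ | _ | i)
    exacts [pred_proj _, succ_proj _, hH.lift, proj _]
  · intro v m hv
    refine ⟨n v, fun t j => match j with
      | none => n v - t
      | some none => t
      | some (some none) => F t v
      | some (some (some i)) => v i, ?_, ?_, by simp, ?_, rfl⟩
    · funext j
      rcases j with _ | _ | _ | i <;> simp [h0]
    · intro t ht
      refine ⟨by simp only; omega, ?_⟩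
      funext j
      rcases j with _ | _ | _ | i
      · simp only; omega
      · rfl
      · exact h1 t v
      · rfl
    · intro t ht j
      have hq' := hq v m hv
      have e1 : 2 ^ q.eval m ≤ 2 ^ (q + p + .X).eval m :=
        Nat.pow_le_pow_right (by norm_num) (by simp; omega)
      have e2 : 2 ^ p.eval m ≤ 2 ^ (q + p + .X).eval m :=
        Nat.pow_le_pow_right (by norm_num) (by simp; omega)
      have e3 : 2 ^ m ≤ 2 ^ (q + p + .X).eval m :=
        Nat.pow_le_pow_right (by norm_num) (by simp)
      rcases j with _ | _ | _ | i
      · simp only; omega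
      · simp only; omega
      · exact (hp v m hv t ht).trans_le e2
      · exact (hv i).trans_le e3

theorem add (hg : PS g) (hh : PS h) : PS fun v => g v + h v := by
  obtain ⟨p, hp, _⟩ := id hg
  obtain ⟨q, hq, _⟩ := id hh
  refine primrec hh hg (H := fun _ y _ => y + 1) (succ_proj _) (fun t v => g v + t)
    (fun v => by simp) (fun t v => by ring) (p + q + 1) fun v m hv t ht => ?_
  have h1 := hp v m hv
  have h2 := hq v m hv
  have e1 : 2 ^ p.eval m ≤ 2 ^ (p.eval m + q.eval m) := Nat.pow_le_pow_right (by norm_num) (by simp)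
  have e2 : 2 ^ q.eval m ≤ 2 ^ (p.eval m + q.eval m) := Nat.pow_le_pow_right (by norm_num) (by simp)
  simp only [Polynomial.eval_add, Polynomial.eval_one, pow_succ]
  omega

theorem sub (hg : PS g) (hh : PS h) : PS fun v => g v - h v := by
  obtain ⟨p, hp, _⟩ := id hg
  exact primrec hh hg (H := fun _ y _ => y - 1) (pred_proj _) (fun t v => g v - t)
    (fun v => by simp) (fun t v => by omega) p fun v m hv t ht =>
      (Nat.sub_le _ _).trans_lt (hp v m hv)

/-- The range may be exponentially long: only an index and a partial sum are stored. With fewer than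
`2 ^ p` terms, each at most `2 ^ (q.comp (p + .X))`, partial sums still have polynomially many bits.
-/
theorem sum {n : (ι → ℕ) → ℕ} (hn : PS n) {F : ℕ → (ι → ℕ) → ℕ}
    (hF : PS fun w : Option ι → ℕ => F (w none) fun i => w (some i)) :
    PS fun v => ∑ i ∈ Finset.range (n v), F i v := by
  obtain ⟨p, hp, _⟩ := id hn
  obtain ⟨q, hq, _⟩ := id hF
  have hF' : PS fun w : Option (Option ι) → ℕ => F (w none) fun i => w (some (some i)) :=
    hF.rename fun j => match j with
      | none => none
      | some i => some (some i)
  refine primrec hn (const 0) (H := fun t y v => y + F t v) ((proj _).add hF')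
    (fun t v => ∑ i ∈ Finset.range t, F i v) (fun v => by simp)
    (fun t v => by rw [Finset.sum_range_succ]) (p + q.comp (p + .X)) fun v m hv t ht => ?_
  have h1 := hp v m hv
  have e1 : 2 ^ p.eval m ≤ 2 ^ (p.eval m + m) := Nat.pow_le_pow_right (by norm_num) (by simp)
  have e2 : 2 ^ m ≤ 2 ^ (p.eval m + m) := Nat.pow_le_pow_right (by norm_num) (by simp)
  have h2 : ∀ i ∈ Finset.range t, F i v ≤ 2 ^ q.eval (p.eval m + m) := by
    intro i hi
    rw [Finset.mem_range] at hi
    refine (hq (fun j => match j with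
      | none => i
      | some j => v j) (p.eval m + m) ?_).le
    rintro (_ | j)
    · simp only; omega
    · exact (hv j).trans_le e2
  have h3 := Finset.sum_le_card_nsmul _ _ _ h2
  simp only [Finset.card_range, smul_eq_mul] at h3
  simp only [Polynomial.eval_add, Polynomial.eval_comp, Polynomial.eval_X, pow_add] at h3 ⊢
  refine h3.trans_lt ?_
  exact Nat.mul_lt_mul_of_pos_right (ht.trans_lt h1) (by positivity)

theorem mul (hg : PS g) (hh : PS h) : PS fun v => g v * h v := by
  have := sum hh (F := fun _ v => g v) hg.lift
  simpa [mul_comm] using this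

theorem finset_sum (J : Finset κ) {F : κ → (ι → ℕ) → ℕ} (hF : ∀ j, PS (F j)) :
    PS fun v => ∑ j ∈ J, F j v := by
  induction J using Finset.cons_induction with
  | empty => simpa using const 0
  | cons j J hj ih =>
    simp only [Finset.sum_cons]
    exact (hF j).add ih

end PS

/-! ### Decidable predicates, division and powers. -/

/-- A predicate with a characteristic function in `PS`. -/
def PSP {ι : Type} (P : (ι → ℕ) → Prop) : Prop := ∃ c : (ι → ℕ) → ℕ, PS c ∧ ∀ v, P v ↔ c v ≠ 0

/-- A function whose values are polynomial in the number of binary digits of its arguments. -/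
def PolyBdd {ι : Type} (f : (ι → ℕ) → ℕ) : Prop :=
  ∃ p : Polynomial ℕ, ∀ v m, (∀ i, v i < 2 ^ m) → f v ≤ p.eval m

section

variable {ι κ : Type} [Finite ι] {f g h : (ι → ℕ) → ℕ} {P Q : (ι → ℕ) → Prop}

theorem PSP.congr (hP : PSP P) (e : ∀ v, Q v ↔ P v) : PSP Q := by
  obtain ⟨c, hc, h⟩ := hP
  exact ⟨c, hc, fun v => (e v).trans (h v)⟩

theorem PSP.not (hP : PSP P) : PSP fun v => ¬ P v := by
  obtain ⟨c, hc, h⟩ := hP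
  exact ⟨_, (PS.const 1).sub hc, fun v => by beta_reduce; rw [h]; omega⟩

theorem PSP.and (hP : PSP P) (hQ : PSP Q) : PSP fun v => P v ∧ Q v := by
  obtain ⟨c, hc, h⟩ := hP
  obtain ⟨c', hc', h'⟩ := hQ
  exact ⟨_, hc.mul hc', fun v => by beta_reduce; rw [h, h', mul_ne_zero_iff]⟩

theorem PSP.lift (hP : PSP P) : PSP fun w : Option ι → ℕ => P fun i => w (some i) := by
  obtain ⟨c, hc, h⟩ := hP
  exact ⟨_, hc.lift, fun v => h _⟩

theorem PSP.le (hg : PS g) (hh : PS h) : PSP fun v => g v ≤ h v :=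
  ⟨_, hh.succ.sub hg, fun v => by omega⟩

theorem PSP.lt (hg : PS g) (hh : PS h) : PSP fun v => g v < h v :=
  ⟨_, hh.sub hg, fun v => by omega⟩

theorem PSP.eq (hg : PS g) (hh : PS h) : PSP fun v => g v = h v :=
  ((PSP.le hg hh).and (PSP.le hh hg)).congr fun v => by omega

theorem PS.ite (hP : PSP P) [∀ v, Decidable (P v)] (hf : PS f) (hg : PS g) :
    PS fun v => if P v then f v else g v := by
  obtain ⟨c, hc, h⟩ := hP
  have h1 := (PS.const 1).sub hc
  -- With truncated subtraction, `1 - c v` is the indicator of the negation and `1 - (1 - c v)` that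
  -- of `P`.
  convert (((PS.const 1).sub h1).mul hf).add (h1.mul hg) using 2 with v
  by_cases hv : P v
  · have := (h v).1 hv
    have : 1 - c v = 0 := by omega
    simp [hv, this]
  · have := (not_iff_not.2 (h v)).1 hv
    have : 1 - c v = 1 := by omega
    simp [hv, this]

theorem PSP.exists_lt {n : (ι → ℕ) → ℕ} (hn : PS n) {P : ℕ → (ι → ℕ) → Prop}
    (hP : PSP fun w : Option ι → ℕ => P (w none) fun i => w (some i)) :
    PSP fun v => ∃ i < n v, P i v := by
  obtain ⟨c, hc, h⟩ := hP
  refine ⟨_, PS.sum hn (F := fun n v => c fun o => match o with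
    | none => n
    | some i => v i) ?_, fun v => ?_⟩
  · convert hc using 3 with w
    funext o
    cases o <;> rfl
  · rw [ne_eq, Finset.sum_eq_zero_iff]
    push Not
    simp only [Finset.mem_range]
    exact exists_congr fun i => and_congr_right fun _ => h fun o => match o with
      | none => i
      | some i => v i

theorem PSP.forall_lt {n : (ι → ℕ) → ℕ} (hn : PS n) {P : ℕ → (ι → ℕ) → Prop}
    (hP : PSP fun w : Option ι → ℕ => P (w none) fun i => w (some i)) :
    PSP fun v => ∀ i < n v, P i v :=
  (PSP.exists_lt hn (P := fun i v => ¬ P i v) hP.not).not.congr fun v => by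
    push Not
    rfl

theorem PSP.exists_le {n : (ι → ℕ) → ℕ} (hn : PS n) {P : ℕ → (ι → ℕ) → Prop}
    (hP : PSP fun w : Option ι → ℕ => P (w none) fun i => w (some i)) :
    PSP fun v => ∃ i ≤ n v, P i v :=
  (PSP.exists_lt hn.succ hP).congr fun v => by simp only [Nat.lt_succ_iff]

theorem PSP.forall_le {n : (ι → ℕ) → ℕ} (hn : PS n) {P : ℕ → (ι → ℕ) → Prop}
    (hP : PSP fun w : Option ι → ℕ => P (w none) fun i => w (some i)) :
    PSP fun v => ∀ i ≤ n v, P i v :=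
  (PSP.forall_lt hn.succ hP).congr fun v => by simp only [Nat.lt_succ_iff]

theorem PSP.finite_forall [Finite κ] {P : κ → (ι → ℕ) → Prop} (hP : ∀ j, PSP (P j)) :
    PSP fun v => ∀ j, P j v := by
  have := Fintype.ofFinite κ
  choose c hc h using fun j => (hP j).not
  refine (show PSP fun v => ∑ j, c j v = 0 from
    PSP.eq (PS.finset_sum _ hc) (PS.const 0)).congr fun v => ?_
  rw [Finset.sum_eq_zero_iff]
  simp only [Finset.mem_univ, true_imp_iff]
  refine forall_congr' fun j => ?_
  have := h j v
  tauto

/-- The quotient is the number of `i` with `(i + 1) * h v ≤ g v`; the condition `0 < h v` reproduces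
the convention that division by zero gives zero. -/
theorem PS.div (hg : PS g) (hh : PS h) : PS fun v => g v / h v := by
  classical
  have h1 : PSP fun w : Option ι → ℕ => (0 < h fun i => w (some i)) ∧
      (w none + 1) * (h fun i => w (some i)) ≤ g fun i => w (some i) :=
    (PSP.lt (PS.const 0) hh.lift).and (PSP.le ((PS.proj none).succ.mul hh.lift) hg.lift)
  convert PS.sum hg (F := fun i v => if 0 < h v ∧ (i + 1) * h v ≤ g v then 1 else 0)
    (PS.ite h1 (PS.const 1) (PS.const 0)) using 2 with v
  rw [Finset.sum_boole]
  rcases Nat.eq_zero_or_pos (h v) with h0 | h0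
  · simp [h0]
  · have : Finset.filter (fun i => 0 < h v ∧ (i + 1) * h v ≤ g v) (Finset.range (g v)) =
        Finset.range (g v / h v) := by
      ext i
      have h2 : g v / h v ≤ g v := Nat.div_le_self _ _
      have h3 : i < g v / h v ↔ (i + 1) * h v ≤ g v := by
        rw [← Nat.le_div_iff_mul_le h0]
        rfl
      simp only [Finset.mem_filter, Finset.mem_range, h3, h0, true_and, and_iff_right_iff_imp]
      intro h4
      have := h3.2 h4
      omega
    simp [this]

theorem PS.mod (hg : PS g) (hh : PS h) : PS fun v => g v % h v := by
  convert hg.sub (hh.mul (hg.div hh)) using 2 with v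
  have := Nat.div_add_mod (g v) (h v)
  omega

theorem PS.min (hg : PS g) (hh : PS h) : PS fun v => min (g v) (h v) := by
  convert hg.sub (hg.sub hh) using 2 with v
  omega

/-- The power `b ^ n`, cut off at `U`. -/
def cutPow (b U : ℕ) : ℕ → ℕ
  | 0 => Min.min 1 U
  | n + 1 => Min.min (cutPow b U n * b) U

theorem cutPow_eq {b U n : ℕ} (hb : 0 < b) (h : b ^ n ≤ U) : cutPow b U n = b ^ n := by
  induction n with
  | zero => simpa [cutPow] using h
  | succ n ih =>
    have h1 : b ^ n ≤ U := (Nat.pow_le_pow_right hb n.le_succ).trans h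
    rw [cutPow, ih h1, ← pow_succ, min_eq_left h]

theorem cutPow_le (b U n : ℕ) : cutPow b U n ≤ U := by
  cases n <;> exact min_le_right _ _

/-- Since powers are cut off at `g v`, the exponent may be exponentially large here, in contrast to
`PS.pow`. -/
theorem PS.cutPow {n : (ι → ℕ) → ℕ} (b : ℕ) (hU : PS g) (hn : PS n) :
    PS fun v => cutPow b (g v) (n v) := by
  obtain ⟨p, hp, _⟩ := id hU
  exact primrec hn ((const 1).min hU) (H := fun _ y v => Min.min (y * b) (g v))
    (((proj _).mul (const b)).min hU.lift.lift) (fun t v => BPS.cutPow b (g v) t) (fun v => rfl)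
    (fun t v => rfl) p fun v m hv t ht => (cutPow_le _ _ _).trans_lt (hp v m hv)

theorem PS.pow {n : (ι → ℕ) → ℕ} (hg : PS g) (hn : PS n) (hb : PolyBdd n) :
    PS fun v => g v ^ n v := by
  obtain ⟨p, hp, _⟩ := id hg
  obtain ⟨q, hq⟩ := hb
  refine primrec hn (const 1) (H := fun _ y v => y * g v) ((proj _).mul hg.lift.lift)
    (fun t v => g v ^ t) (fun v => by simp) (fun t v => pow_succ _ _) (p * q + 1)
    fun v m hv t ht => ?_
  have h1 := hp v m hv
  have h2 := hq v m hv
  calc g v ^ t ≤ (2 ^ p.eval m) ^ t := Nat.pow_le_pow_left h1.le t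
    _ = 2 ^ (p.eval m * t) := (pow_mul _ _ _).symm
    _ ≤ 2 ^ (p.eval m * q.eval m) :=
      Nat.pow_le_pow_right (by norm_num) (Nat.mul_le_mul_left _ (ht.trans h2))
    _ < 2 ^ (p * q + 1).eval m := Nat.pow_lt_pow_right (by norm_num) (by simp)

/-! ### Polynomially bounded functions -/

theorem PolyBdd.mono (hg : PolyBdd g) (h : ∀ v, f v ≤ g v) : PolyBdd f := by
  obtain ⟨p, hp⟩ := hg
  exact ⟨p, fun v m hv => (h v).trans (hp v m hv)⟩

theorem PolyBdd.const (c : ℕ) : PolyBdd fun _ : ι → ℕ => c := ⟨.C c, fun _ _ _ => by simp⟩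

theorem PolyBdd.add (hg : PolyBdd g) (hh : PolyBdd h) : PolyBdd fun v => g v + h v := by
  obtain ⟨p, hp⟩ := hg
  obtain ⟨q, hq⟩ := hh
  exact ⟨p + q, fun v m hv => by simpa using add_le_add (hp v m hv) (hq v m hv)⟩

theorem PolyBdd.mul (hg : PolyBdd g) (hh : PolyBdd h) : PolyBdd fun v => g v * h v := by
  obtain ⟨p, hp⟩ := hg
  obtain ⟨q, hq⟩ := hh
  exact ⟨p * q, fun v m hv => by simpa using Nat.mul_le_mul (hp v m hv) (hq v m hv)⟩

theorem PolyBdd.lift (hg : PolyBdd g) : PolyBdd fun w : Option ι → ℕ => g fun i => w (some i) := by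
  obtain ⟨p, hp⟩ := hg
  exact ⟨p, fun v m hv => hp _ m fun i => hv (some i)⟩

theorem PolyBdd.eval (hg : PolyBdd g) (p : Polynomial ℕ) : PolyBdd fun v => p.eval (g v) := by
  obtain ⟨q, hq⟩ := hg
  exact ⟨p.comp q, fun v m hv => by
    rw [Polynomial.eval_comp]
    exact polynomial_eval_mono p (hq v m hv)⟩

theorem PS.eval (hg : PS g) (p : Polynomial ℕ) : PS fun v => p.eval (g v) := by
  induction p using Polynomial.induction_on' with
  | add p q hp hq => simpa using hp.add hq
  | monomial n c =>
    simpa using (PS.const c).mul (hg.pow (PS.const n) (PolyBdd.const n))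

/-- An eventually constant function is a finite case distinction, unfolded one value at a time. -/
theorem PS.table (hg : PS g) (N : ℕ) (φ : ℕ → ℕ) (hφ : ∀ n, N ≤ n → φ n = φ N) :
    PS fun v => φ (g v) := by
  induction N generalizing φ g with
  | zero =>
    have : (fun v => φ (g v)) = fun _ => φ 0 := by
      funext v
      exact hφ _ (Nat.zero_le _)
    rw [this]
    exact PS.const _
  | succ N ih =>
    have h1 := ih hg.pred (fun n => φ (n + 1)) (fun n hn => hφ (n + 1) (by omega))
    convert PS.ite (PSP.eq hg (PS.const 0)) (PS.const (φ 0)) h1 using 2 with v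
    split_ifs with h0
    · rw [h0]
    · rw [Nat.sub_add_cancel (by omega)]

/-! ### Functions with finitely many values -/

/-- A function into a finite type is computable if its composition with every function is. -/
def FinPS {A : Type} (g : (ι → ℕ) → A) : Prop := ∀ φ : A → ℕ, PS fun v => φ (g v)

end

namespace FinPS

variable {ι κ A C : Type} [Finite ι] {g : (ι → ℕ) → A} {h : (ι → ℕ) → C}

theorem map (hg : FinPS g) (φ : A → C) : FinPS fun v => φ (g v) := fun ψ => hg fun a => ψ (φ a)

theorem pred (hg : FinPS g) (P : A → Prop) : PSP fun v => P (g v) := by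
  classical
  exact ⟨_, hg fun a => if P a then 1 else 0, fun v => by simp⟩

/-- The composition with `φ` is the sum of `φ a` over all `a`, weighted with the indicator of `g v =
a`. -/
theorem of_pred [Finite A] (hg : ∀ a, PSP fun v => g v = a) : FinPS g := by
  classical
  have := Fintype.ofFinite A
  intro φ
  have h1 : PS fun v => ∑ a, if g v = a then φ a else 0 :=
    PS.finset_sum _ fun a => PS.ite (hg a) (PS.const (φ a)) (PS.const 0)
  simpa using h1

theorem const (a : A) : FinPS fun _ : ι → ℕ => a := fun _ => PS.const _

theorem pair [Finite A] [Finite C] (hg : FinPS g) (hh : FinPS h) : FinPS fun v => (g v, h v) :=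
  of_pred fun a => ((hg.pred (· = a.1)).and (hh.pred (· = a.2))).congr fun v => by
    rw [Prod.ext_iff]

theorem pi [Finite A] [Finite κ] {g : κ → (ι → ℕ) → A} (hg : ∀ j, FinPS (g j)) :
    FinPS fun v j => g j v :=
  of_pred fun a => (PSP.finite_forall fun j => (hg j).pred (· = a j)).congr fun v => by
    rw [funext_iff]

theorem decode {n : (ι → ℕ) → ℕ} (hn : PS n) (N : ℕ) (D : ℕ → A) (hD : ∀ n, N ≤ n → D n = D N) :
    FinPS fun v => D (n v) :=
  fun φ => PS.table hn N (fun n => φ (D n)) fun n hn => by rw [hD n hn]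

theorem ite {P : (ι → ℕ) → Prop} (hP : PSP P) [∀ v, Decidable (P v)] {h : (ι → ℕ) → A}
    (hg : FinPS g) (hh : FinPS h) : FinPS fun v => if P v then g v else h v := fun φ => by
  convert PS.ite hP (hg φ) (hh φ) using 2 with v
  by_cases hv : P v <;> simp [hv]

theorem subst {F : ℕ → (ι → ℕ) → A}
    (hF : FinPS fun w : Option ι → ℕ => F (w none) fun i => w (some i)) {n : (ι → ℕ) → ℕ}
    (hn : PS n) : FinPS fun v => F (n v) v :=
  fun φ => PS.subst (F := fun n v => φ (F n v)) (hF φ) hn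

theorem rename (hg : FinPS g) (σ : ι → κ) : FinPS fun v : κ → ℕ => g fun i => v (σ i) :=
  fun φ => (hg φ).rename σ

end FinPS

/-! ### String valued functions -/

/-- A string valued function of natural numbers is computable if its length is computable and
polynomially bounded, and its symbols are computable. -/
structure PSStr {ι α : Type} (X : (ι → ℕ) → List α) : Prop where
  len : PS fun v => (X v).length
  bdd : PolyBdd fun v => (X v).length
  sym : FinPS fun w : Option ι → ℕ => (X fun i => w (some i))[w none]?

section

variable {ι κ α β : Type} [Finite ι] {X : (ι → ℕ) → List α}

theorem PSStr.sym_at (hX : PSStr X) {n : (ι → ℕ) → ℕ} (hn : PS n) :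
    FinPS fun v => (X v)[n v]? :=
  FinPS.subst (F := fun n v => (X v)[n]?) hX.sym hn

theorem PolyBdd.rename {f : (ι → ℕ) → ℕ} (hf : PolyBdd f) (σ : ι → κ) :
    PolyBdd fun v : κ → ℕ => f fun i => v (σ i) := by
  obtain ⟨p, hp⟩ := hf
  exact ⟨p, fun v m hv => hp _ m fun i => hv (σ i)⟩

theorem PSStr.rename (hX : PSStr X) (σ : ι → κ) : PSStr fun v : κ → ℕ => X fun i => v (σ i) where
  len := hX.len.rename σ
  bdd := hX.bdd.rename σ
  sym := hX.sym.rename fun o => match o with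
    | none => none
    | some i => some (σ i)

theorem PSStr.lift (hX : PSStr X) : PSStr fun w : Option ι → ℕ => X fun i => w (some i) :=
  hX.rename some

theorem PSStr.readInput (hX : PSStr X) {n : (ι → ℕ) → ℕ} (hn : PS n) :
    FinPS fun v => readInput (X v) (n v) := by
  classical
  have h1 : (fun v => BPS.readInput (X v) (n v)) =
      fun v => if n v = 0 then none else (X v)[n v - 1]? := by
    funext v
    rcases h : n v with _ | i
    · simp [BPS.readInput]
    · simp [BPS.readInput]
  rw [h1]
  exact FinPS.ite (PSP.eq hn (PS.const 0)) (FinPS.const none) (hX.sym_at hn.pred)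

/-! ### Arrays of digits -/

/-- The number with the digits `c 0, …, c (L - 1)` in base `N`. -/
def arr (N L : ℕ) (c : ℕ → ℕ) : ℕ := ∑ j ∈ Finset.range L, c j * N ^ j

theorem arr_succ (N L : ℕ) (c : ℕ → ℕ) : arr N (L + 1) c = c 0 + N * arr N L fun j => c (j + 1) := by
  rw [arr, Finset.sum_range_succ', arr, Finset.mul_sum, add_comm]
  congr 1
  · simp
  · exact Finset.sum_congr rfl fun j _ => by ring

theorem arr_lt {N L : ℕ} {c : ℕ → ℕ} (hc : ∀ j, c j < N) : arr N L c < N ^ L := by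
  induction L generalizing c with
  | zero => simp [arr]
  | succ L ih =>
    rw [arr_succ, pow_succ']
    have h1 := ih (c := fun j => c (j + 1)) fun j => hc _
    have h2 := hc 0
    calc c 0 + N * arr N L (fun j => c (j + 1)) < N * (arr N L (fun j => c (j + 1)) + 1) := by
          rw [mul_add]; omega
      _ ≤ _ := Nat.mul_le_mul_left _ h1

theorem arr_digit {N L : ℕ} {c : ℕ → ℕ} (hc : ∀ j, c j < N) {i : ℕ} (hi : i < L) :
    arr N L c / N ^ i % N = c i := by
  induction i generalizing L c with
  | zero =>
    obtain ⟨L, rfl⟩ := Nat.exists_eq_succ_of_ne_zero hi.ne'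
    rw [arr_succ]
    simp [Nat.mod_eq_of_lt (hc 0)]
  | succ i ih =>
    obtain ⟨L, rfl⟩ := Nat.exists_eq_succ_of_ne_zero (Nat.ne_zero_of_lt hi)
    have hN : 0 < N := (Nat.zero_le _).trans_lt (hc 0)
    rw [arr_succ, pow_succ', ← Nat.div_div_eq_div_mul, Nat.add_mul_div_left _ _ hN,
      Nat.div_eq_of_lt (hc 0), zero_add]
    exact ih (c := fun j => c (j + 1)) (fun j => hc _) (by omega)

/-- The digit `i` of `T` in base `N`, provided that `N ^ i ≤ U`. -/
def getDigit (N U T i : ℕ) : ℕ := T / cutPow N U i % N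

/-- Replaces the digit `i` of `T`. -/
def putDigit (N L U T i c : ℕ) : ℕ :=
  ∑ j ∈ Finset.range L, (if j = i then c else getDigit N U T j) * cutPow N U j

theorem getDigit_arr {N L : ℕ} {c : ℕ → ℕ} (hc : ∀ j, c j < N) {i : ℕ} (hi : i < L) :
    getDigit N (N ^ L) (arr N L c) i = c i := by
  have hN : 0 < N := (Nat.zero_le _).trans_lt (hc 0)
  rw [getDigit, cutPow_eq hN (Nat.pow_le_pow_right hN hi.le), arr_digit hc hi]

theorem putDigit_arr {N L : ℕ} {c : ℕ → ℕ} (hc : ∀ j, c j < N) (i x : ℕ) :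
    putDigit N L (N ^ L) (arr N L c) i x = arr N L (update c i x) := by
  have hN : 0 < N := (Nat.zero_le _).trans_lt (hc 0)
  refine Finset.sum_congr rfl fun j hj => ?_
  rw [Finset.mem_range] at hj
  rw [getDigit_arr hc hj, cutPow_eq hN (Nat.pow_le_pow_right hN hj.le), update_apply]

theorem PS.getDigit (N : ℕ) {U T i : (ι → ℕ) → ℕ} (hU : PS U) (hT : PS T) (hi : PS i) :
    PS fun v => getDigit N (U v) (T v) (i v) :=
  (hT.div (PS.cutPow N hU hi)).mod (PS.const N)

theorem PS.putDigit (N : ℕ) {L U T i c : (ι → ℕ) → ℕ} (hL : PS L) (hU : PS U) (hT : PS T)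
    (hi : PS i) (hc : PS c) : PS fun v => putDigit N (L v) (U v) (T v) (i v) (c v) :=
  PS.sum hL (F := fun j v => (if j = i v then c v else BPS.getDigit N (U v) (T v) j) *
      BPS.cutPow N (U v) j)
    ((PS.ite (PSP.eq (PS.proj none) hi.lift) hc.lift (PS.getDigit N hU.lift hT.lift (PS.proj none))).mul
      (PS.cutPow N hU.lift (PS.proj none)))

/-! ### Simulation of machines -/

/-- Numbers below `N` for the elements of a finite type, with `0` for `a`. -/
structure Coding (A : Type) (a : A) (N : ℕ) where
  enc : A → ℕ
  dec : ℕ → A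
  dec_enc : ∀ x, dec (enc x) = x
  enc_zero : enc a = 0
  enc_lt : ∀ x, enc x < N
  dec_const : ∀ n, N ≤ n → dec n = dec N

/-- Every large enough `N'` is allowed, so that states, tape symbols and output symbols can share
one base. The code `0` for `a` makes a blank tape the number zero. -/
theorem Coding.exists (A : Type) [Finite A] (a : A) : ∃ N, ∀ N', N ≤ N' → Nonempty (Coding A a N') := by
  classical
  obtain ⟨n, ⟨e⟩⟩ := Finite.exists_equiv_fin A
  let c : A → ℕ := fun x => if x = a then 0 else e x + 1
  have hc : Injective c := by
    intro x y h
    simp only [c] at h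
    split_ifs at h with h1 h2 h2
    · rw [h1, h2]
    · exact e.injective (Fin.ext (by omega))
  have : Nonempty A := ⟨a⟩
  have hlt : ∀ x, c x < n + 1 := fun x => by
    have := (e x).2
    simp only [c]
    split_ifs <;> omega
  refine ⟨n + 1, fun N' hN' => ⟨⟨c, fun k => if k < n + 1 then invFun c k else a, fun x => ?_, ?_,
    fun x => (hlt x).trans_le hN', fun k hk => ?_⟩⟩⟩
  · rw [if_pos (hlt x), leftInverse_invFun hc]
  · simp [c]
  · rw [if_neg (by omega), if_neg (by omega)]

/-- The registers of a simulation with `k` work tapes and the context `ι`. -/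
inductive SimReg (k : ℕ) (ι : Type) where
  | st
  | pos
  | out
  | len
  | bd
  | wd
  | hd (i : Fin k)
  | tp (i : Fin k)
  | ctx (j : ι)

instance (k : ℕ) : Finite (SimReg k ι) :=
  Finite.of_surjective (fun o : Fin 6 ⊕ (Bool × Fin k) ⊕ ι => match o with
    | .inl 0 => SimReg.st
    | .inl 1 => .pos
    | .inl 2 => .out
    | .inl 3 => .len
    | .inl 4 => .bd
    | .inl 5 => .wd
    | .inr (.inl (true, i)) => .hd i
    | .inr (.inl (false, i)) => .tp i
    | .inr (.inr j) => .ctx j)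
    (by
      rintro (_ | _ | _ | _ | _ | _ | i | i | j)
      exacts [⟨.inl 0, rfl⟩, ⟨.inl 1, rfl⟩, ⟨.inl 2, rfl⟩, ⟨.inl 3, rfl⟩, ⟨.inl 4, rfl⟩,
        ⟨.inl 5, rfl⟩, ⟨.inr (.inl (true, i)), rfl⟩, ⟨.inr (.inl (false, i)), rfl⟩,
        ⟨.inr (.inr j), rfl⟩])

theorem PS.move_apply {mv : (ι → ℕ) → Move} (hm : FinPS mv) {n : (ι → ℕ) → ℕ} (hn : PS n) :
    PS fun v => (mv v).apply (n v) := by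
  classical
  convert PS.ite (hm.pred (· = .left)) hn.pred (PS.ite (hm.pred (· = .right)) hn.succ hn)
    using 2 with v
  cases mv v <;> simp [Move.apply]

namespace Machine

variable (M : Machine α β) {N : ℕ} (cQ : Coding M.State M.start N) (cS : Coding M.Sym M.blank N)
  (cO : Coding (Option β) none N) (X : (ι → ℕ) → List α) (L : (ι → ℕ) → ℕ)

/-- The registers that represent a configuration. -/
def simEnc (v : ι → ℕ) (c : Config M) : SimReg M.tapes ι → ℕ
  | .st => cQ.enc c.state
  | .pos => c.inputHead
  | .out => arr N (L v) fun j => cO.enc c.output[j]?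
  | .len => c.output.length
  | .bd => N ^ L v
  | .wd => L v
  | .hd i => c.head i
  | .tp i => arr N (L v) fun j => cS.enc (c.tape i j)
  | .ctx j => v j

/-- The instruction for the represented configuration. -/
def simInstr (w : SimReg M.tapes ι → ℕ) :
    Option (M.State × Move × (Fin M.tapes → M.Sym × Move) × Option β) :=
  M.δ (cQ.dec (w .st)) (readInput (X fun j => w (.ctx j)) (w .pos))
    fun i => cS.dec (getDigit N (w .bd) (w (.tp i)) (w (.hd i)))

/-- The instruction, or an arbitrary one if the machine halts. -/
def simAct (w : SimReg M.tapes ι → ℕ) :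
    M.State × Move × (Fin M.tapes → M.Sym × Move) × Option β :=
  (M.simInstr cQ cS X w).getD (M.start, .stay, fun _ => (M.blank, .stay), none)

/-- One step of the simulation. -/
def simStep (j : SimReg M.tapes ι) (w : SimReg M.tapes ι → ℕ) : ℕ :=
  match j with
  | .st => cQ.enc (M.simAct cQ cS X w).1
  | .pos => min ((M.simAct cQ cS X w).2.1.apply (w .pos)) ((X fun j => w (.ctx j)).length + 1)
  | .out => if (M.simAct cQ cS X w).2.2.2 = none then w .out else
      putDigit N (w .wd) (w .bd) (w .out) (w .len) (cO.enc (M.simAct cQ cS X w).2.2.2)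
  | .len => w .len + (M.simAct cQ cS X w).2.2.2.toList.length
  | .bd => w .bd
  | .wd => w .wd
  | .hd i => ((M.simAct cQ cS X w).2.2.1 i).2.apply (w (.hd i))
  | .tp i => putDigit N (w .wd) (w .bd) (w (.tp i)) (w (.hd i))
      (cS.enc ((M.simAct cQ cS X w).2.2.1 i).1)
  | .ctx j => w (.ctx j)

variable {X}

theorem finPS_simInstr [Finite α] (hX : PSStr X) : FinPS (M.simInstr cQ cS X) := by
  have := M.finite_state
  have := M.finite_sym
  have h1 : FinPS fun w : SimReg M.tapes ι → ℕ => cQ.dec (w .st) :=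
    FinPS.decode (PS.proj _) N _ cQ.dec_const
  have h2 : FinPS fun w : SimReg M.tapes ι → ℕ => readInput (X fun j => w (.ctx j)) (w .pos) :=
    (hX.rename SimReg.ctx).readInput (PS.proj _)
  have h3 : FinPS fun (w : SimReg M.tapes ι → ℕ) i =>
      cS.dec (getDigit N (w .bd) (w (.tp i)) (w (.hd i))) :=
    FinPS.pi fun i => FinPS.decode (PS.getDigit N (PS.proj _) (PS.proj _) (PS.proj _)) N _
      cS.dec_const
  exact ((h1.pair h2).pair h3).map fun a => M.δ a.1.1 a.1.2 a.2

theorem ps_simStep [Finite α] (hX : PSStr X) (j : SimReg M.tapes ι) :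
    PS (M.simStep cQ cS cO X j) := by
  classical
  have h : FinPS (M.simAct cQ cS X) := (M.finPS_simInstr cQ cS hX).map fun a => a.getD _
  rcases j with _ | _ | _ | _ | _ | _ | i | i | j
  · exact h fun a => cQ.enc a.1
  · exact (PS.move_apply (h.map fun a => a.2.1) (PS.proj _)).min (hX.len.rename SimReg.ctx).succ
  · exact PS.ite (h.pred fun a => a.2.2.2 = none) (PS.proj _)
      (PS.putDigit N (PS.proj _) (PS.proj _) (PS.proj _) (PS.proj _) (h fun a => cO.enc a.2.2.2))
  · exact (PS.proj _).add (h fun a => a.2.2.2.toList.length)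
  · exact PS.proj _
  · exact PS.proj _
  · exact PS.move_apply (h.map fun a => (a.2.2.1 i).2) (PS.proj _)
  · exact PS.putDigit N (PS.proj _) (PS.proj _) (PS.proj _) (PS.proj _)
      (h fun a => cS.enc (a.2.2.1 i).1)
  · exact PS.proj _

theorem simInstr_enc {v : ι → ℕ} {c : Config M} (hc : ∀ i, c.head i < L v) :
    M.simInstr cQ cS X (M.simEnc cQ cS cO L v c) = M.next (X v) c := by
  simp only [simInstr, simEnc, next, cQ.dec_enc]
  congr 1
  funext i
  rw [getDigit_arr (fun j => cS.enc_lt _) (hc i), cS.dec_enc]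

theorem simStep_enc {v : ι → ℕ} {c : Config M} (hc : ∀ i, c.head i < L v)
    (hn : M.next (X v) c ≠ none) : (fun j => M.simStep cQ cS cO X j (M.simEnc cQ cS cO L v c)) =
      M.simEnc cQ cS cO L v (M.step (X v) c) := by
  obtain ⟨⟨q, mv, a, o⟩, h⟩ := Option.ne_none_iff_exists'.1 hn
  have h1 : M.simAct cQ cS X (M.simEnc cQ cS cO L v c) = (q, mv, a, o) := by
    rw [simAct, simInstr_enc M cQ cS cO L hc, h]
    rfl
  funext j
  rcases j with _ | _ | _ | _ | _ | _ | i | i | j <;> simp only [simStep, h1, simEnc, step, h]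
  · rcases o with _ | b
    · simp
    -- Positions behind the output carry the code of `none`, so appending a symbol is a change of
    -- the single digit at `c.output.length`.
    · rw [if_neg (by simp), putDigit_arr fun j => cO.enc_lt _]
      congr 1
      funext j
      rw [update_apply]
      split_ifs with hj
      · simp [hj]
      · rcases lt_or_gt_of_ne hj with hj | hj
        · simp [List.getElem?_append, hj]
        · simp [List.getElem?_append, show ¬ j < c.output.length by omega]
          rw [List.getElem?_eq_none (by simp; omega)]
  · simp
  · rw [putDigit_arr fun j => cS.enc_lt _]
    congr 1
    funext j
    simp only [update_apply]
    split_ifs <;> rfl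

theorem output_length_le (x : List α) (c : Config M) :
    c.output.length ≤ (M.step x c).output.length := by
  rw [step]
  split <;> simp

theorem run_succ (x : List α) (t : ℕ) : M.run x (t + 1) = M.step x (M.run x t) :=
  iterate_succ_apply' _ _ _

theorem run_of_halted {x : List α} {t : ℕ} (h : M.Halted x (M.run x t)) {t' : ℕ} (ht : t ≤ t') :
    M.run x t' = M.run x t := by
  obtain ⟨j, rfl⟩ := Nat.exists_eq_add_of_le ht
  rw [run, add_comm, iterate_add_apply]
  exact M.iterate_of_halted x _ h j

/-- Functions of the final configuration of a polynomial space machine are computable. -/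
theorem simulate [Finite α] (hX : PSStr X) (hN : 0 < N) (p q : Polynomial ℕ) {F : List α → List β}
    (hM : ∀ x, (∃ t, M.OutputsWithin x (F x) t) ∧ M.UsesSpace x (p.eval x.length))
    (hq : ∀ x, (F x).length ≤ q.eval x.length) {out : (SimReg M.tapes ι → ℕ) → ℕ} (hout : PS out)
    (f : (ι → ℕ) → ℕ) (hf : ∀ v c, c.output = F (X v) →
      out (M.simEnc cQ cS cO (fun v => (p + q).eval (X v).length) v c) = f v) : PS f := by
  classical
  -- One array length for everything: `p` bounds the work heads and `q` the output.
  set L : (ι → ℕ) → ℕ := fun v => (p + q).eval (X v).length with hL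
  have hLps : PS L := hX.len.eval _
  have hLbd : PolyBdd L := hX.bdd.eval _
  obtain ⟨l, hl⟩ := hX.bdd
  obtain ⟨r, hr⟩ := id hLbd
  have hinit : ∀ j, PS fun v => M.simEnc cQ cS cO L v M.initial j := by
    rintro (_ | _ | _ | _ | _ | _ | i | i | j)
    · exact PS.const _
    · exact PS.const _
    · convert PS.const 0 using 2 with v
      simp [simEnc, initial, cO.enc_zero, arr]
    · exact PS.const _
    · exact (PS.const N).pow hLps hLbd
    · exact hLps
    · exact PS.const _
    · convert PS.const 0 using 2 with v
      simp [simEnc, initial, cS.enc_zero, arr]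
    · exact PS.proj j
  refine PS.while_loop (init := fun j v => M.simEnc cQ cS cO L v M.initial j) hinit
    (c := fun w => if M.simInstr cQ cS X w = none then 0 else 1)
    (PS.ite ((M.finPS_simInstr cQ cS hX).pred (· = none)) (PS.const 0) (PS.const 1))
    (M.ps_simStep cQ cS cO hX) hout (.C N * r + r + l + .X + .C N + 2) fun v m hv => ?_
  obtain ⟨⟨t, ht1, ht2⟩, hs⟩ := hM (X v)
  have hex : ∃ t, M.Halted (X v) (M.run (X v) t) := ⟨t, ht1⟩
  -- The simulation stops at the first halting time, which may be exponentially large.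
  let T := Nat.find hex
  have hT : M.Halted (X v) (M.run (X v) T) := Nat.find_spec hex
  have hTt : T ≤ t := Nat.find_min' hex ht1
  have hrun : M.run (X v) t = M.run (X v) T := M.run_of_halted hT hTt
  have hhead : ∀ t' i, (M.run (X v) t').head i < L v := fun t' i =>
    (hs t' i).trans_le (by simp [hL])
  have hlen : ∀ t' ≤ T, (M.run (X v) t').output.length ≤ L v := by
    intro t' ht'
    have h1 : Monotone fun t => (M.run (X v) t).output.length :=
      monotone_nat_of_le_succ fun n => by
        rw [run_succ]
        exact M.output_length_le _ _
    have h2 := h1 (ht'.trans hTt)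
    simp only [ht2] at h2
    refine h2.trans ((hq (X v)).trans ?_)
    simp [hL]
  have hpos : ∀ t', (M.run (X v) t').inputHead ≤ (X v).length + 1 := by
    intro t'
    induction t' with
    | zero => simp [run, initial]
    | succ t' ih =>
      rw [run_succ, step]
      split
      · exact ih
      · simp
  refine ⟨T, fun t => M.simEnc cQ cS cO L v (M.run (X v) t), rfl, ?_, ?_, ?_, ?_⟩
  · intro t' ht'
    have h1 : M.next (X v) (M.run (X v) t') ≠ none := Nat.find_min hex ht'
    refine ⟨?_, ?_⟩
    · rw [M.simInstr_enc cQ cS cO L (hhead t'), if_neg h1]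
      simp
    · beta_reduce
      rw [run_succ]
      exact (M.simStep_enc cQ cS cO L (hhead t') h1).symm
  · rw [M.simInstr_enc cQ cS cO L (hhead T), if_pos (show M.next _ _ = none from hT)]
  · intro t' ht' j
    have h1 := hr v m hv
    have h2 := hl v m hv
    beta_reduce at h2
    -- The arrays are the only large registers; `N < 2 ^ N` bounds their number of bits by `N * L
    -- v`. The machine's other registers are bounded by a polynomial, and the context consists of
    -- the arguments.
    have h3 : N ^ L v ≤ 2 ^ (N * r.eval m) := by
      calc N ^ L v ≤ (2 ^ N) ^ L v := Nat.pow_le_pow_left Nat.lt_two_pow_self.le _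
        _ = 2 ^ (N * L v) := (pow_mul _ _ _).symm
        _ ≤ _ := Nat.pow_le_pow_right (by norm_num) (Nat.mul_le_mul_left _ h1)
    have hE : (Polynomial.C N * r + r + l + .X + .C N + 2 : Polynomial ℕ).eval m =
        N * r.eval m + r.eval m + l.eval m + m + N + 2 := by simp
    rw [hE]
    have big : ∀ y, y ≤ r.eval m + l.eval m + N + 1 →
        y < 2 ^ (N * r.eval m + r.eval m + l.eval m + m + N + 2) := fun y hy =>
      (by omega : y < N * r.eval m + r.eval m + l.eval m + m + N + 2).trans Nat.lt_two_pow_self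
    have big2 : 2 ^ (N * r.eval m) < 2 ^ (N * r.eval m + r.eval m + l.eval m + m + N + 2) :=
      Nat.pow_lt_pow_right (by norm_num) (by omega)
    rcases j with _ | _ | _ | _ | _ | _ | i | i | j
    · have := cQ.enc_lt (M.run (X v) t').state
      exact big _ (by simp only [simEnc]; omega)
    · have := hpos t'
      exact big _ (by simp only [simEnc]; omega)
    · exact ((arr_lt fun j => cO.enc_lt _).trans_le h3).trans big2
    · have := hlen t' ht'
      exact big _ (by simp only [simEnc]; omega)
    · exact h3.trans_lt big2
    · exact big _ (by simp only [simEnc]; omega)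
    · have := hhead t' i
      exact big _ (by simp only [simEnc]; omega)
    · exact ((arr_lt fun j => cS.enc_lt _).trans_le h3).trans big2
    · refine (hv j).trans_le (Nat.pow_le_pow_right (by norm_num) (by omega))
  · rw [hf]
    rw [← hrun, ht2]

end Machine

/-- Polynomial space functions preserve computable strings. -/
theorem PSStr.fpspace [Finite α] [Finite β] (hX : PSStr X) {F : List α → List β} (hF : FPSpace F) :
    PSStr fun v => F (X v) := by
  classical
  obtain ⟨⟨M, p, hM⟩, q, hq⟩ := hF
  have := M.finite_state
  have := M.finite_sym
  obtain ⟨N1, h1⟩ := Coding.exists M.State M.start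
  obtain ⟨N2, h2⟩ := Coding.exists M.Sym M.blank
  obtain ⟨N3, h3⟩ := Coding.exists (Option β) none
  obtain ⟨cQ⟩ := h1 (N1 + N2 + N3 + 1) (by omega)
  obtain ⟨cS⟩ := h2 (N1 + N2 + N3 + 1) (by omega)
  obtain ⟨cO⟩ := h3 (N1 + N2 + N3 + 1) (by omega)
  have hlen : PS fun v => (F (X v)).length :=
    M.simulate cQ cS cO hX (by omega) p q hM hq (PS.proj .len) _ fun v c hc => by
      simp only [Machine.simEnc, hc]
  refine ⟨hlen, ?_, fun φ => ?_⟩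
  · obtain ⟨r, hr⟩ := hX.bdd.eval q
    exact ⟨r, fun v m hv => (hq _).trans (hr v m hv)⟩
  -- The queried position is carried through the simulation as the context register `ctx none`, and
  -- the output array is read there at the end.
  · have hout : FinPS fun w : SimReg M.tapes (Option ι) → ℕ =>
        if w (.ctx none) < w .len then
          cO.dec (getDigit (N1 + N2 + N3 + 1) (w .bd) (w .out) (w (.ctx none))) else none :=
      FinPS.ite (PSP.lt (PS.proj _) (PS.proj _))
        (FinPS.decode (PS.getDigit _ (PS.proj _) (PS.proj _) (PS.proj _)) _ _ cO.dec_const)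
        (FinPS.const none)
    refine M.simulate cQ cS cO hX.lift (by omega) p q hM hq (hout φ) _ fun v c hc => ?_
    congr 1
    simp only [Machine.simEnc, hc]
    split_ifs with h
    · rw [getDigit_arr (fun j => cO.enc_lt _), cO.dec_enc]
      refine h.trans_le ((hq _).trans ?_)
      simp
    · rw [List.getElem?_eq_none (by omega)]

end

/-! ### Strings as numbers -/

/-- The last `j` binary digits of `r`, most significant digit first. -/
def bitString (j r : ℕ) : List Bool := List.ofFn fun i : Fin j => r.testBit (j - 1 - i)

@[simp] theorem length_bitString (j r : ℕ) : (bitString j r).length = j := by simp [bitString]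

theorem getElem?_bitString (j r i : ℕ) :
    (bitString j r)[i]? = if i < j then some (r.testBit (j - 1 - i)) else none := by
  rw [bitString, List.getElem?_ofFn]
  split_ifs <;> rfl

theorem bitString_succ (j r : ℕ) (b : Bool) :
    bitString (j + 1) (2 * r + b.toNat) = bitString j r ++ [b] := by
  apply List.ext_getElem?
  intro i
  rw [List.getElem?_append]
  simp only [getElem?_bitString, length_bitString]
  rcases lt_trichotomy i j with h | rfl | h
  · have : j + 1 - 1 - i = (j - 1 - i) + 1 := by omega
    rw [if_pos (by omega), if_pos h, if_pos h, this, Nat.testBit_succ]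
    congr 2
    cases b
    · simp
    · simp
      omega
  · cases b <;> simp
  · rw [if_neg (by omega), if_neg (by omega), List.getElem?_eq_none (by simp; omega)]

/-- The number with the binary expansion `1x`. -/
def strCode (x : List Bool) : ℕ := x.foldl (fun m b => 2 * m + b.toNat) 1

theorem strCode_concat (x : List Bool) (b : Bool) :
    strCode (x ++ [b]) = 2 * strCode x + b.toNat := by
  simp [strCode]

theorem strCode_pos (x : List Bool) : 0 < strCode x := by
  induction x using List.reverseRecOn with
  | nil => simp [strCode]
  | append_singleton x b ih =>
    rw [strCode_concat]
    omega

theorem strCode_lt (x : List Bool) : strCode x < 2 ^ (x.length + 1) := by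
  induction x using List.reverseRecOn with
  | nil => simp [strCode]
  | append_singleton x b ih =>
    rw [strCode_concat, List.length_append, List.length_singleton, pow_succ]
    have := Bool.toNat_le b
    omega

/-- The string that is coded by a number. -/
def codeStr (n : ℕ) : List Bool := bitString (Nat.log 2 n) n

theorem codeStr_strCode (x : List Bool) : codeStr (strCode x) = x := by
  induction x using List.reverseRecOn with
  | nil => simp [strCode, codeStr, bitString]
  | append_singleton x b ih =>
    have h1 := strCode_pos x
    have h2 : Nat.log 2 (2 * strCode x + b.toNat) = Nat.log 2 (strCode x) + 1 := by
      have hb := Bool.toNat_le b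
      rw [Nat.log_of_one_lt_of_le (by norm_num) (by omega)]
      congr 2
      omega
    rw [codeStr, strCode_concat, h2, bitString_succ]
    rw [codeStr] at ih
    rw [ih]

/-! ### Logarithms, bits and strings coded by numbers. -/

section

variable {ι α : Type} [Finite ι]

theorem cutPow_eq_min {b : ℕ} (hb : 0 < b) (U n : ℕ) : cutPow b U n = min (b ^ n) U := by
  induction n with
  | zero => simp [cutPow]
  | succ n ih =>
    rw [cutPow, ih, pow_succ]
    rcases le_total (b ^ n) U with h | h
    · rw [min_eq_left h]
    · rw [min_eq_right h, min_eq_right (Nat.le_mul_of_pos_right U hb),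
        min_eq_right (h.trans (Nat.le_mul_of_pos_right _ hb))]

/-- The logarithm counts the `i` with `2 ^ (i + 1) ≤ f v`. Cutting the power off at `f v + 1` does
not affect this comparison and keeps it short. -/
theorem PS.log {f : (ι → ℕ) → ℕ} (hf : PS f) : PS fun v => Nat.log 2 (f v) := by
  classical
  have h1 : PSP fun w : Option ι → ℕ =>
      BPS.cutPow 2 ((f fun i => w (some i)) + 1) (w none + 1) ≤ f fun i => w (some i) :=
    PSP.le (PS.cutPow 2 hf.lift.succ (PS.proj none).succ) hf.lift
  convert PS.sum hf (F := fun i v => if BPS.cutPow 2 (f v + 1) (i + 1) ≤ f v then 1 else 0)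
    (PS.ite h1 (PS.const 1) (PS.const 0)) using 2 with v
  rw [Finset.sum_boole]
  have : Finset.filter (fun i => BPS.cutPow 2 (f v + 1) (i + 1) ≤ f v) (Finset.range (f v)) =
      Finset.range (Nat.log 2 (f v)) := by
    ext i
    rw [Finset.mem_filter, Finset.mem_range, Finset.mem_range, cutPow_eq_min (by norm_num)]
    have h2 : Min.min (2 ^ (i + 1)) (f v + 1) ≤ f v ↔ 2 ^ (i + 1) ≤ f v := by
      rw [min_le_iff]
      omega
    rw [h2]
    rcases Nat.eq_zero_or_pos (f v) with h0 | h0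
    · simp [h0]
    · rw [← Nat.le_log_iff_pow_le (by norm_num) h0.ne']
      have : Nat.log 2 (f v) < f v := Nat.log_lt_self 2 h0.ne'
      omega
  simp [this]

theorem PolyBdd.log {f : (ι → ℕ) → ℕ} (hf : PS f) : PolyBdd fun v => Nat.log 2 (f v) := by
  obtain ⟨p, hp, _⟩ := hf
  refine ⟨p, fun v m hv => ?_⟩
  rcases Nat.eq_zero_or_pos (f v) with h0 | h0
  · simp [h0]
  · exact (Nat.log_lt_of_lt_pow h0.ne' (hp v m hv)).le

theorem PSStr.of_getElem {X : (ι → ℕ) → List α} (h1 : PS fun v => (X v).length)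
    (h2 : PolyBdd fun v => (X v).length) {s : ℕ → (ι → ℕ) → α}
    (h3 : FinPS fun w : Option ι → ℕ => s (w none) fun i => w (some i))
    (h4 : ∀ v i (h : i < (X v).length), (X v)[i] = s i v) : PSStr X where
  len := h1
  bdd := h2
  sym := by
    classical
    have h5 : (fun w : Option ι → ℕ => (X fun i => w (some i))[w none]?) = fun w =>
        if w none < (X fun i => w (some i)).length then some (s (w none) fun i => w (some i))
        else none := by
      funext w
      split_ifs with h
      · rw [List.getElem?_eq_getElem h, h4]
      · rw [List.getElem?_eq_none (by omega)]
    rw [h5]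
    exact FinPS.ite (PSP.lt (PS.proj none) h1.lift) (h3.map some) (FinPS.const none)

/-- A power above `f v + 1` may be replaced by `f v + 1`, since both quotients are zero. -/
theorem FinPS.testBit {f n : (ι → ℕ) → ℕ} (hf : PS f) (hn : PS n) :
    FinPS fun v => (f v).testBit (n v) := by
  classical
  have h : (fun v => (f v).testBit (n v)) =
      fun v => if f v / cutPow 2 (f v + 1) (n v) % 2 = 1 then true else false := by
    funext v
    rw [Nat.testBit_eq_decide_div_mod_eq, cutPow_eq_min (by norm_num)]
    rcases le_total (2 ^ n v) (f v + 1) with h | h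
    · rw [min_eq_left h]
      simp
    · rw [min_eq_right h, Nat.div_eq_of_lt (by omega), Nat.div_eq_of_lt (by omega)]
      simp
  rw [h]
  exact FinPS.ite (PSP.eq ((hf.div (PS.cutPow 2 hf.succ hn)).mod (PS.const 2)) (PS.const 1))
    (FinPS.const _) (FinPS.const _)

theorem PSStr.bitString {j r : (ι → ℕ) → ℕ} (hj : PS j) (hb : PolyBdd j) (hr : PS r) :
    PSStr fun v => bitString (j v) (r v) :=
  PSStr.of_getElem (by simpa using hj) (by simpa using hb)
    (s := fun i v => (r v).testBit (j v - 1 - i))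
    (FinPS.testBit hr.lift ((hj.lift.pred).sub (PS.proj none))) fun v i h => by
      simp [BPS.bitString]

theorem PSStr.codeStr {f : (ι → ℕ) → ℕ} (hf : PS f) : PSStr fun v => codeStr (f v) :=
  PSStr.bitString hf.log (PolyBdd.log hf) hf

end

/-! ### Reading the input and writing the output -/

/-- Register `1` is incremented if the input head is on a symbol. -/
def senseProg : Prog := .seq (.onInput (some true) (.inc 1)) (.onInput (some false) (.inc 1))

/-- The registers while the input is read. -/
def readRegs (n f : ℕ) : ℕ → ℕ := fun z => if z = 0 then n else if z = 1 then f else 0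

theorem senseProg_exec {x : List Bool} {B : ℕ} (hB : 1 < B) (n pos : ℕ) (out : List ℕ) :
    Exec x B senseProg ⟨readRegs n 0, pos, out⟩
      ⟨readRegs n (if readInput x pos = none then 0 else 1), pos, out⟩ := by
  have h1 : Exec x B (.inc 1) ⟨readRegs n 0, pos, out⟩ ⟨readRegs n 1, pos, out⟩ := by
    refine RExec.congr (RExec.inc 1 (by simpa [readRegs])) ?_ x pos out
    funext z
    simp only [update_apply, readRegs]
    split_ifs <;> simp_all
  rcases h : readInput x pos with _ | _ | _
  · exact .seq (.onInput_false (by simp [h])) (.onInput_false (by simp [h]))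
  · exact .seq (.onInput_false (by simp [h])) (.onInput_true (by simp [h]) h1)
  · exact .seq (.onInput_true (by simp [h]) h1) (.onInput_false (by simp [h]))

/-- Appends the current input symbol to the number in register `0`. -/
def readBody : Prog :=
  .seq (.dec 1) (.seq (.loop 0 (.seq (.dec 0) (.seq (.inc 2) (.inc 3))))
    (.seq (.loop 3 (.seq (.dec 3) (.inc 2))) (.seq (.onInput (some true) (.inc 2))
      (.seq (.loop 2 (.seq (.dec 2) (.inc 0))) (.seq .adv senseProg)))))

/-- Reads the input into register `0`. -/
def readProg : Prog := .seq (.inc 0) (.seq .adv (.seq senseProg (.loop 1 readBody)))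

theorem readInput_append (y z : List Bool) : readInput (y ++ z) (y.length + 1) = z.head? := by
  simp only [readInput, List.getElem?_append]
  cases z <;> simp

theorem readBody_exec {B : ℕ} (y : List Bool) (b : Bool) (z : List Bool) (out : List ℕ)
    (hB : strCode (y ++ [b]) < B) :
    Exec (y ++ b :: z) B readBody ⟨readRegs (strCode y) 1, y.length + 1, out⟩
      ⟨readRegs (strCode (y ++ [b])) (if z.head? = none then 0 else 1), y.length + 2, out⟩ := by
  have h0 := strCode_pos y
  rw [strCode_concat] at hB ⊢
  set n := strCode y
  have hx : readInput (y ++ b :: z) (y.length + 1) = some b := readInput_append _ _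
  -- The contents of the registers `0`, `2` and `3`. The code is doubled by copying register `0` to
  -- `2` and `3` and adding `3` to `2`; then the new bit is added.
  let R : ℕ → ℕ → ℕ → ℕ → ℕ := fun i j k z => if z = 0 then i else if z = 2 then j else
    if z = 3 then k else 0
  have h1 : RExec B (.dec 1) (readRegs n 1) (R n 0 0) := by
    refine (RExec.dec 1 (by simp [readRegs])).congr ?_
    funext z
    simp only [update_apply, readRegs, R]
    split_ifs <;> simp_all
  have h2 : RExec B (.loop 0 (.seq (.dec 0) (.seq (.inc 2) (.inc 3)))) (R n 0 0) (R 0 n n) := by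
    refine (RExec.move_two (by norm_num) (by norm_num) (by norm_num) _ ?_ ?_).congr ?_
    · simp [R]; omega
    · simp [R]; omega
    · funext z
      simp only [update_apply, R]
      split_ifs <;> simp_all
  have h3 : RExec B (.loop 3 (.seq (.dec 3) (.inc 2))) (R 0 n n) (R 0 (2 * n) 0) := by
    refine (RExec.move (by norm_num) _ ?_).congr ?_
    · simp [R]; omega
    · funext z
      simp only [update_apply, R]
      split_ifs <;> simp_all
      omega
  have h4 : Exec (y ++ b :: z) B (.onInput (some true) (.inc 2)) ⟨R 0 (2 * n) 0, y.length + 1, out⟩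
      ⟨R 0 (2 * n + b.toNat) 0, y.length + 1, out⟩ := by
    cases b
    · exact .onInput_false (by simp [hx])
    · refine .onInput_true (by simp [hx]) (RExec.congr (RExec.inc 2 ?_) ?_ _ _ _)
      · simpa [R] using hB
      · funext z
        simp only [update_apply, R]
        split_ifs <;> simp_all
  have h5 : RExec B (.loop 2 (.seq (.dec 2) (.inc 0))) (R 0 (2 * n + b.toNat) 0)
      (readRegs (2 * n + b.toNat) 0) := by
    refine (RExec.move (by norm_num) _ ?_).congr ?_
    · simp [R]; omega
    · funext z
      simp only [update_apply, R, readRegs]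
      split_ifs <;> simp_all
  have h6 : Exec (y ++ b :: z) B .adv ⟨readRegs (2 * n + b.toNat) 0, y.length + 1, out⟩
      ⟨readRegs (2 * n + b.toNat) 0, y.length + 2, out⟩ := by
    have := Exec.adv (x := y ++ b :: z) (B := B)
      ⟨readRegs (2 * n + b.toNat) 0, y.length + 1, out⟩
    simpa using this
  have h7 := senseProg_exec (x := y ++ b :: z) (B := B) (by omega) (2 * n + b.toNat)
    (y.length + 2) out
  have hx' : readInput (y ++ b :: z) (y.length + 2) = z.head? := by
    have := readInput_append (y ++ [b]) z
    simpa using this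
  rw [hx'] at h7
  exact .seq (h1 _ _ _) (.seq (h2 _ _ _) (.seq (h3 _ _ _) (.seq h4 (.seq (h5 _ _ _)
    (.seq h6 h7)))))

/-- Loop invariant: after the prefix `y`, register `0` holds `strCode y`, and register `1` tells
whether a symbol is left. -/
theorem readProg_exec {B : ℕ} (x : List Bool) (hB : 2 ^ (x.length + 1) ≤ B) :
    ∃ pos, Exec x B readProg ⟨fun _ => 0, 0, []⟩ ⟨readRegs (strCode x) 0, pos, []⟩ := by
  have hloop : ∀ z y : List Bool, y ++ z = x →
      Exec x B (.loop 1 readBody)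
        ⟨readRegs (strCode y) (if z.head? = none then 0 else 1), y.length + 1, []⟩
        ⟨readRegs (strCode x) 0, x.length + 1, []⟩ := by
    intro z
    induction z with
    | nil =>
      rintro y rfl
      simpa using Exec.loop_zero (by simp [readRegs])
    | cons b z ih =>
      intro y hy
      have h1 := ih (y ++ [b]) (by simpa using hy)
      refine .loop_succ (by simp [readRegs]) ?_ h1
      have h2 := readBody_exec (B := B) y b z [] (by
        refine (strCode_lt _).trans_le (le_trans ?_ hB)
        refine Nat.pow_le_pow_right (by norm_num) ?_
        rw [← hy]
        simp)
      rw [hy] at h2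
      simpa using h2
  have hB' : 1 < B := by
    refine lt_of_lt_of_le ?_ hB
    exact Nat.one_lt_two_pow (by omega)
  have h1 : RExec B (.inc 0) (fun _ => 0) (readRegs 1 0) := by
    refine (RExec.inc 0 (by simpa)).congr ?_
    funext z
    simp only [update_apply, readRegs]
    split_ifs <;> simp_all
  have h2 : Exec x B .adv ⟨readRegs 1 0, 0, []⟩ ⟨readRegs 1 0, 1, []⟩ := by
    simpa using Exec.adv (x := x) (B := B) ⟨readRegs 1 0, 0, []⟩
  have h3 := senseProg_exec (x := x) hB' 1 1 []
  have h4 : readInput x 1 = x.head? := readInput_append [] x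
  rw [h4] at h3
  exact ⟨_, .seq (h1 _ _ _) (.seq h2 (.seq h3 (hloop x [] rfl)))⟩

/-- A function on strings with a computable counterpart on numbers is polynomial space computable. -/
theorem FPSpace.of_psStr {β : Type} [Finite β] [Nonempty β] {F : List Bool → List β}
    (h : PSStr fun v : Unit → ℕ => F (codeStr (v ()))) : FPSpace F := by
  classical
  have := Fintype.ofFinite β
  obtain ⟨n, ⟨e⟩⟩ := Finite.exists_equiv_fin β
  let code : β → ℕ := fun b => e b
  have hcode : Injective code := fun a b hab => e.injective (Fin.ext hab)
  obtain ⟨p, hp, hlen⟩ := h.len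
  obtain ⟨q, hq⟩ := h.bdd
  choose ps hps hsym using fun b : β => h.sym fun o => if o = some b then 1 else 0
  obtain ⟨r, hr⟩ := PS.exists_bound ps
  obtain ⟨P1, hP1⟩ := hlen (fun _ => 0) 1 4 (by simp) (by simp) (by simp)
  choose P2 hP2 using fun b => hsym b (fun o => match o with
    | none => 2
    | some _ => 0) 3 4 (by rintro (_ | _) <;> simp) (by simp) (by rintro (_ | _) <;> simp)
  -- Programs can emit constants only, so every symbol `b` is tried in turn: `P2 b` leaves in
  -- register `3` whether `b` is the symbol at the position in register `2`.
  let E : List β → Prog := fun l => l.foldr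
    (fun b P => .seq (.seq (P2 b) (.loop 3 (.seq (.dec 3) (.emit (code b))))) P) .skip
  let P : Prog := .seq readProg (.seq P1 (.loop 1 (.seq (.dec 1)
    (.seq (E Finset.univ.toList) (.inc 2)))))
  -- The code of `x` has at most `m0` bits; `m1` also bounds the output positions.
  let m0 : Polynomial ℕ := .X + 1
  let m1 : Polynomial ℕ := m0 + q.comp m0
  refine FPSpace.of_prog P (invFun code) (p.comp m0 + r.comp m1 + m1 + 1) (q.comp m0)
    (fun x => ?_) fun x => ?_
  swap
  · have := hq (fun _ => strCode x) (x.length + 1) fun _ => strCode_lt x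
    simpa [codeStr_strCode, m0] using this
  set B := 2 ^ (p.comp m0 + r.comp m1 + m1 + 1).eval x.length with hB
  set k0 := x.length + 1 with hk0
  set k1 := k0 + q.eval k0 with hk1
  have hBexp : (p.comp m0 + r.comp m1 + m1 + 1).eval x.length =
      p.eval k0 + r.eval k1 + k1 + 1 := by
    simp [m1, m0, hk1, hk0]
  rw [hBexp] at hB
  have hlenx : (F x).length ≤ q.eval k0 := by
    have := hq (fun _ => strCode x) k0 fun _ => strCode_lt x
    simpa [codeStr_strCode] using this
  obtain ⟨pos, hread⟩ := readProg_exec (B := B) x (Nat.pow_le_pow_right (by norm_num) (by omega))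
  -- The registers after `i` output symbols: the input code, the number of symbols still to write,
  -- and the position.
  let R : ℕ → ℕ → ℕ := fun i z => if z = 0 then strCode x else if z = 1 then (F x).length - i else
    if z = 2 then i else 0
  have h1 : RExec B P1 (readRegs (strCode x) 0) (R 0) := by
    refine ((hP1 (readRegs (strCode x) 0) k0 ?_ ?_ ?_).mono
      (Nat.pow_le_pow_right (by norm_num) (by omega))).congr ?_
    · intro _
      simpa [readRegs] using strCode_lt x
    · simp [readRegs]
    · intro j hj
      simp [readRegs, show j ≠ 0 by omega, show j ≠ 1 by omega]
    · funext z
      rcases z with _ | _ | _ | z <;> simp [readRegs, R, codeStr_strCode]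
  have hk1B : ∀ j, j ≤ k1 → j + 1 < B := fun j hj => by
    rw [hB]
    exact (by omega : j + 1 < p.eval k0 + r.eval k1 + k1 + 1 + 1).trans_le
      (Nat.lt_two_pow_self)
  have hE : ∀ (i : ℕ) (y : β), (F x)[i]? = some y → ∀ (l : List β), l.Nodup → ∀ (S : ℕ → ℕ),
      S 0 = strCode x → S 2 = i → (∀ j, 3 ≤ j → S j = 0) → ∀ out,
      Exec x B (E l) ⟨S, pos, out⟩ ⟨S, pos, out ++ if y ∈ l then [code y] else []⟩ := by
    intro i y hy l hl S hS0 hS2 hS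
    have hi : i < (F x).length := by
      by_contra hi
      rw [List.getElem?_eq_none (by omega)] at hy
      simp at hy
    induction l with
    | nil =>
      intro out
      change Exec x B .skip _ _
      simpa using Exec.skip _
    | cons b l ih =>
      intro out
      rw [List.nodup_cons] at hl
      have h2 : RExec B (P2 b) S (update S 3 (if y = b then 1 else 0)) := by
        refine ((hP2 b S k1 ?_ (hS 3 le_rfl) (fun j hj => hS j (by omega))).mono
          (Nat.pow_le_pow_right (by norm_num) (by have := hr b k1; omega))).congr ?_
        · rintro (_ | _)
          · simp only [hS2]
            exact (by omega : i < k1).trans Nat.lt_two_pow_self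
          · simp only [hS0]
            exact (strCode_lt x).trans_le (Nat.pow_le_pow_right (by norm_num) (by omega))
        · simp [hS2, hS0, codeStr_strCode, hy]
      by_cases hyb : y = b
      · subst hyb
        have h3 : Exec x B (.loop 3 (.seq (.dec 3) (.emit (code y)))) ⟨update S 3 1, pos, out⟩
            ⟨S, pos, out ++ [code y]⟩ := by
          have e1 : update (update S 3 1) 3 (update S 3 1 3 - 1) = S := by
            rw [update_idem, update_self, show 1 - 1 = S 3 from (hS 3 le_rfl).symm,
              update_eq_self]
          have h4 := RExec.dec (B := B) (s := update S 3 1) 3 (by simp) x pos out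
          rw [e1] at h4
          exact .loop_succ (by simp) (.seq h4 (.emit _ _)) (.loop_zero (hS 3 le_rfl))
        have h5 := ih hl.2 (out ++ [code y])
        rw [if_neg hl.1, List.append_nil] at h5
        rw [if_pos rfl] at h2
        rw [if_pos List.mem_cons_self]
        exact .seq (.seq (h2 _ _ _) h3) h5
      · rw [if_neg hyb, ← hS 3 le_rfl, update_eq_self] at h2
        have h5 := ih hl.2 out
        simp only [List.mem_cons, hyb, false_or]
        exact .seq (.seq (h2 _ _ _) (.loop_zero (hS 3 le_rfl))) h5
  have hloop : ∀ k i, i + k = (F x).length → ∀ out, out = ((F x).take i).map code →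
      Exec x B (.loop 1 (.seq (.dec 1) (.seq (E Finset.univ.toList) (.inc 2)))) ⟨R i, pos, out⟩
        ⟨R (F x).length, pos, (F x).map code⟩ := by
    intro k
    induction k with
    | zero =>
      rintro i hi out rfl
      obtain rfl : i = (F x).length := by omega
      rw [List.take_length]
      exact .loop_zero (by simp [R])
    | succ k ih =>
      rintro i hi out rfl
      have hi' : i < (F x).length := by omega
      have hy : (F x)[i]? = some (F x)[i] := List.getElem?_eq_getElem hi'
      let S := update (R i) 1 (R i 1 - 1)
      have h2 : RExec B (.dec 1) (R i) S := RExec.dec 1 (by simp [R]; omega)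
      have h3 := hE i _ hy Finset.univ.toList (Finset.nodup_toList _) S (by simp [S, R])
        (by simp [S, R]) (fun j hj => by
          simp [S, R, show j ≠ 0 by omega, show j ≠ 1 by omega, show j ≠ 2 by omega])
        (((F x).take i).map code)
      rw [if_pos (by simp)] at h3
      have h4 : RExec B (.inc 2) S (R (i + 1)) := by
        refine (RExec.inc 2 ?_).congr ?_
        · simp [S, R]
          exact hk1B i (by omega)
        · funext z
          rcases z with _ | _ | _ | z <;> simp [S, R]
          omega
      have h5 := ih (i + 1) (by omega) (((F x).take i).map code ++ [code (F x)[i]])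
        (by
          rw [List.take_add_one, hy]
          simp only [List.map_append, Option.toList_some, List.map_cons, List.map_nil])
      exact .loop_succ (by simp [R]; omega) (.seq (h2 _ _ _) (.seq h3 (h4 _ _ _))) h5
  refine ⟨_, .seq hread (.seq (h1 _ _ _) (hloop (F x).length 0 (zero_add _) [] (by simp))), ?_⟩
  simp only [List.map_map]
  rw [invFun_comp hcode, List.map_id]

/-! ### Polynomial time -/

theorem Machine.head_run_le {α β : Type} (M : Machine α β) (x : List α) (t : ℕ) (i : Fin M.tapes) :
    (M.run x t).head i ≤ t := by
  induction t with
  | zero => simp [run, initial]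
  | succ t ih =>
    rw [run_succ, step]
    split
    · omega
    · rename_i q mv act o _
      have : ∀ (m : Move) n, m.apply n ≤ n + 1 := by
        intro m n
        cases m <;> simp only [Move.apply] <;> omega
      exact (this _ _).trans (by omega)

theorem Machine.length_output_run_le {α β : Type} (M : Machine α β) (x : List α) (t : ℕ) :
    (M.run x t).output.length ≤ t := by
  induction t with
  | zero => simp [run, initial]
  | succ t ih =>
    rw [run_succ, step]
    split
    · omega
    · rename_i q mv act o _
      have : o.toList.length ≤ 1 := by cases o <;> simp
      simp only [List.length_append]
      omega

/-- A step moves each head by at most one cell and writes at most one symbol, and nothing changes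
after halting. -/
theorem PTime.fpspace {α β : Type} {F : List α → List β} (h : PTime F) : FPSpace F := by
  obtain ⟨M, p, hM⟩ := h
  refine ⟨⟨M, p + 1, fun x => ⟨⟨_, hM x⟩, fun t i => ?_⟩⟩, p, fun x => ?_⟩
  · rw [Polynomial.eval_add, Polynomial.eval_one]
    refine Nat.lt_succ_of_le ?_
    rcases le_total t (p.eval x.length) with ht | ht
    · exact (M.head_run_le x t i).trans ht
    · rw [M.run_of_halted (hM x).1 ht]
      exact M.head_run_le x _ i
  · rw [← (hM x).2]
    exact M.length_output_run_le x _

/-! ### A polynomial time machine with `(n + 2) ^ k - 1` output symbols. -/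

/-- The states of the odometer. -/
inductive OdoState (k : ℕ) where
  | start
  | fill
  | run (d : Fin k → Bool)

instance (k : ℕ) : Finite (OdoState k) :=
  Finite.of_surjective (fun o : Bool ⊕ (Fin k → Bool) => match o with
    | .inl true => OdoState.start
    | .inl false => .fill
    | .inr d => .run d)
    (by
      rintro (_ | _ | d)
      exacts [⟨.inl true, rfl⟩, ⟨.inl false, rfl⟩, ⟨.inr d, rfl⟩])

open Classical in
/-- The transitions of an odometer whose heads move back and forth between two end marks, like a
reflected Gray code, with one output symbol for each move. The cell contents `some false` and
`some true` are the left and the right end mark. -/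
noncomputable def odoδ (k : ℕ) (q : OdoState k) (r : Option Unit) (c : Fin k → Option Bool) :
    Option (OdoState k × Move × (Fin k → Option Bool × Move) × Option Unit) :=
  match q with
  | .start => some (.fill, .right, fun _ => (some false, .right), none)
  | .fill => if r = none then some (.run fun _ => false, .stay, fun _ => (some true, .stay), none)
      else some (.fill, .right, fun _ => (none, .right), none)
  | .run d =>
      if h : ∃ i, c i ≠ some (d i) ∧ ∀ j < i, c j = some (d j) then
        some (.run fun j => if j < h.choose then !d j else d j, .stay,
          fun j => (c j, if j = h.choose then (if d j then .right else .left) else .stay),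
          some ())
      else none

/-- The machine with these transitions. -/
noncomputable def odometer (k : ℕ) : Machine Unit Unit where
  State := OdoState k
  finite_state := inferInstance
  Sym := Option Bool
  finite_sym := inferInstance
  blank := none
  tapes := k
  start := .start
  δ := odoδ k

/-- A tape with end marks in the cells `0` and `n + 1`. -/
def odoTape (n : ℕ) : ℕ → Option Bool :=
  fun z => if z = 0 then some false else if z = n + 1 then some true else none

/-- The distance of a head from the end mark it moves to. -/
def odoDist (n : ℕ) {k : ℕ} (h : Fin k → ℕ) (d : Fin k → Bool) (j : ℕ) : ℕ :=
  if hj : j < k then (if d ⟨j, hj⟩ then n + 1 - h ⟨j, hj⟩ else h ⟨j, hj⟩) else 0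

/-- Subtracting one with a borrow: `i` is the lowest nonzero digit, and the zeros below it become `b
- 1`. -/
theorem arr_decrement {b k i : ℕ} (hi : i < k) {r r' : ℕ → ℕ} (h1 : ∀ j < i, r j = 0)
    (h2 : ∀ j < i, r' j + 1 = b) (h3 : r i = r' i + 1) (h4 : ∀ j, i < j → r j = r' j) :
    arr b k r = arr b k r' + 1 := by
  induction i generalizing k r r' with
  | zero =>
    obtain ⟨k, rfl⟩ := Nat.exists_eq_succ_of_ne_zero hi.ne'
    have : (fun j => r (j + 1)) = fun j => r' (j + 1) := funext fun j => h4 _ (by omega)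
    rw [arr_succ, arr_succ, h3, this]
    ring
  | succ i ih =>
    obtain ⟨k, rfl⟩ := Nat.exists_eq_succ_of_ne_zero (Nat.ne_zero_of_lt hi)
    have := ih (k := k) (r := fun j => r (j + 1)) (r' := fun j => r' (j + 1)) (by omega)
      (fun j hj => h1 _ (by omega)) (fun j hj => h2 _ (by omega)) h3 (fun j hj => h4 _ (by omega))
    rw [arr_succ, arr_succ, this, h1 0 (by omega)]
    have := h2 0 (by omega)
    rw [mul_add]
    omega

/-- Configurations of the odometer. -/
def odoMk {k : ℕ} (q : OdoState k) (p : ℕ) (h : Fin k → ℕ) (t : Fin k → ℕ → Option Bool)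
    (out : List Unit) : Config (odometer k) :=
  ⟨q, p, h, t, out⟩

/-- The configurations of a running odometer. -/
def odoConfig {k : ℕ} (n : ℕ) (d : Fin k → Bool) (h : Fin k → ℕ) (out : List Unit) :
    Config (odometer k) :=
  odoMk (.run d) (n + 1) h (fun _ => odoTape n) out

theorem odoTape_eq_iff {n k : ℕ} {h : Fin k → ℕ} (d : Fin k → Bool) (hh : ∀ i, h i ≤ n + 1)
    (i : Fin k) : odoTape n (h i) = some (d i) ↔ odoDist n h d i = 0 := by
  have h1 := hh i
  simp only [odoDist, i.2, dif_pos, Fin.eta, odoTape]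
  by_cases h2 : h i = 0
  · cases d i <;> simp [h2]
  · by_cases h3 : h i = n + 1
    · cases d i <;> simp [h3]
    · cases d i <;> simp [h2, h3]
      omega

/-- The distances of the heads from their goals are the digits of a number in base `n + 2`. Each
output symbol accompanies a decrement of this number, and the machine halts at zero. -/
theorem odometer_run (k : ℕ) (x : List Unit) (R : ℕ) : ∀ (d : Fin k → Bool) (h : Fin k → ℕ)
    (out : List Unit), (∀ i, h i ≤ x.length + 1) →
    arr (x.length + 2) k (odoDist x.length h d) = R →
    (odometer k).Halted x (((odometer k).step x)^[R] (odoConfig x.length d h out)) ∧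
      (((odometer k).step x)^[R] (odoConfig x.length d h out)).output =
        out ++ List.replicate R () := by
  set n := x.length with hn
  have hnext : ∀ (d : Fin k → Bool) (h : Fin k → ℕ) (out : List Unit),
      (odometer k).next x (odoConfig n d h out) =
        odoδ k (.run d) (readInput x (n + 1)) fun i => odoTape n (h i) := fun _ _ _ => rfl
  induction R with
  | zero =>
    intro d h out hh hR
    refine ⟨?_, by simp [odoConfig, odoMk]⟩
    rw [iterate_zero, id_eq, Machine.Halted, hnext, odoδ]
    refine dif_neg ?_
    rintro ⟨i, hi, _⟩
    rw [ne_eq, odoTape_eq_iff d hh] at hi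
    have h1 : odoDist n h d i * (n + 2) ^ (i : ℕ) = 0 :=
      Finset.sum_eq_zero_iff.1 hR i (Finset.mem_range.2 i.2)
    rcases Nat.mul_eq_zero.1 h1 with h | h
    · exact hi h
    · simp at h
  | succ R ih =>
    intro d h out hh hR
    have hex : ∃ i : Fin k, odoTape n (h i) ≠ some (d i) ∧
        ∀ j < i, odoTape n (h j) = some (d j) := by
      have h1 : ∃ m, ∃ _ : m < k, odoDist n h d m ≠ 0 := by
        by_contra! h1
        have : arr (n + 2) k (odoDist n h d) = 0 :=
          Finset.sum_eq_zero fun j hj => by rw [h1 j (Finset.mem_range.1 hj), zero_mul]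
        omega
      classical
      obtain ⟨hm, h2⟩ := Nat.find_spec h1
      refine ⟨⟨Nat.find h1, hm⟩, ?_, fun j hj => ?_⟩
      · rw [ne_eq, odoTape_eq_iff d hh]
        exact h2
      · rw [odoTape_eq_iff d hh]
        by_contra h3
        exact Nat.find_min h1 hj ⟨j.2, h3⟩
    obtain ⟨i, hi⟩ : ∃ i, i = hex.choose := ⟨_, rfl⟩
    have hspec := hex.choose_spec
    rw [← hi] at hspec
    obtain ⟨hi1, hi2⟩ := hspec
    rw [ne_eq, odoTape_eq_iff d hh] at hi1
    -- The heads before `i` have reached their marks and turn round, which resets their distances to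
    -- `n + 1` without a movement; head `i` moves one cell closer to its mark.
    let d' : Fin k → Bool := fun j => if j < i then !d j else d j
    let mv : Fin k → Move := fun j => if j = i then (if d j then .right else .left) else .stay
    let h' : Fin k → ℕ := fun j => (mv j).apply (h j)
    have hstep : (odometer k).step x (odoConfig n d h out) = odoConfig n d' h' (out ++ [()]) := by
      have h1 : (odometer k).next x (odoConfig n d h out) =
          some (.run d', .stay, fun j => (odoTape n (h j), mv j), some ()) := by
        rw [hnext, odoδ, dif_pos hex]
        simp only [← hi]
        rfl
      rw [Machine.step, h1]
      have h2 : (fun j => update (odoTape n) (h j) (odoTape n (h j))) = fun _ => odoTape n :=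
        funext fun j => update_eq_self _ _
      change odoMk (.run d') (min (n + 1) (x.length + 1)) h'
        (fun j => update (odoTape n) (h j) (odoTape n (h j))) (out ++ [()]) = _
      rw [h2, ← hn, min_self]
      rfl
    rw [iterate_succ_apply, hstep]
    have hh' : ∀ j, h' j ≤ n + 1 ∧ odoDist n h' d' j =
        if j < i then n + 1 else if j = i then odoDist n h d j - 1 else odoDist n h d j := by
      intro j
      have h1 := hh j
      rcases lt_trichotomy j i with hj | rfl | hj
      · have h2 := (odoTape_eq_iff d hh j).1 (hi2 j hj)
        simp only [odoDist, j.2, dif_pos, Fin.eta, h', d', mv, hj, hj.ne, if_true, if_false,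
          Move.apply] at h2 ⊢
        cases hd : d j <;> simp [hd] at h2 ⊢ <;> omega
      · simp only [odoDist, j.2, dif_pos, Fin.eta, h', d', mv, lt_irrefl, if_true, if_false] at hi1 ⊢
        cases hd : d j <;> simp [hd, Move.apply] at hi1 ⊢ <;> omega
      · simp only [odoDist, j.2, dif_pos, Fin.eta, h', d', mv, hj.not_gt, hj.ne', if_false,
          Move.apply]
        exact ⟨h1, trivial⟩
    have hsum : arr (n + 2) k (odoDist n h d) = arr (n + 2) k (odoDist n h' d') + 1 := by
      refine arr_decrement i.2 (fun j hj => ?_) (fun j hj => ?_) ?_ (fun j hj => ?_)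
      · exact (odoTape_eq_iff d hh ⟨j, hj.trans i.2⟩).1 (hi2 ⟨j, hj.trans i.2⟩ hj)
      · have := (hh' ⟨j, hj.trans i.2⟩).2
        rw [if_pos (show (⟨j, hj.trans i.2⟩ : Fin k) < i from hj)] at this
        simp only at this
        omega
      · have := (hh' i).2
        rw [if_neg (lt_irrefl _), if_pos rfl] at this
        omega
      · by_cases hjk : j < k
        · have := (hh' ⟨j, hjk⟩).2
          rw [if_neg (show ¬ (⟨j, hjk⟩ : Fin k) < i from fun h => absurd (show j < i from h) (by omega)),
            if_neg (fun h => absurd (congrArg Fin.val h) (show j ≠ i by omega))] at this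
          exact this.symm
        · simp [odoDist, hjk]
    have := ih d' h' (out ++ [()]) (fun j => (hh' j).1) (by omega)
    refine ⟨this.1, ?_⟩
    rw [this.2]
    simp [List.replicate_succ]

/-- The configurations in the first phase. -/
def fillConfig (k m : ℕ) : Config (odometer k) :=
  odoMk .fill (m + 1) (fun _ => m + 1) (fun _ z => if z = 0 then some false else none) []

theorem odometer_fill (k : ℕ) (x : List Unit) : ∀ m ≤ x.length,
    (odometer k).run x (m + 1) = fillConfig k m := by
  intro m
  induction m with
  | zero =>
    intro _
    have h : (odometer k).next x (odometer k).initial =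
      some (.fill, .right, fun _ => (some false, .right), none) := rfl
    rw [Machine.run_succ, Machine.run, iterate_zero, id_eq, Machine.step, h]
    change odoMk .fill (min 1 (x.length + 1)) (fun _ => 1)
      (fun _ => update (fun _ => none) 0 (some false)) [] = fillConfig k 0
    rw [min_eq_left (by omega), fillConfig]
    congr 1
    funext _ z
    rw [update_apply]
  | succ m ih =>
    intro hm
    have h : (odometer k).next x (fillConfig k m) =
        some (.fill, .right, fun _ => (none, .right), none) := by
      change odoδ k .fill (readInput x (m + 1))
        (fun _ => (if m + 1 = 0 then some false else none : Option Bool)) = _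
      refine if_neg (show ¬ x[m]? = none from ?_)
      rw [List.getElem?_eq_none_iff]
      omega
    rw [Machine.run_succ, ih (by omega), Machine.step, h]
    change odoMk .fill (min (m + 1 + 1) (x.length + 1)) (fun _ => m + 1 + 1)
      (fun _ => update (fun z => if z = 0 then some false else none) (m + 1) none)
      [] = fillConfig k (m + 1)
    rw [min_eq_left (by omega), fillConfig]
    congr 1
    funext _ z
    rw [update_apply]
    split_ifs with h1 h2
    · omega
    · rfl
    · rfl
    · rfl

theorem arr_const (b k : ℕ) : arr (b + 1) k (fun _ => b) + 1 = (b + 1) ^ k := by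
  induction k with
  | zero => simp [arr]
  | succ k ih =>
    rw [arr_succ, pow_succ', ← ih]
    ring

/-- Polynomials are dominated by polynomial time functions. -/
theorem ptime_pow (k : ℕ) : PTime fun x : List Unit => ones ((x.length + 2) ^ k - 1) := by
  refine ⟨odometer k, (.X + 2) ^ k + .X + 2, fun x => ?_⟩
  set n := x.length with hn
  let c : Config (odometer k) := odoConfig n (fun _ => false) (fun _ => n + 1) []
  -- One starting step, `n` steps along the input, and one step that writes the right marks.
  have h1 : (odometer k).run x (n + 2) = c := by
    have h : (odometer k).next x (fillConfig k n) =
        some (.run fun _ => false, .stay, fun _ => (some true, .stay), none) := by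
      change odoδ k .fill (readInput x (n + 1))
        (fun _ => (if n + 1 = 0 then some false else none : Option Bool)) = _
      exact if_pos (show x[n]? = none from List.getElem?_eq_none_iff.2 le_rfl)
    rw [Machine.run_succ, odometer_fill k x n le_rfl, Machine.step, h]
    change odoMk (.run fun _ => false) (min (n + 1) (x.length + 1)) (fun _ => n + 1)
      (fun _ => update (fun z => if z = 0 then some false else none) (n + 1) (some true))
      [] = odoConfig n (fun _ => false) (fun _ => n + 1) []
    rw [min_eq_left le_rfl, odoConfig]
    congr 1
    funext _ z
    rw [update_apply, odoTape]
    split_ifs with h1 h2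
    · omega
    · rfl
    · rfl
    · rfl
  -- All heads stand at the right marks and move left, so all digits have the maximal value `n + 1`.
  have hR : arr (n + 2) k (odoDist n (k := k) (fun _ => n + 1) fun _ => false) =
      (n + 2) ^ k - 1 := by
    have h2 : arr (n + 1 + 1) k (fun _ => n + 1) + 1 = (n + 2) ^ k := arr_const (n + 1) k
    have h3 : arr (n + 2) k (odoDist n (k := k) (fun _ => n + 1) fun _ => false) =
        arr (n + 1 + 1) k fun _ => n + 1 :=
      Finset.sum_congr rfl fun j hj => by
        simp [odoDist, Finset.mem_range.1 hj]
    omega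
  obtain ⟨h2, h3⟩ := odometer_run k x _ (fun _ => false) _ [] (fun i => le_rfl) hR
  have h4 : (odometer k).run x ((n + 2) ^ k - 1 + (n + 2)) =
      ((odometer k).step x)^[(n + 2) ^ k - 1] c := by
    rw [← h1, Machine.run, iterate_add_apply]
    rfl
  rw [← h4] at h2 h3
  have hT : (n + 2) ^ k - 1 + (n + 2) ≤ ((.X + 2) ^ k + .X + 2 : Polynomial ℕ).eval n := by
    simp
    omega
  rw [Machine.OutputsWithin, (odometer k).run_of_halted h2 hT]
  exact ⟨h2, by rw [h3, List.nil_append]; rfl⟩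

/-- The base `n + 2` is at least two, so coefficients are absorbed by `c ≤ 2 ^ c ≤ (n + 2) ^ c`. -/
theorem exists_pow_bound (p : Polynomial ℕ) : ∃ k, ∀ n, p.eval n ≤ (n + 2) ^ k := by
  induction p using Polynomial.induction_on' with
  | add p q hp hq =>
    obtain ⟨a, ha⟩ := hp
    obtain ⟨b, hb⟩ := hq
    refine ⟨a + b + 1, fun n => ?_⟩
    have h1 : (n + 2) ^ a ≤ (n + 2) ^ (a + b) := Nat.pow_le_pow_right (by omega) (by omega)
    have h2 : (n + 2) ^ b ≤ (n + 2) ^ (a + b) := Nat.pow_le_pow_right (by omega) (by omega)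
    have h3 := ha n
    have h4 := hb n
    rw [Polynomial.eval_add, pow_succ]
    nlinarith [Nat.zero_le (n * (n + 2) ^ (a + b))]
  | monomial m c =>
    refine ⟨m + c, fun n => ?_⟩
    rw [Polynomial.eval_monomial, pow_add, mul_comm]
    refine Nat.mul_le_mul (Nat.pow_le_pow_left (by omega) m) ?_
    exact Nat.lt_two_pow_self.le.trans (Nat.pow_le_pow_left (by omega) c)

/-- A strictly increasing polynomial time bound above a polynomial. -/
theorem exists_ptime_bound (p : Polynomial ℕ) : ∃ g : List Unit → List Unit, PTime g ∧
    StrictMono (lengthAt g) ∧ ∀ n, p.eval n ≤ lengthAt g n := by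
  obtain ⟨k, hk⟩ := exists_pow_bound p
  have hlen : ∀ n, lengthAt (fun x : List Unit => ones ((x.length + 2) ^ (k + 1) - 1)) n =
      (n + 2) ^ (k + 1) - 1 := by
    intro n
    simp [lengthAt, ones]
  -- The exponent `k + 1` compensates for the subtracted one and is positive, as strict monotonicity
  -- requires.
  refine ⟨_, ptime_pow (k + 1), ?_, fun n => ?_⟩
  · intro a b hab
    rw [hlen, hlen]
    have h1 : (a + 2) ^ (k + 1) < (b + 2) ^ (k + 1) := Nat.pow_lt_pow_left (by omega) (by omega)
    have h2 : 0 < (a + 2) ^ (k + 1) := by positivity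
    omega
  · rw [hlen]
    have h1 := hk n
    have h2 : 0 < (n + 2) ^ k := by positivity
    rw [pow_succ]
    have : (n + 2) ^ k * (n + 2) = (n + 2) ^ k * (n + 1) + (n + 2) ^ k := by ring
    have : (n + 2) ^ k ≤ (n + 2) ^ k * (n + 1) := Nat.le_mul_of_pos_right _ (by omega)
    omega

theorem lengthAt_le_poly {f : List Unit → List Unit} (hf : PTime f) :
    ∃ p : Polynomial ℕ, ∀ n, lengthAt f n ≤ p.eval n := by
  obtain ⟨_, q, hq⟩ := hf.fpspace
  exact ⟨q, fun n => by simpa [lengthAt, ones] using hq (ones n)⟩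

open MeasureTheory

/-! ### The uniform measure -/

instance : IsProbabilityMeasure uniformMeasure := by
  unfold uniformMeasure
  infer_instance

@[simp] theorem length_initSeg (X : ℕ → Bool) (m : ℕ) : (initSeg X m).length = m := by
  simp [initSeg]

theorem getElem?_initSeg (X : ℕ → Bool) (m i : ℕ) :
    (initSeg X m)[i]? = if i < m then some (X i) else none := by
  rw [initSeg, List.getElem?_ofFn]
  split_ifs <;> rfl

theorem take_initSeg (X : ℕ → Bool) {i m : ℕ} (h : i ≤ m) :
    (initSeg X m).take i = initSeg X i := by
  apply List.ext_getElem?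
  intro j
  simp only [List.getElem?_take, getElem?_initSeg]
  split_ifs <;> first | rfl | omega

theorem initSeg_succ (X : ℕ → Bool) (m : ℕ) : initSeg X (m + 1) = initSeg X m ++ [X m] := by
  rw [initSeg, List.ofFn_succ_last]
  rfl

theorem mem_cylinder_iff {X : ℕ → Bool} {σ : List Bool} :
    X ∈ cylinder σ ↔ ∀ i (h : i < σ.length), X i = σ[i] := by
  rw [cylinder, Set.mem_ofPred_eq]
  constructor
  · intro h i hi
    have := getElem?_initSeg X σ.length i
    rw [h, if_pos hi, List.getElem?_eq_getElem hi, Option.some_inj] at this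
    exact this.symm
  · intro h
    apply List.ext_getElem (by simp)
    intro i h1 h2
    simp [initSeg, h i h2]

theorem cylinder_eq_pi (σ : List Bool) : cylinder σ =
    Set.pi (Finset.range σ.length) fun i => {σ.getD i false} := by
  ext X
  rw [mem_cylinder_iff]
  simp only [Set.mem_pi, Finset.coe_range, Set.mem_Iio, Set.mem_singleton_iff]
  refine forall_congr' fun i => forall_congr' fun h => ?_
  rw [List.getD_eq_getElem _ _ h]

theorem measurableSet_cylinder (σ : List Bool) : MeasurableSet (cylinder σ) := by
  rw [cylinder_eq_pi]
  exact MeasurableSet.pi (Finset.countable_toSet _) fun _ _ => measurableSet_singleton _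

theorem measure_cylinder (σ : List Bool) : uniformMeasure.real (cylinder σ) = (1 / 2) ^ σ.length := by
  rw [cylinder_eq_pi, measureReal_def, uniformMeasure, Measure.infinitePi_pi _
    fun _ _ => measurableSet_singleton _]
  simp

theorem measure_split (A : Set (ℕ → Bool)) (σ : List Bool) :
    uniformMeasure.real (A ∩ cylinder σ) = uniformMeasure.real (A ∩ cylinder (σ ++ [false])) +
      uniformMeasure.real (A ∩ cylinder (σ ++ [true])) := by
  have h1 : A ∩ cylinder (σ ++ [true]) = (A ∩ cylinder σ) \ cylinder (σ ++ [false]) := by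
    ext X
    simp only [cylinder, Set.mem_ofPred_eq, Set.mem_inter_iff, Set.mem_sdiff, List.length_append,
      List.length_singleton, initSeg_succ, List.append_singleton_inj]
    cases X σ.length <;> simp
  have h2 : A ∩ cylinder (σ ++ [false]) = (A ∩ cylinder σ) ∩ cylinder (σ ++ [false]) := by
    ext X
    simp only [cylinder, Set.mem_ofPred_eq, Set.mem_inter_iff, List.length_append,
      List.length_singleton, initSeg_succ, List.append_singleton_inj]
    tauto
  rw [h1, h2]
  exact (measureReal_inter_add_sdiff (measurableSet_cylinder _)).symm

theorem cylinder_nil : cylinder [] = Set.univ := by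
  ext X
  simp [mem_cylinder_iff]

theorem mem_cylinder_initSeg (X : ℕ → Bool) (m : ℕ) : X ∈ cylinder (initSeg X m) := by
  simp [cylinder]

theorem eq_take_of_mem {X : ℕ → Bool} {σ τ : List Bool} (hσ : X ∈ cylinder σ) (hτ : X ∈ cylinder τ)
    (h : τ.length ≤ σ.length) : τ = σ.take τ.length := by
  rw [cylinder, Set.mem_ofPred_eq] at hσ hτ
  rw [← hσ, take_initSeg X h, hτ]

/-- Splits off the most significant digit, so that the two halves of `range (2 ^ (j + 1))`
correspond to the two one-bit extensions in `extCount_succ`. -/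
theorem bitString_cons (b : Bool) {j r : ℕ} (hr : r < 2 ^ j) :
    bitString (j + 1) (b.toNat * 2 ^ j + r) = b :: bitString j r := by
  apply List.ext_getElem?
  intro i
  rcases i with _ | i
  · rw [getElem?_bitString, if_pos (by omega), List.getElem?_cons_zero, mul_comm,
      Nat.testBit_two_pow_mul_add _ hr]
    cases b <;> simp
  · rw [List.getElem?_cons_succ, getElem?_bitString, getElem?_bitString]
    by_cases h : i < j
    · rw [if_pos (by omega), if_pos h, mul_comm, Nat.testBit_two_pow_mul_add _ hr,
        if_pos (by omega)]
      congr 2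
      omega
    · rw [if_neg (by omega), if_neg h]

/-! ### Measure by counting, and Ville's inequality. -/

open Classical in
/-- The number of extensions of `σ` by `j` bits with property `p`. -/
noncomputable def extCount (p : List Bool → Prop) (σ : List Bool) (j : ℕ) : ℕ :=
  ∑ r ∈ Finset.range (2 ^ j), if p (σ ++ bitString j r) then 1 else 0

theorem extCount_succ (p : List Bool → Prop) (σ : List Bool) (j : ℕ) :
    extCount p σ (j + 1) = extCount p (σ ++ [false]) j + extCount p (σ ++ [true]) j := by
  classical
  rw [extCount, pow_succ, mul_two, Finset.sum_range_add]
  congr 1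
  · refine Finset.sum_congr rfl fun r hr => ?_
    have := bitString_cons false (Finset.mem_range.1 hr)
    simp only [Bool.toNat_false, zero_mul, zero_add] at this
    rw [this, List.append_assoc]
    rfl
  · refine Finset.sum_congr rfl fun r hr => ?_
    have := bitString_cons true (Finset.mem_range.1 hr)
    simp only [Bool.toNat_true, one_mul] at this
    rw [this, List.append_assoc]
    rfl

/-- Membership in `A` is decided by `σ.length + j` bits. Both sides are averages over the two
children of `σ`, down to `j = 0`, where `[σ]` lies inside `A` or outside it. -/
theorem measure_eq_extCount {A : Set (ℕ → Bool)} {p : List Bool → Prop} (j : ℕ) :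
    ∀ σ : List Bool, (∀ X, X ∈ A ↔ p (initSeg X (σ.length + j))) →
    uniformMeasure.real (A ∩ cylinder σ) * 2 ^ σ.length = extCount p σ j / 2 ^ j := by
  induction j with
  | zero =>
    intro σ h
    classical
    have h1 : extCount p σ 0 = if p σ then 1 else 0 := by
      simp [extCount, bitString]
    rw [h1]
    have h2 : ∀ X ∈ cylinder σ, X ∈ A ↔ p σ := by
      intro X hX
      rw [h X, add_zero, show initSeg X σ.length = σ from hX]
    split_ifs with hp
    · have : A ∩ cylinder σ = cylinder σ := by
        ext X
        simp only [Set.mem_inter_iff, and_iff_right_iff_imp]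
        intro hX
        exact (h2 X hX).2 hp
      rw [this, measure_cylinder, ← mul_pow]
      simp
    · have : A ∩ cylinder σ = ∅ := by
        ext X
        simp only [Set.mem_inter_iff, Set.mem_empty_iff_false, iff_false, not_and]
        intro hA hX
        exact hp ((h2 X hX).1 hA)
      simp [this]
  | succ j ih =>
    intro σ h
    have h1 := ih (σ ++ [false]) (fun X => by rw [h X]; simp; rw [show σ.length + (j + 1) = σ.length + 1 + j by omega])
    have h2 := ih (σ ++ [true]) (fun X => by rw [h X]; simp; rw [show σ.length + (j + 1) = σ.length + 1 + j by omega])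
    rw [measure_split, extCount_succ]
    simp only [List.length_append, List.length_singleton, pow_succ] at h1 h2 ⊢
    push_cast
    field_simp at h1 h2 ⊢
    nlinarith

/-- The measure of the sequences with a prefix on which a martingale is large. -/
theorem ville {d : List Bool → ℚ} (hd : IsMartingale d) {T : Set (List Bool)} {l : ℕ} {c : ℚ}
    (hc : 0 < c) (hT : ∀ τ ∈ T, τ.length ≤ l ∧ c ≤ d τ) (n : ℕ) : ∀ σ : List Bool,
    l ≤ σ.length + n → (∀ i < σ.length, σ.take i ∉ T) →
    uniformMeasure.real ((⋃ τ ∈ T, cylinder τ) ∩ cylinder σ) ≤ d σ / c * (1 / 2) ^ σ.length := by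
  have hc' : (0 : ℝ) < c := by exact_mod_cast hc
  -- On `T` the factor `d σ / c` is at least one, so the measure of `[σ]` is bound enough.
  have hcase : ∀ σ ∈ T, uniformMeasure.real ((⋃ τ ∈ T, cylinder τ) ∩ cylinder σ) ≤
      d σ / c * (1 / 2) ^ σ.length := by
    intro σ hσ
    have h1 : uniformMeasure.real ((⋃ τ ∈ T, cylinder τ) ∩ cylinder σ) ≤ (1 / 2) ^ σ.length := by
      rw [← measure_cylinder]
      exact measureReal_mono Set.inter_subset_right
    have h2 : (1 : ℝ) ≤ d σ / c := by
      rw [one_le_div hc']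
      exact_mod_cast (hT σ hσ).2
    refine h1.trans ?_
    exact le_mul_of_one_le_left (by positivity) h2
  -- `n` bounds the number of levels left down to `l`. At or beyond level `l`, a string without a
  -- prefix in `T` has a cylinder that misses the union; above it, the bounds for the two children
  -- add up by fairness.
  induction n with
  | zero =>
    intro σ hl hσ
    by_cases h : σ ∈ T
    · exact hcase σ h
    · have : (⋃ τ ∈ T, cylinder τ) ∩ cylinder σ = ∅ := by
        ext X
        simp only [Set.mem_inter_iff, Set.mem_iUnion, Set.mem_empty_iff_false, iff_false, not_and]
        rintro ⟨τ, hτ, hX⟩ hXσ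
        have h1 := (hT τ hτ).1
        have h2 := eq_take_of_mem hXσ hX (by omega)
        rcases Nat.lt_or_ge τ.length σ.length with h3 | h3
        · exact hσ _ h3 (h2 ▸ hτ)
        · rw [List.take_of_length_le h3] at h2
          exact h (h2 ▸ hτ)
      rw [this, measureReal_empty]
      have : (0 : ℝ) ≤ d σ := by exact_mod_cast hd.nonneg σ
      positivity
  | succ n ih =>
    intro σ hl hσ
    by_cases h : σ ∈ T
    · exact hcase σ h
    · have hb : ∀ b : Bool, ∀ i < (σ ++ [b]).length, (σ ++ [b]).take i ∉ T := by
        intro b i hi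
        simp only [List.length_append, List.length_singleton, Nat.lt_succ_iff] at hi
        rw [List.take_append_of_le_length (by omega)]
        rcases Nat.lt_or_ge i σ.length with h3 | h3
        · exact hσ i h3
        · rwa [List.take_of_length_le h3]
      have h1 := ih (σ ++ [false]) (by simp; omega) (hb false)
      have h2 := ih (σ ++ [true]) (by simp; omega) (hb true)
      rw [measure_split]
      have h3 : (d σ : ℝ) = (d (σ ++ [false]) + d (σ ++ [true])) / 2 := by
        exact_mod_cast congrArg (Rat.cast (K := ℝ)) (hd.fair σ)
      rw [h3]
      simp only [List.length_append, List.length_singleton, pow_succ] at h1 h2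
      refine (add_le_add h1 h2).trans (le_of_eq ?_)
      ring

theorem IsMartingale.append_le {d : List Bool → ℚ} (hd : IsMartingale d) (σ : List Bool) (b : Bool) :
    d (σ ++ [b]) ≤ 2 * d σ := by
  have h1 := hd.fair σ
  have h2 := hd.nonneg (σ ++ [false])
  have h3 := hd.nonneg (σ ++ [true])
  cases b <;> linarith

theorem IsMartingale.le_two_pow {d : List Bool → ℚ} (hd : IsMartingale d) (σ : List Bool) :
    d σ ≤ 2 ^ σ.length := by
  induction σ using List.reverseRecOn with
  | nil => simp [hd.empty]
  | append_singleton σ b ih =>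
    have := hd.append_le σ b
    rw [List.length_append, List.length_singleton, pow_succ]
    linarith

/-! ### From martingales to tests -/

open Classical in
/-- `σ` is the first place where `d` reaches `4 ^ n`. -/
noncomputable def crossing (d : List Bool → ℚ) (u : List Unit) (σ : List Bool) : Bool :=
  decide (4 ^ u.length ≤ d σ ∧ ∀ i < σ.length, d (σ.take i) < 4 ^ u.length)

theorem crossing_iff {d : List Bool → ℚ} {n : ℕ} {σ : List Bool} :
    crossing d (ones n) σ = true ↔ 4 ^ n ≤ d σ ∧ ∀ i < σ.length, d (σ.take i) < 4 ^ n := by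
  simp [crossing, ones]

theorem mem_testSet {G : List Unit → List Bool → Bool} {f : List Unit → List Unit} {n : ℕ}
    {X : ℕ → Bool} : X ∈ testSet G f n ↔
      ∃ i ≤ lengthAt f n, G (ones n) (initSeg X i) = true := by
  simp only [testSet, testStrings, Set.mem_iUnion, Set.mem_ofPred_eq, exists_prop]
  constructor
  · rintro ⟨τ, ⟨h1, h2⟩, h3⟩
    refine ⟨τ.length, h1, ?_⟩
    rwa [show initSeg X τ.length = τ from h3]
  · rintro ⟨i, h1, h2⟩
    exact ⟨initSeg X i, ⟨by simpa using h1, h2⟩, mem_cylinder_initSeg X i⟩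

theorem IsMartingale.weakTest {d : List Bool → ℚ} (hd : IsMartingale d) {f : List Unit → List Unit}
    (hG : FPSpacePredicate (crossing d)) (hf : PTime f) (hmono : StrictMono (lengthAt f)) :
    IsWeakPSpaceTest (crossing d) f := by
  have hville : ∀ n σ, (∀ i < σ.length, σ.take i ∉ testStrings (crossing d) f n) →
      uniformMeasure.real (testSet (crossing d) f n ∩ cylinder σ) ≤
        d σ / ((4 ^ n : ℚ) : ℝ) * (1 / 2) ^ σ.length := fun n σ hσ =>
    ville hd (by positivity) (fun τ hτ => ⟨hτ.1, (crossing_iff.1 hτ.2).1⟩) (lengthAt f n) σ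
      (by omega) hσ
  refine ⟨⟨hG, hf, hmono, fun n => ?_⟩, fun n σ hσ => ?_⟩
  · have h := hville n [] (by simp)
    rw [cylinder_nil, Set.inter_univ, hd.empty] at h
    have h2 : uniformMeasure.real (testSet (crossing d) f n) ≤ (1 / 2) ^ n := by
      refine h.trans ?_
      simp only [Rat.cast_one, Rat.cast_pow, Rat.cast_ofNat, List.length_nil, pow_zero, mul_one]
      rw [one_div_pow]
      exact one_div_le_one_div_of_le (by positivity) (pow_le_pow_left₀ (by norm_num) (by norm_num) n)
    rw [measureReal_def] at h2
    refine (ENNReal.toReal_le_toReal (measure_ne_top _ _) (by simp)).1 ?_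
    simpa using h2
  · obtain ⟨h1, h2⟩ := crossing_iff.1 hσ.2
    -- The proper prefixes of a first crossing of `4 ^ n` are below `4 ^ n`, so none of them belongs
    -- to component `n + 1`.
    have h := hville (n + 1) σ (fun i hi hmem => by
      have h3 := (crossing_iff.1 hmem.2).1
      have h4 := h2 i hi
      have h5 : (4 : ℚ) ^ n ≤ 4 ^ (n + 1) := pow_le_pow_right₀ (by norm_num) (by omega)
      linarith)
    -- The predecessor of `σ` is still below `4 ^ n`; the empty string has value one.
    have hle : d σ ≤ 2 * 4 ^ n := by
      rcases List.eq_nil_or_concat σ with rfl | ⟨σ', b, rfl⟩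
      · rw [hd.empty]
        have : (1 : ℚ) ≤ 4 ^ n := one_le_pow₀ (by norm_num)
        linarith
      · have h3 := h2 σ'.length (by simp)
        rw [List.concat_eq_append, List.take_left'] at h3
        · have h4 := hd.append_le σ' b
          rw [List.concat_eq_append]
          linarith
        · rfl
    have h3 : uniformMeasure.real (testSet (crossing d) f (n + 1) ∩ cylinder σ) ≤
        1 / 2 * uniformMeasure.real (cylinder σ) := by
      rw [measure_cylinder]
      refine h.trans (mul_le_mul_of_nonneg_right ?_ (by positivity))
      rw [div_le_iff₀ (by positivity)]
      have : (d σ : ℝ) ≤ 2 * 4 ^ n := by exact_mod_cast hle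
      refine this.trans (le_of_eq ?_)
      push_cast
      ring
    rw [measureReal_def, measureReal_def] at h3
    refine (ENNReal.toReal_le_toReal (measure_ne_top _ _)
      (ENNReal.mul_ne_top (by simp) (measure_ne_top _ _))).1 ?_
    rw [ENNReal.toReal_mul]
    simpa using h3

theorem mem_testSet_crossing {d : List Bool → ℚ} {f : List Unit → List Unit} {X : ℕ → Bool} {n m : ℕ}
    (hm : m ≤ lengthAt f n) (h : 4 ^ n ≤ d (initSeg X m)) : X ∈ testSet (crossing d) f n := by
  classical
  have hex : ∃ i, 4 ^ n ≤ d (initSeg X i) := ⟨m, h⟩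
  rw [mem_testSet]
  refine ⟨Nat.find hex, (Nat.find_min' hex h).trans hm, crossing_iff.2 ⟨Nat.find_spec hex, ?_⟩⟩
  intro i hi
  rw [length_initSeg] at hi
  rw [take_initSeg X hi.le]
  exact not_le.1 (Nat.find_min hex hi)

theorem exists_le_of_mem_testSet {d : List Bool → ℚ} {f : List Unit → List Unit} {X : ℕ → Bool}
    {n : ℕ} (h : X ∈ testSet (crossing d) f n) : ∃ m, 4 ^ n ≤ d (initSeg X m) := by
  obtain ⟨i, _, h2⟩ := mem_testSet.1 h
  exact ⟨i, (crossing_iff.1 h2).1⟩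

/-! ### From tests to martingales -/

/-- Every sequence that extends `ρ` is in the first `k + 1` components of the test, if `ρ` is long. -/
def MemUpTo (G : List Unit → List Bool → Bool) (f : List Unit → List Unit) (k : ℕ)
    (ρ : List Bool) : Prop :=
  ∀ j ≤ k, ∃ i ≤ lengthAt f j, G (ones j) (ρ.take i) = true

/-- The conditional measure of the first `k + 1` components of the test. -/
noncomputable def condMeasure (G : List Unit → List Bool → Bool) (f : List Unit → List Unit) (k : ℕ)
    (σ : List Bool) : ℚ :=
  extCount (MemUpTo G f k) σ (lengthAt f k) / 2 ^ lengthAt f k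

/-- The gain on the component `3 * (k + 1)` of the test. -/
noncomputable def gain (G : List Unit → List Bool → Bool) (f : List Unit → List Unit)
    (σ : List Bool) (k : ℕ) : ℚ :=
  2 ^ (k + 1) * (condMeasure G f (3 * (k + 1)) σ - condMeasure G f (3 * (k + 1)) (σ.take (k + 1)))

/-- The martingale that bets on the components of the test. -/
noncomputable def testMart (G : List Unit → List Bool → Bool) (f : List Unit → List Unit)
    (σ : List Bool) : ℚ :=
  1 + ∑ k ∈ Finset.range σ.length, gain G f σ k

/-! ### Fairness, success and boundedness of the martingale of a test. -/

section

variable {G : List Unit → List Bool → Bool} {f : List Unit → List Unit}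

theorem memUpTo_initSeg (h : IsPSpaceTest G f) {k N : ℕ} (hN : lengthAt f k ≤ N) (X : ℕ → Bool) :
    X ∈ (⋂ j ≤ k, testSet G f j) ↔ MemUpTo G f k (initSeg X N) := by
  simp only [Set.mem_iInter, mem_testSet, MemUpTo]
  refine forall_congr' fun j => forall_congr' fun hj => exists_congr fun i => ?_
  refine and_congr_right fun hi => ?_
  rw [take_initSeg X (hi.trans ((h.strictMono.monotone hj).trans hN))]

/-- Connects the count, which is computable, with the measure, from which the inequalities follow.
Extending by `lengthAt f k` bits always suffices, as membership depends on no more bits than that.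
-/
theorem condMeasure_eq (h : IsPSpaceTest G f) (k : ℕ) (σ : List Bool) :
    (condMeasure G f k σ : ℝ) =
      uniformMeasure.real ((⋂ j ≤ k, testSet G f j) ∩ cylinder σ) * 2 ^ σ.length := by
  rw [measure_eq_extCount (lengthAt f k) σ fun X => memUpTo_initSeg h (Nat.le_add_left _ _) X,
    condMeasure]
  push_cast
  rfl

theorem condMeasure_fair (h : IsPSpaceTest G f) (k : ℕ) (σ : List Bool) :
    condMeasure G f k σ =
      (condMeasure G f k (σ ++ [false]) + condMeasure G f k (σ ++ [true])) / 2 := by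
  have : (condMeasure G f k σ : ℝ) =
      (condMeasure G f k (σ ++ [false]) + condMeasure G f k (σ ++ [true])) / 2 := by
    simp only [condMeasure_eq h, List.length_append, List.length_singleton, pow_succ]
    rw [measure_split]
    ring
  exact_mod_cast this

theorem condMeasure_nonneg (k : ℕ) (σ : List Bool) : 0 ≤ condMeasure G f k σ := by
  unfold condMeasure
  positivity

theorem condMeasure_le_one (h : IsPSpaceTest G f) (k : ℕ) (σ : List Bool) :
    condMeasure G f k σ ≤ 1 := by
  have : (condMeasure G f k σ : ℝ) ≤ 1 := by
    rw [condMeasure_eq h]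
    have h1 := measureReal_mono (μ := uniformMeasure)
      (Set.inter_subset_right : (⋂ j ≤ k, testSet G f j) ∩ cylinder σ ⊆ cylinder σ)
    rw [measure_cylinder] at h1
    refine (mul_le_mul_of_nonneg_right h1 (by positivity)).trans (le_of_eq ?_)
    rw [← mul_pow]
    norm_num
  exact_mod_cast this

theorem condMeasure_le (h : IsPSpaceTest G f) (k : ℕ) (σ : List Bool) :
    condMeasure G f k σ ≤ (1 / 2) ^ k * 2 ^ σ.length := by
  have : (condMeasure G f k σ : ℝ) ≤ (1 / 2) ^ k * 2 ^ σ.length := by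
    rw [condMeasure_eq h]
    have h1 : uniformMeasure.real ((⋂ j ≤ k, testSet G f j) ∩ cylinder σ) ≤
        uniformMeasure.real (testSet G f k) :=
      measureReal_mono (Set.inter_subset_left.trans fun X hX => Set.mem_iInter₂.1 hX k le_rfl)
    have h2 : uniformMeasure.real (testSet G f k) ≤ (1 / 2) ^ k := by
      have := ENNReal.toReal_mono (by simp) (h.measure_le k)
      simpa [measureReal_def] using this
    exact mul_le_mul_of_nonneg_right (h1.trans h2) (by positivity)
  rw [← Rat.cast_le (K := ℝ)]
  push_cast
  exact this

/-- The price of the `k`-th purchase. Of the exponent `3 * (k + 1)`, one third pays for the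
multiplicity `2 ^ (k + 1)`, one for conditioning on `k + 1` bits, and one makes the prices summable.
-/
theorem condMeasure_take_le (h : IsPSpaceTest G f) (k : ℕ) (σ : List Bool) :
    2 ^ (k + 1) * condMeasure G f (3 * (k + 1)) (σ.take (k + 1)) ≤ (1 / 2) ^ (k + 1) := by
  have h1 := condMeasure_le h (3 * (k + 1)) (σ.take (k + 1))
  have h2 : (2 : ℚ) ^ (σ.take (k + 1)).length ≤ 2 ^ (k + 1) :=
    pow_le_pow_right₀ (by norm_num) (List.length_take_le _ _)
  calc 2 ^ (k + 1) * condMeasure G f (3 * (k + 1)) (σ.take (k + 1))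
      ≤ 2 ^ (k + 1) * ((1 / 2) ^ (3 * (k + 1)) * 2 ^ (k + 1)) := by
        refine mul_le_mul_of_nonneg_left (h1.trans ?_) (by positivity)
        exact mul_le_mul_of_nonneg_left h2 (by positivity)
    _ = (1 / 2) ^ (k + 1) := by
        rw [pow_mul, ← mul_pow, ← mul_pow]
        norm_num

theorem sum_half_pow_le (n : ℕ) : ∑ k ∈ Finset.range n, (1 / 2 : ℚ) ^ (k + 1) ≤ 1 := by
  have : ∑ k ∈ Finset.range n, (1 / 2 : ℚ) ^ (k + 1) = 1 - (1 / 2) ^ n := by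
    induction n with
    | zero => simp
    | succ n ih =>
      rw [Finset.sum_range_succ, ih]
      ring
  rw [this]
  have : (0 : ℚ) ≤ (1 / 2) ^ n := by positivity
  linarith

theorem neg_le_gain (h : IsPSpaceTest G f) (σ : List Bool) (k : ℕ) :
    0 ≤ gain G f σ k + (1 / 2) ^ (k + 1) := by
  have h1 := condMeasure_take_le h k σ
  have h2 : 0 ≤ 2 ^ (k + 1) * condMeasure G f (3 * (k + 1)) σ :=
    mul_nonneg (by positivity) (condMeasure_nonneg _ _)
  rw [gain, mul_sub]
  linarith

/-- From length `k + 1` on the price is frozen, and only the fair term varies. -/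
theorem gain_fair (h : IsPSpaceTest G f) {σ : List Bool} {k : ℕ} (hk : k < σ.length) :
    gain G f σ k = (gain G f (σ ++ [false]) k + gain G f (σ ++ [true]) k) / 2 := by
  simp only [gain]
  rw [condMeasure_fair h _ σ, List.take_append_of_le_length hk, List.take_append_of_le_length hk]
  ring

/-- A summand enters with value zero, so letting the number of summands grow with `σ` does not
disturb fairness. -/
theorem gain_self (σ : List Bool) (b : Bool) : gain G f (σ ++ [b]) σ.length = 0 := by
  rw [gain, List.take_of_length_le (by simp), sub_self, mul_zero]

theorem isMartingale_testMart (h : IsPSpaceTest G f) : IsMartingale (testMart G f) where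
  nonneg σ := by
    have h1 := Finset.sum_nonneg fun k (_ : k ∈ Finset.range σ.length) => neg_le_gain h σ k
    rw [Finset.sum_add_distrib] at h1
    have h2 := sum_half_pow_le σ.length
    rw [testMart]
    linarith
  empty := by simp [testMart]
  fair σ := by
    simp only [testMart, List.length_append, List.length_singleton, Finset.sum_range_succ,
      gain_self]
    rw [Finset.sum_congr rfl fun k hk => gain_fair h (Finset.mem_range.1 hk), ← Finset.sum_div,
      Finset.sum_add_distrib]
    ring

theorem condMeasure_initSeg (h : IsPSpaceTest G f) {X : ℕ → Bool} (hX : ∀ n, X ∈ testSet G f n)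
    {k M : ℕ} (hM : lengthAt f k ≤ M) : condMeasure G f k (initSeg X M) = 1 := by
  have h1 : (⋂ j ≤ k, testSet G f j) ∩ cylinder (initSeg X M) = cylinder (initSeg X M) := by
    rw [Set.inter_eq_right]
    intro Y hY
    rw [cylinder, Set.mem_ofPred_eq, length_initSeg] at hY
    rw [memUpTo_initSeg h hM, hY, ← memUpTo_initSeg h hM]
    exact Set.mem_iInter₂.2 fun j _ => hX j
  have h2 : (condMeasure G f k (initSeg X M) : ℝ) = 1 := by
    rw [condMeasure_eq h, h1, measure_cylinder, ← mul_pow]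
    norm_num
  exact_mod_cast h2

/-- Intersecting with the earlier components pays off here: missing a single `U_j` makes every later
component worthless after `lengthAt f j` bits. -/
theorem condMeasure_eq_zero (h : IsPSpaceTest G f) {X : ℕ → Bool} {j : ℕ} (hX : X ∉ testSet G f j)
    {k M : ℕ} (hk : j ≤ k) (hM : lengthAt f j ≤ M) : condMeasure G f k (initSeg X M) = 0 := by
  have h1 : (⋂ j ≤ k, testSet G f j) ∩ cylinder (initSeg X M) = ∅ := by
    rw [Set.eq_empty_iff_forall_notMem]
    rintro Y ⟨hY1, hY⟩
    rw [cylinder, Set.mem_ofPred_eq, length_initSeg] at hY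
    obtain ⟨i, hi, hG⟩ := mem_testSet.1 (Set.mem_iInter₂.1 hY1 j hk)
    refine hX (mem_testSet.2 ⟨i, hi, ?_⟩)
    rwa [← take_initSeg X (hi.trans hM), ← hY, take_initSeg Y (hi.trans hM)]
  have h2 : (condMeasure G f k (initSeg X M) : ℝ) = 0 := by
    rw [condMeasure_eq h, h1]
    simp
  exact_mod_cast h2

/-- The purchase `k` alone yields `2 ^ (k + 1)`; the prices of all purchases are covered by the
initial capital. -/
theorem two_pow_le_testMart (h : IsPSpaceTest G f) {X : ℕ → Bool} (hX : ∀ n, X ∈ testSet G f n)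
    {k M : ℕ} (hM : lengthAt f (3 * (k + 1)) ≤ M) : 2 ^ (k + 1) ≤ testMart G f (initSeg X M) := by
  -- Strict monotonicity gives `3 * (k + 1) ≤ lengthAt f (3 * (k + 1))`, so the summand `k` is
  -- already present.
  have hkM : k < M := by
    have := h.strictMono.le_apply (x := 3 * (k + 1))
    omega
  have h1 := Finset.single_le_sum
    (fun k (_ : k ∈ Finset.range M) => neg_le_gain h (initSeg X M) k) (Finset.mem_range.2 hkM)
  rw [Finset.sum_add_distrib] at h1
  have h2 := sum_half_pow_le M
  have h3 := condMeasure_take_le h k (initSeg X M)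
  have h4 : gain G f (initSeg X M) k = 2 ^ (k + 1) -
      2 ^ (k + 1) * condMeasure G f (3 * (k + 1)) ((initSeg X M).take (k + 1)) := by
    rw [gain, condMeasure_initSeg h hX hM, mul_sub, mul_one]
  rw [testMart, length_initSeg]
  linarith

/-- Up to length `lengthAt f j` the bound `2 ^ M` suffices. Beyond it the gains with `k ≥ j` are not
positive, and those with `k < j` are at most `2 ^ (k + 1)`. -/
theorem testMart_bounded (h : IsPSpaceTest G f) {X : ℕ → Bool} {j : ℕ} (hX : X ∉ testSet G f j) :
    ∃ C, ∀ M, testMart G f (initSeg X M) ≤ C := by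
  refine ⟨2 ^ lengthAt f j + (1 + ∑ k ∈ Finset.range j, 2 ^ (k + 1)), fun M => ?_⟩
  have h0 : (0 : ℚ) ≤ ∑ k ∈ Finset.range j, 2 ^ (k + 1) := by positivity
  rcases le_total M (lengthAt f j) with hM | hM
  · have h1 := (isMartingale_testMart h).le_two_pow (initSeg X M)
    have h2 : (2 : ℚ) ^ (initSeg X M).length ≤ 2 ^ lengthAt f j :=
      pow_le_pow_right₀ (by norm_num) (by simpa using hM)
    linarith
  · have h1 : ∀ k, gain G f (initSeg X M) k ≤ if k ∈ Finset.range j then 2 ^ (k + 1) else 0 := by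
      intro k
      have h2 : 0 ≤ 2 ^ (k + 1) * condMeasure G f (3 * (k + 1)) ((initSeg X M).take (k + 1)) :=
        mul_nonneg (by positivity) (condMeasure_nonneg _ _)
      rw [gain, mul_sub]
      split_ifs with hk
      · have h3 := mul_le_mul_of_nonneg_left (condMeasure_le_one h (3 * (k + 1)) (initSeg X M))
          (by positivity : (0 : ℚ) ≤ 2 ^ (k + 1))
        linarith
      · rw [Finset.mem_range] at hk
        rw [condMeasure_eq_zero h hX (by omega) hM]
        linarith
    have h2 : ∑ k ∈ Finset.range M, gain G f (initSeg X M) k ≤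
        ∑ k ∈ Finset.range j, (2 : ℚ) ^ (k + 1) := by
      refine (Finset.sum_le_sum fun k _ => h1 k).trans ?_
      rw [← Finset.sum_filter]
      refine Finset.sum_le_sum_of_subset_of_nonneg (fun k hk => (Finset.mem_filter.1 hk).2) ?_
      intros
      positivity
    have h3 : (0 : ℚ) ≤ 2 ^ lengthAt f j := by positivity
    rw [testMart, length_initSeg]
    linarith

end

/-! ### Computable operations on strings -/

section

variable {ι α γ : Type} [Finite ι] {X Y : (ι → ℕ) → List α} {n : (ι → ℕ) → ℕ}

theorem PSStr.map (hX : PSStr X) (φ : α → γ) : PSStr fun v => (X v).map φ where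
  len := by simpa using hX.len
  bdd := by simpa using hX.bdd
  sym := by simpa using hX.sym.map (Option.map φ)

theorem PSStr.replicate (hn : PS n) (hb : PolyBdd n) (a : α) :
    PSStr fun v => List.replicate (n v) a :=
  PSStr.of_getElem (by simpa using hn) (by simpa using hb) (s := fun _ _ => a) (FinPS.const a)
    (by simp)

theorem PSStr.append (hX : PSStr X) (hY : PSStr Y) : PSStr fun v => X v ++ Y v where
  len := by simpa using hX.len.add hY.len
  bdd := by simpa using hX.bdd.add hY.bdd
  sym := by
    simp only [List.getElem?_append]
    exact FinPS.ite (PSP.lt (PS.proj none) hX.len.lift) hX.sym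
      (hY.lift.sym_at ((PS.proj none).sub hX.len.lift))

theorem PSStr.cons (hX : PSStr X) (a : α) : PSStr fun v => a :: X v :=
  (PSStr.replicate (PS.const 1) (PolyBdd.const 1) a).append hX

theorem PSStr.take (hX : PSStr X) (hn : PS n) : PSStr fun v => (X v).take (n v) where
  len := by simpa using hn.min hX.len
  bdd := hX.bdd.mono fun v => by simp
  sym := by
    simp only [List.getElem?_take]
    exact FinPS.ite (PSP.lt (PS.proj none) hn.lift) hX.sym (FinPS.const none)

theorem PSStr.drop (hX : PSStr X) (hn : PS n) : PSStr fun v => (X v).drop (n v) where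
  len := by simpa using hX.len.sub hn
  bdd := hX.bdd.mono fun v => by simp
  sym := by
    simp only [List.getElem?_drop]
    exact hX.lift.sym_at (hn.lift.add (PS.proj none))

/-- The index is the number of positions up to and including which `p` fails throughout. -/
theorem PSStr.findIdx (hX : PSStr X) (p : α → Bool) : PS fun v => (X v).findIdx p := by
  have h1 : PSP fun w : Option ι → ℕ => ∀ j ≤ w none,
      (X fun i => w (some i))[j]?.map p = some false :=
    PSP.forall_le (PS.proj none) (P := fun j w => (X fun i => w (some i))[j]?.map p = some false)
      ((hX.lift.lift.sym_at (PS.proj none)).pred fun o => o.map p = some false)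
  convert PS.sum hX.len (F := fun i v => if ∀ j ≤ i, (X v)[j]?.map p = some false
    then 1 else 0) (PS.ite h1 (PS.const 1) (PS.const 0)) using 2 with v
  rw [Finset.sum_boole]
  have : Finset.filter (fun i => ∀ j ≤ i, (X v)[j]?.map p = some false)
      (Finset.range (X v).length) = Finset.range ((X v).findIdx p) := by
    ext i
    rw [Finset.mem_filter, Finset.mem_range, Finset.mem_range]
    constructor
    · rintro ⟨h2, h3⟩
      refine List.lt_findIdx_of_not h2 fun j hj => ?_
      have h4 := h3 j hj
      rw [List.getElem?_eq_getElem (hj.trans_lt h2)] at h4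
      simpa using h4
    · intro h2
      have h3 := h2.trans_le (List.findIdx_le_length (xs := X v) (p := p))
      refine ⟨h3, fun j hj => ?_⟩
      rw [List.getElem?_eq_getElem (hj.trans_lt h3)]
      simpa using List.not_of_lt_findIdx (hj.trans_lt h2)
  rw [this, Finset.card_range]
  rfl

theorem PolyBdd.findIdx (hX : PSStr X) (p : α → Bool) : PolyBdd fun v => (X v).findIdx p :=
  hX.bdd.mono fun _ => List.findIdx_le_length

theorem PolyBdd.min_right {f : (ι → ℕ) → ℕ} (hf : PolyBdd f) {g : (ι → ℕ) → ℕ} :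
    PolyBdd fun v => Min.min (g v) (f v) :=
  hf.mono fun _ => min_le_right _ _

/-- The bound variable of a sum or quantifier is an arbitrary number as far as `PolyBdd` is
concerned. Taking its minimum with the actual limit changes nothing in range and makes it
polynomially bounded. -/
theorem PolyBdd.min_lift {f : (ι → ℕ) → ℕ} (hf : PolyBdd f) {g : (Option ι → ℕ) → ℕ} :
    PolyBdd fun w : Option ι → ℕ => Min.min (g w) (f fun i => w (some i)) :=
  hf.lift.min_right

end

theorem binVal_concat (u : List Bool) (b : Bool) : binVal (u ++ [b]) = 2 * binVal u + b.toNat := by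
  simp [binVal]

theorem binVal_append (u v : List Bool) :
    binVal (u ++ v) = binVal u * 2 ^ v.length + binVal v := by
  induction v using List.reverseRecOn with
  | nil => simp [binVal]
  | append_singleton v b ih =>
    rw [← List.append_assoc, binVal_concat, ih, binVal_concat, List.length_append,
      List.length_singleton, pow_succ]
    ring

theorem binVal_bitString (j : ℕ) : ∀ r < 2 ^ j, binVal (bitString j r) = r := by
  induction j with
  | zero =>
    intro r hr
    obtain rfl : r = 0 := by simpa using hr
    rfl
  | succ j ih =>
    intro r hr
    rw [pow_succ] at hr
    have h : 2 * (r / 2) + (decide (r % 2 = 1)).toNat = r := by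
      rcases Nat.mod_two_eq_zero_or_one r with h | h <;> simp [h] <;> omega
    rw [← h, bitString_succ, binVal_concat, ih _ (by omega)]

theorem binVal_eq_sum (u : List Bool) : binVal u =
    ∑ i ∈ Finset.range u.length, if u[i]? = some true then 2 ^ (u.length - 1 - i) else 0 := by
  induction u using List.reverseRecOn with
  | nil => simp [binVal]
  | append_singleton u b ih =>
    rw [binVal_concat, List.length_append, List.length_singleton, Finset.sum_range_succ, ih,
      Finset.mul_sum]
    congr 1
    · refine Finset.sum_congr rfl fun i hi => ?_
      rw [Finset.mem_range] at hi
      rw [List.getElem?_append_left hi, mul_ite, mul_zero, ← pow_succ',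
        show u.length - 1 - i + 1 = u.length + 1 - 1 - i by omega]
    · cases b <;> simp

theorem PSStr.binVal {ι : Type} [Finite ι] {X : (ι → ℕ) → List Bool} (hX : PSStr X) :
    PS fun v => binVal (X v) := by
  simp only [binVal_eq_sum]
  have h1 : PS fun w : Option ι → ℕ => (X fun i => w (some i)).length - 1 - w none :=
    hX.len.lift.pred.sub (PS.proj none)
  exact PS.sum hX.len (F := fun i v => if (X v)[i]? = some true then 2 ^ ((X v).length - 1 - i)
      else 0) (PS.ite (hX.sym.pred (· = some true))
    ((PS.const 2).pow h1 (hX.bdd.lift.mono fun v => by omega)) (PS.const 0))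

section

variable {ι : Type} [Finite ι] {n : (ι → ℕ) → ℕ}

theorem PSStr.ones (hn : PS n) (hb : PolyBdd n) : PSStr fun v => ones (n v) :=
  PSStr.replicate hn hb ()

theorem PSStr.pairCode (hn : PS n) (hb : PolyBdd n) {τ : (ι → ℕ) → List Bool} (hτ : PSStr τ) :
    PSStr fun v => pairCode (BPS.ones (n v)) (τ v) := by
  simpa [BPS.pairCode, BPS.ones] using (PSStr.replicate hn hb true).append (hτ.cons false)

theorem PTime.psStr {f : List Unit → List Unit} (hf : PTime f) (hn : PS n) (hb : PolyBdd n) :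
    PSStr fun v => f (BPS.ones (n v)) :=
  (PSStr.ones hn hb).fpspace hf.fpspace

theorem FPSpacePredicate.psp {G : List Unit → List Bool → Bool} (hG : FPSpacePredicate G)
    (hn : PS n) (hb : PolyBdd n) {τ : (ι → ℕ) → List Bool} (hτ : PSStr τ) :
    PSP fun v => G (BPS.ones (n v)) (τ v) = true := by
  obtain ⟨F, hF, h⟩ := hG
  have h1 := ((PSStr.pairCode hn hb hτ).fpspace hF).sym_at (PS.const 0)
  refine (h1.pred (· = some true)).congr fun v => ?_
  simp [h]

/-! ### The martingale of a test is computable -/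

variable {G : List Unit → List Bool → Bool} {f : List Unit → List Unit}

theorem PSP.memUpTo (hG : FPSpacePredicate G) (hf : PTime f) (hn : PS n) (hb : PolyBdd n)
    {ρ : (ι → ℕ) → List Bool} (hρ : PSStr ρ) : PSP fun v => MemUpTo G f (n v) (ρ v) := by
  have hm : PS fun w : Option ι → ℕ => Min.min (w none) (n fun i => w (some i)) :=
    (PS.proj none).min hn.lift
  have h1 : PSP fun w : Option ι → ℕ =>
      ∃ i ≤ lengthAt f (Min.min (w none) (n fun i => w (some i))),
        G (ones (Min.min (w none) (n fun i => w (some i)))) ((ρ fun i => w (some i)).take i) = true :=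
    PSP.exists_le (hf.psStr hm hb.min_lift).len
      (P := fun i w => G (ones (Min.min (w none) (n fun i => w (some i))))
        ((ρ fun i => w (some i)).take i) = true)
      (hG.psp hm.lift (PolyBdd.min_lift (g := fun w => w none) hb).lift (hρ.lift.lift.take (PS.proj none)))
  refine (PSP.forall_le hn (P := fun j v => ∃ i ≤ lengthAt f (Min.min j (n v)),
    G (ones (Min.min j (n v))) ((ρ v).take i) = true) h1).congr fun v => ?_
  refine forall_congr' fun j => forall_congr' fun hj => ?_
  rw [min_eq_left hj]

/-- A sum of `2 ^ lengthAt f (n v)` terms: here polynomial space, rather than time, is exploited. -/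
theorem PS.extCount (hG : FPSpacePredicate G) (hf : PTime f) (hn : PS n) (hb : PolyBdd n)
    {σ : (ι → ℕ) → List Bool} (hσ : PSStr σ) :
    PS fun v => extCount (MemUpTo G f (n v)) (σ v) (lengthAt f (n v)) := by
  classical
  have hl := hf.psStr hn hb
  have h1 : PSP fun w : Option ι → ℕ => MemUpTo G f (n fun i => w (some i))
      ((σ fun i => w (some i)) ++ bitString (lengthAt f (n fun i => w (some i))) (w none)) :=
    PSP.memUpTo hG hf hn.lift hb.lift
      (hσ.lift.append (PSStr.bitString hl.lift.len hl.lift.bdd (PS.proj none)))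
  unfold BPS.extCount
  exact PS.sum ((PS.const 2).pow hl.len hl.bdd)
    (F := fun r v => if MemUpTo G f (n v) (σ v ++ bitString (lengthAt f (n v)) r) then 1 else 0)
    (by convert PS.ite h1 (PS.const 1) (PS.const 0))

end

section

variable {G : List Unit → List Bool → Bool} {f : List Unit → List Unit}

/-- The number of binary digits of the values of the martingale of a test after the point. -/
def precision (f : List Unit → List Unit) (σ : List Bool) : ℕ := lengthAt f (3 * σ.length)

/-- The value of `2 ^ (k + 1) * condMeasure G f (3 * (k + 1)) ρ` with `L` binary digits. -/
noncomputable def stake (G : List Unit → List Bool → Bool) (f : List Unit → List Unit) (L k : ℕ)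
    (ρ : List Bool) : ℕ :=
  2 ^ (k + 1) * extCount (MemUpTo G f (3 * (k + 1))) ρ (lengthAt f (3 * (k + 1))) *
    2 ^ (L - lengthAt f (3 * (k + 1)))

/-- The numerator of the martingale of a test. -/
noncomputable def testNum (G : List Unit → List Bool → Bool) (f : List Unit → List Unit)
    (σ : List Bool) : ℕ :=
  2 ^ precision f σ + ∑ k ∈ Finset.range σ.length, stake G f (precision f σ) k σ -
    ∑ k ∈ Finset.range σ.length, stake G f (precision f σ) k (σ.take (k + 1))

theorem cast_stake {L k : ℕ} (hL : lengthAt f (3 * (k + 1)) ≤ L) (ρ : List Bool) :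
    (stake G f L k ρ : ℚ) = 2 ^ (k + 1) * condMeasure G f (3 * (k + 1)) ρ * 2 ^ L := by
  obtain ⟨m, rfl⟩ := Nat.exists_eq_add_of_le hL
  rw [stake, condMeasure, Nat.add_sub_cancel_left, pow_add]
  push_cast
  field_simp
  ring

theorem testMart_eq (h : IsPSpaceTest G f) (σ : List Bool) :
    testMart G f σ = testNum G f σ / 2 ^ precision f σ := by
  have hL : ∀ k ∈ Finset.range σ.length, lengthAt f (3 * (k + 1)) ≤ precision f σ := fun k hk => by
    have := Finset.mem_range.1 hk
    exact h.strictMono.monotone (by omega)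
  have h1 : testMart G f σ * 2 ^ precision f σ =
      ((2 ^ precision f σ + ∑ k ∈ Finset.range σ.length, stake G f (precision f σ) k σ : ℕ) : ℚ) -
      ((∑ k ∈ Finset.range σ.length, stake G f (precision f σ) k (σ.take (k + 1)) : ℕ) : ℚ) := by
    push_cast
    rw [testMart, add_mul, one_mul, add_sub_assoc, ← Finset.sum_sub_distrib, Finset.sum_mul]
    congr 1
    refine Finset.sum_congr rfl fun k hk => ?_
    rw [cast_stake (hL k hk), cast_stake (hL k hk), gain]
    ring
  -- Nonnegativity of the martingale makes the truncated subtraction in `testNum` exact.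
  have h2 := mul_nonneg ((isMartingale_testMart h).nonneg σ)
    (by positivity : (0 : ℚ) ≤ 2 ^ precision f σ)
  rw [h1, sub_nonneg, Nat.cast_le] at h2
  rw [eq_div_iff (by positivity), h1, testNum, Nat.cast_sub h2]

theorem PS.stake {ι : Type} [Finite ι] (hG : FPSpacePredicate G) (hf : PTime f) {L k : (ι → ℕ) → ℕ}
    (hL : PS L) (hLb : PolyBdd L) (hk : PS k) (hkb : PolyBdd k) {ρ : (ι → ℕ) → List Bool}
    (hρ : PSStr ρ) : PS fun v => stake G f (L v) (k v) (ρ v) := by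
  have h3 : PS fun v => 3 * (k v + 1) := (PS.const 3).mul hk.succ
  have h3b : PolyBdd fun v => 3 * (k v + 1) :=
    (PolyBdd.const 3).mul (hkb.add (PolyBdd.const 1))
  exact (((PS.const 2).pow hk.succ (hkb.add (PolyBdd.const 1))).mul
    (PS.extCount hG hf h3 h3b hρ)).mul ((PS.const 2).pow (hL.sub (hf.psStr h3 h3b).len)
      (hLb.mono fun v => Nat.sub_le _ _))

theorem PSStr.precision {ι : Type} [Finite ι] (hf : PTime f) {σ : (ι → ℕ) → List Bool}
    (hσ : PSStr σ) : (PS fun v => precision f (σ v)) ∧ PolyBdd fun v => precision f (σ v) := by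
  have h := hf.psStr ((PS.const 3).mul hσ.len) ((PolyBdd.const 3).mul hσ.bdd)
  exact ⟨h.len, h.bdd⟩

theorem PS.testNum {ι : Type} [Finite ι] (hG : FPSpacePredicate G) (hf : PTime f)
    {σ : (ι → ℕ) → List Bool} (hσ : PSStr σ) : PS fun v => testNum G f (σ v) := by
  obtain ⟨hp, hpb⟩ := PSStr.precision hf hσ
  have hm : PS fun w : Option ι → ℕ => Min.min (w none) (σ fun i => w (some i)).length :=
    (PS.proj none).min hσ.len.lift
  have hmb : PolyBdd fun w : Option ι → ℕ => Min.min (w none) (σ fun i => w (some i)).length :=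
    PolyBdd.min_lift (g := fun w => w none) hσ.bdd
  have h1 := PS.sum hσ.len
    (F := fun k v => BPS.stake G f (BPS.precision f (σ v)) (Min.min k (σ v).length) (σ v))
    (PS.stake hG hf hp.lift hpb.lift hm hmb hσ.lift)
  have h2 := PS.sum hσ.len
    (F := fun k v => BPS.stake G f (BPS.precision f (σ v)) (Min.min k (σ v).length)
      ((σ v).take (k + 1)))
    (PS.stake hG hf hp.lift hpb.lift hm hmb (hσ.lift.take (PS.proj none).succ))
  convert (((PS.const 2).pow hp hpb).add h1).sub h2 using 2 with v
  rw [BPS.testNum]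
  congr 1
  · congr 1
    refine Finset.sum_congr rfl fun k hk => ?_
    rw [min_eq_left (Finset.mem_range.1 hk).le]
  · refine Finset.sum_congr rfl fun k hk => ?_
    rw [min_eq_left (Finset.mem_range.1 hk).le]

theorem isFPSpaceMartingale_testMart (h : IsPSpaceTest G f) :
    IsFPSpaceMartingale (testMart G f) := by
  refine ⟨isMartingale_testMart h, fun σ =>
    (bitString (σ.length + 1) (testNum G f σ / 2 ^ precision f σ)).map digit ++
      2 :: (bitString (precision f σ) (testNum G f σ % 2 ^ precision f σ)).map digit, ?_,
    fun σ => ⟨_, _, rfl, ?_⟩⟩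
  · refine FPSpace.of_psStr ?_
    have hσ : PSStr fun v : Unit → ℕ => codeStr (v ()) := PSStr.codeStr (PS.proj ())
    obtain ⟨hp, hpb⟩ := PSStr.precision h.ptime hσ
    have hN := PS.testNum h.fpspace h.ptime hσ
    have hpow := (PS.const 2).pow hp hpb
    exact ((PSStr.bitString hσ.len.succ (hσ.bdd.add (PolyBdd.const 1)) (hN.div hpow)).map
      digit).append (((PSStr.bitString hp hpb (hN.mod hpow)).map digit).cons 2)
  -- The value is at most `2 ^ σ.length`, so `σ.length + 1` digits hold its integer part.
  · have h1 := (isMartingale_testMart h).le_two_pow σ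
    rw [testMart_eq h, div_le_iff₀ (by positivity)] at h1
    have h2 : testNum G f σ ≤ 2 ^ σ.length * 2 ^ precision f σ := by exact_mod_cast h1
    rw [binVal_bitString _ _ (Nat.mod_lt _ (by positivity)), binVal_bitString, length_bitString,
      testMart_eq h]
    · conv_lhs => rw [← Nat.div_add_mod (testNum G f σ) (2 ^ precision f σ)]
      push_cast
      field_simp
    · rw [Nat.div_lt_iff_lt_mul (by positivity)]
      refine h2.trans_lt (Nat.mul_lt_mul_of_pos_right ?_ (by positivity))
      exact Nat.pow_lt_pow_right (by norm_num) (Nat.lt_succ_self _)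

end

/-! ### The crossing test of a martingale is computable -/

/-- The numerator of the rational number with code `w`. -/
def codeNum (w : List (Fin 3)) : ℕ :=
  binVal ((w.take (w.findIdx (· == 2)) ++ w.drop (w.findIdx (· == 2) + 1)).map (· == 1))

/-- The denominator of the rational number with code `w`. -/
def codeDen (w : List (Fin 3)) : ℕ := 2 ^ (w.length - 1 - w.findIdx (· == 2))

theorem IsRatCode.le_iff {w : List (Fin 3)} {q : ℚ} (h : IsRatCode w q) (c : ℕ) :
    (c : ℚ) ≤ q ↔ c * codeDen w ≤ codeNum w := by
  obtain ⟨u, v, rfl, rfl⟩ := h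
  -- The images of `digit` are `0` and `1`, so the first `2` is the separator.
  have h1 : (u.map digit ++ 2 :: v.map digit).findIdx (· == 2) = u.length := by
    rw [List.findIdx_append, List.findIdx_eq_length_of_false]
    · simp [List.findIdx_cons]
    · intro a ha
      obtain ⟨b, -, rfl⟩ := List.mem_map.1 ha
      cases b <;> rfl
  have h2 : ∀ u : List Bool, (u.map digit).map (· == 1) = u := fun u => by
    rw [List.map_map]
    convert List.map_id u
    funext b
    cases b <;> simp [digit]
  have h3 : codeNum (u.map digit ++ 2 :: v.map digit) = binVal u * 2 ^ v.length + binVal v := by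
    rw [codeNum, h1, List.take_left' (by simp), ← binVal_append]
    congr 1
    simp [h2]
  have h4 : codeDen (u.map digit ++ 2 :: v.map digit) = 2 ^ v.length := by
    rw [codeDen, h1]
    simp
  rw [h3, h4, ← Nat.cast_le (α := ℚ)]
  push_cast
  rw [← mul_le_mul_iff_left₀ (by positivity : (0 : ℚ) < 2 ^ v.length), add_mul,
    div_mul_cancel₀ _ (by positivity)]

theorem PSP.four_pow_le {ι : Type} [Finite ι] {F : List Bool → List (Fin 3)} (hF : FPSpace F)
    {d : List Bool → ℚ} (hd : ∀ σ, IsRatCode (F σ) (d σ)) {n : (ι → ℕ) → ℕ} (hn : PS n)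
    (hb : PolyBdd n) {σ : (ι → ℕ) → List Bool} (hσ : PSStr σ) :
    PSP fun v => 4 ^ n v ≤ d (σ v) := by
  have hw := hσ.fpspace hF
  have h1 : PS fun v => codeNum (F (σ v)) :=
    (((hw.take (hw.findIdx _)).append (hw.drop (hw.findIdx _).succ)).map _).binVal
  have h2 : PS fun v => codeDen (F (σ v)) :=
    (PS.const 2).pow (hw.len.pred.sub (hw.findIdx _)) (hw.bdd.mono fun v => by omega)
  refine (PSP.le (((PS.const 4).pow hn hb).mul h2) h1).congr fun v => ?_
  rw [← (hd _).le_iff]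
  push_cast
  rfl

theorem IsFPSpaceMartingale.crossing {d : List Bool → ℚ} (hd : IsFPSpaceMartingale d) :
    FPSpacePredicate (crossing d) := by
  classical
  obtain ⟨-, F, hF, hc⟩ := hd
  -- Parses `1ⁿ0τ`: the first `false` ends the unary part, and `τ` follows it.
  let lead : List Bool → ℕ := fun x => x.findIdx (! ·)
  let P : List Bool → Prop := fun x =>
    4 ^ lead x ≤ d (x.drop (lead x + 1)) ∧ ∀ i < (x.drop (lead x + 1)).length,
      ¬ 4 ^ lead x ≤ d ((x.drop (lead x + 1)).take i)
  refine ⟨fun x => [decide (P x)], FPSpace.of_psStr ?_, fun u τ => ?_⟩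
  · have hx : PSStr fun v : Unit → ℕ => codeStr (v ()) := PSStr.codeStr (PS.proj ())
    have hl : PS fun v : Unit → ℕ => lead (codeStr (v ())) := hx.findIdx _
    have hlb : PolyBdd fun v : Unit → ℕ => lead (codeStr (v ())) := PolyBdd.findIdx hx _
    have hdr := hx.drop hl.succ
    have h1 : PSP fun v : Unit → ℕ => P (codeStr (v ())) :=
      (PSP.four_pow_le hF hc hl hlb hdr).and (PSP.forall_lt hdr.len
        (P := fun i v => ¬ 4 ^ lead (codeStr (v ())) ≤
          d (((codeStr (v ())).drop (lead (codeStr (v ())) + 1)).take i))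
        (PSP.four_pow_le hF hc hl.lift hlb.lift (hdr.lift.take (PS.proj none))).not)
    refine PSStr.of_getElem (PS.const 1) (PolyBdd.const 1)
      (s := fun _ v => if P (codeStr (v ())) then true else false)
      (FinPS.ite h1.lift (FinPS.const true) (FinPS.const false)) fun v i hi => ?_
    simp
  · have h1 : lead (pairCode u τ) = u.length := by
      simp only [lead, pairCode]
      rw [List.findIdx_append, List.findIdx_eq_length_of_false] <;> simp [List.findIdx_cons]
    have h2 : (pairCode u τ).drop (u.length + 1) = τ := by
      simp [pairCode, List.drop_append]
    simp only [P, h1, h2, BPS.crossing, not_le]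

/-! ### The three notions of randomness coincide -/

/-- The sequences on which a martingale succeeds are captured by a weak test. -/
theorem IsFPSpaceMartingale.exists_weakTest {d : List Bool → ℚ} (hd : IsFPSpaceMartingale d)
    {f : List Unit → List Unit} (hf : PTime f) : ∃ G' f', IsWeakPSpaceTest G' f' ∧
      (∀ X, (∀ n, 2 ^ n ≤ d (initSeg X (lengthAt f n))) → ∀ n, X ∈ testSet G' f' n) ∧
      ∀ X, (∀ n, X ∈ testSet G' f' n) → ∀ C, ∃ M, C < d (initSeg X M) := by
  obtain ⟨p, hp⟩ := lengthAt_le_poly hf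
  -- The threshold `4 ^ n = 2 ^ (2 * n)` is reached at length `lengthAt f (2 * n)`. A new bound is
  -- needed since `f` need not be increasing.
  obtain ⟨g, hg, hmono, hgp⟩ := exists_ptime_bound (p.comp (2 * .X))
  refine ⟨BPS.crossing d, g, hd.1.weakTest hd.crossing hg hmono, fun X hX n => ?_, fun X hX C => ?_⟩
  · refine mem_testSet_crossing (m := lengthAt f (2 * n)) ((hp _).trans ?_) ?_
    · simpa using hgp n
    · rw [show (4 : ℚ) = 2 ^ 2 by norm_num, ← pow_mul]
      exact hX (2 * n)
  · obtain ⟨n, hn⟩ := pow_unbounded_of_one_lt C (by norm_num : (1 : ℚ) < 4)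
    obtain ⟨M, hM⟩ := exists_le_of_mem_testSet (hX n)
    exact ⟨M, hn.trans_le hM⟩

/-- The martingale of a test succeeds on the sequences that do not pass the test. -/
theorem IsPSpaceTest.exists_bound {G : List Unit → List Bool → Bool} {f : List Unit → List Unit}
    (h : IsPSpaceTest G f) : ∃ g, PTime g ∧ ∀ X, (∀ n, X ∈ testSet G f n) →
      ∀ n, 2 ^ n ≤ testMart G f (initSeg X (lengthAt g n)) := by
  obtain ⟨p, hp⟩ := lengthAt_le_poly h.ptime
  obtain ⟨g, hg, -, hgp⟩ := exists_ptime_bound (p.comp (3 * (.X + 1)))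
  refine ⟨g, hg, fun X hX n => ?_⟩
  refine le_trans (pow_le_pow_right₀ (by norm_num) n.le_succ)
    (two_pow_le_testMart h hX ((hp _).trans ?_))
  simpa using hgp n

end BPS

/-! ### The equivalence and the conversion of tests. -/

theorem theorem3p12 :
    (∀ X : ℕ → Bool,
      List.TFAE [BPS.MLRandom X, BPS.WeaklyMLRandom X, BPS.MartingaleRandom X]) ∧
    (∀ (G : List Unit → List Bool → Bool) (f : List Unit → List Unit), BPS.IsPSpaceTest G f →
      ∃ (G' : List Unit → List Bool → Bool) (f' : List Unit → List Unit),
        BPS.IsWeakPSpaceTest G' f' ∧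
          (⋂ n, BPS.testSet G' f' n) = ⋂ n, BPS.testSet G f n) := by
  refine ⟨fun X => ?_, fun G f h => ?_⟩
  · tfae_have 1 → 2 := fun h G f hG => h G f hG.toIsPSpaceTest
    tfae_have 2 → 3 := by
      rintro h d hd ⟨f, hf, hX⟩
      obtain ⟨G', f', hG', h1, -⟩ := hd.exists_weakTest hf
      obtain ⟨n, hn⟩ := h G' f' hG'
      exact hn (h1 X hX n)
    tfae_have 3 → 1 := by
      intro h G f hG
      by_contra hX
      simp only [BPS.Passes, not_exists, not_not] at hX
      obtain ⟨g, hg, h1⟩ := hG.exists_bound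
      exact h _ (BPS.isFPSpaceMartingale_testMart hG) ⟨g, hg, h1 X hX⟩
    tfae_finish
  · obtain ⟨g, hg, h1⟩ := h.exists_bound
    obtain ⟨G', f', hG', h2, h3⟩ := (BPS.isFPSpaceMartingale_testMart h).exists_weakTest hg
    refine ⟨G', f', hG', ?_⟩
    ext X
    simp only [Set.mem_iInter]
    refine ⟨fun hX j => ?_, fun hX => h2 X (h1 X hX)⟩
    -- A sequence outside some `U_j` keeps `testMart` bounded, whereas lying in every component of
    -- the crossing test makes it unbounded.
    by_contra hj
    obtain ⟨C, hC⟩ := BPS.testMart_bounded h hj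
    obtain ⟨M, hM⟩ := h3 X hX C
    exact hM.not_ge (hC M)
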